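/- Setting. Let $L,H,d,\beta,V>0$, $\tau,a\ge 0$, $D=(-L,L)$, $\Omega_1=D\times(-H-d,-H)$, and $$H^2_D(D)=\{v\in H^2(D): v(\pm L)=\partial_xv(\pm L)=0\},\quad H^{-2}(D)=(H^2_D(D))',\quad \bar S_0=\{v\in H_D^2(D): v\ge -H\text{ in }D\}.$$ Let $\sigma_1\in C^2(\overline{\Omega}_1)$ with $\sigma_1>0$ on $\overline\Omega_1$, let $\sigma_2\in(0,\infty)$, and let $h_1:\bar D\times[-H-d,-H]\times[-H,\infty)\to[0,\infty)$ and $h_2:\bar D\times[-H,\infty)\times[-H,\infty)\to[0,\infty)$ be $C^2$-functions of $(x,z,w)$ such that * $h_1(x,-H,w)=h_2(x,-H,w)$ and $\sigma_1(x,-H)\,\partial_zh_1(x,-H,w)=\sigma_2\,\partial_zh_2(x,-H,w)$ for $x\in D$, $w\ge -H$; * $h_1(x,-H-d,w)=0$ and $h_2(x,w,w)=V$ for $x\in\bar D$, $w\ge -H$; * there are constants $m_1,m_2,m_3>0$ with $|\partial_xh_1|+|\partial_zh_1|\le\sqrt{m_1+m_2w^2}$ and $|\partial_wh_1|\le\sqrt{m_3}$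 at all $(x,z,w)\in\bar D\times[-H-d,-H]\times[-H,\infty)$, and $|\partial_xh_2|+|\partial_zh_2|\le\sqrt{(m_1+m_2w^2)/(H+w)}$ and $|\partial_wh_2|\le\sqrt{m_3/(H+w)}$ at all $(x,z,w)$ with $x\in\bar D$, $w>-H$, $-H\le z\le w$. For $v\in\bar S_0$ let $\mathcal C(v)=\{x\in D:v(x)=-H\}$, $\Omega_2(v)=\{(x,z):x\in D,\,-H<z<v(x)\}$, $\Sigma(v)=\{(x,-H):x\in D,\,v(x)>-H\}$ and $\Omega(v)=\Omega_1\cup\Sigma(v)\cup\Omega_2(v)$. Let $\sigma=\sigma_1$ in $\Omega_1$ and $\sigma=\sigma_2$ in $\Omega_2(v)$, and let $h_v(x,z)=h_1(x,z,v(x))$ for $z\le -H$ and $h_v(x,z)=h_2(x,z,v(x))$ for $z>-H$. Let $\psi_v\in h_v+H^1_0(\Omega(v))$ be the variational solution to $\mathrm{div}(\sigma\nabla\psi_v)=0$ in $\Omega(v)$, $\psi_v=h_v$ on $\partial\Omega(v)$, and put $\psi_{v,1}=\psi_v|_{\Omega_1}$, $\psi_{v,2}=\psi_v|_{\Omega_2(v)}$.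 For a.e. $x\in D$ define, in the sense of traces, $$g(v)(x)=\begin{cases}\frac{\sigma_2}{2}\big(1+(\partial_xv(x))^2\big)\big(\partial_z\psi_{v,2}(x,v(x))\big)^2,& x\in D\setminus\mathcal C(v),\\[1mm] \frac{\sigma_1(x,-H)^2}{2\sigma_2}\big(\partial_z\psi_{v,1}(x,-H)\big)^2,& x\in\mathcal C(v).\end{cases}$$ Let $\|\cdot\|_2$ be the norm of $L_2(D)$ and, for $v\in\bar S_0$, $$E(v)=\frac\beta2\|\partial_x^2v\|_2^2+\Big(\frac\tau2+\frac a4\|\partial_xv\|_2^2\Big)\|\partial_xv\|_2^2-\frac12\int_{\Omega(v)}\sigma|\nabla\psi_v|^2\,\mathrm d(x,z).$$ For $v\in\bar S_0$, $\xi\in H^{-2}(D)$ belongs to $\partial\mathbb I_{\bar S_0}(v)$ iff $\langle\xi,w-v\rangle\le 0$ for all $w\in\bar S_0$. For $v\in H^2_D(D)$, $\partial_x^4v\in H^{-2}(D)$ is given by $\langle\partial_x^4v,\phi\rangle=\int_D\partial_x^2v\,\partial_x^2\phi\,\mathrm dx$. Let $u_0\in\bar S_0$. A weak solution is a function $u\in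 C([0,\infty),H^1(D))\cap L_{\infty,loc}([0,\infty),H^2_D(D))\cap H^1_{loc}([0,\infty),L_2(D))$ with $u(0)=u_0$ and $u(t)\in\bar S_0$ for all $t\ge0$, such that $$\zeta:=-\partial_tu-\beta\partial_x^4u+\big(\tau+a\|\partial_xu\|_2^2\big)\partial_x^2u-g(u)\in L_{2,loc}([0,\infty),H^{-2}(D)),\qquad \zeta(t)\in\partial\mathbb I_{\bar S_0}(u(t))\ \text{ for a.e. }t\ge0,$$ such that for all $t>0$ and $v\in H^2_D(D)$ $$\int_D(u(t)-u_0)v\,\mathrm dx=-\int_0^t\!\!\int_D\big\{g(u(s))-(\tau+a\|\partial_xu(s)\|_2^2)\partial_x^2u(s)\big\}v\,\mathrm dx\,\mathrm ds-\int_0^t\!\!\int_D\beta\,\partial_x^2u(s)\,\partial_x^2v\,\mathrm dx\,\mathrm ds-\int_0^t\langle\zeta(s),v\rangle\,\mathrm ds,$$ and such that $\frac12\int_0^t\|\partial_tu(s)\|_2^2\,\mathrm ds+E(u(t))\le E(u_0)$ for all $t>0$. Claim. If $u$ is a weak solution, then $u\in L_{2,loc}([0,\infty),H^s(D))$ for every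 $s\in(2,7/2)$, and $-\zeta\in L_{2,loc}([0,\infty),\mathcal M_+(D))$. The latter means that there are finite nonnegative Radon measures $\mu(t)$, $t>0$, on $D$ such that $\langle-\zeta(t),v\rangle=\int_Dv\,\mathrm d\mu(t)$ for a.e. $t>0$ and all $v\in H^2_D(D)$, that $t\mapsto\int_Df\,\mathrm d\mu(t)$ is measurable for all $f\in C_0(D)$, and that $\int_0^T\mu(t)(D)^2\,\mathrm dt<\infty$ for all $T>0$. -/

import Mathlib

open MeasureTheory Set Filter Topology
open scoped ENNReal NNReal ContDiff ZeroAtInfty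

noncomputable section

namespace MEMS

/-! ### Weak derivatives and Sobolev spaces -/

/-- Test functions on `U`: the elements of `C_c^∞(U)`. -/
def IsTestFun {E : Type*} [NormedAddCommGroup E] [NormedSpace ℝ E] (U : Set E) (φ : E → ℝ) : Prop :=
  ContDiff ℝ ∞ φ ∧ HasCompactSupport φ ∧ tsupport φ ⊆ U

/-- `f'` is the weak derivative of `f` on `U` in the direction `e`. -/
def HasWeakDeriv {E : Type*} [NormedAddCommGroup E] [NormedSpace ℝ E] [MeasureSpace E]
    (U : Set E) (e : E) (f f' : E → ℝ) : Prop :=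
  LocallyIntegrableOn f U volume ∧ LocallyIntegrableOn f' U volume ∧
    ∀ φ : E → ℝ, IsTestFun U φ →
      ∫ x in U, f x * fderiv ℝ φ x e = - ∫ x in U, f' x * φ x

open Classical in
/-- A representative of the weak derivative (unique up to null sets on `U`) when it exists,
and `0` otherwise. -/
def weakDeriv {E : Type*} [NormedAddCommGroup E] [NormedSpace ℝ E] [MeasureSpace E]
    (U : Set E) (e : E) (f : E → ℝ) : E → ℝ :=
  if h : ∃ f', HasWeakDeriv U e f f' then h.choose else 0

/-- The interval `D = (-L, L)`. -/
abbrev dom (L : ℝ) : Set ℝ := Ioo (-L) L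

/-- The weak derivative `∂ₓ v` on `D`. -/
def dx (L : ℝ) (v : ℝ → ℝ) : ℝ → ℝ := weakDeriv (dom L) 1 v

/-- The space `H^k(D)`, for an integer `k`. -/
def MemHk (L : ℝ) (k : ℕ) (v : ℝ → ℝ) : Prop :=
  (∀ j ≤ k, MemLp ((dx L)^[j] v) 2 (volume.restrict (dom L))) ∧
    ∀ j < k, HasWeakDeriv (dom L) 1 ((dx L)^[j] v) ((dx L)^[j + 1] v)

open Classical in
/-- The squared Gagliardo seminorm of order `θ ∈ (0,1)` on `D`; it is absent for `θ = 0`. -/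
def gagliardoSq (L θ : ℝ) (f : ℝ → ℝ) : ℝ≥0∞ :=
  if θ = 0 then 0 else
    ∫⁻ x in dom L, ∫⁻ y in dom L, ENNReal.ofReal ((f x - f y) ^ 2 / |x - y| ^ (1 + 2 * θ))

open Classical in
/-- The norm of the Sobolev(-Slobodeckii) space `H^s(D)`, `s ≥ 0`, extended by `∞` to functions
that do not belong to the space; `s = 0` is the norm of `L₂(D)`. -/
def normH (L s : ℝ) (v : ℝ → ℝ) : ℝ≥0∞ :=
  if MemHk L ⌊s⌋₊ v then
    ((∑ j ∈ Finset.range (⌊s⌋₊ + 1), eLpNorm ((dx L)^[j] v) 2 (volume.restrict (dom L)) ^ 2)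
      + gagliardoSq L (Int.fract s) ((dx L)^[⌊s⌋₊] v)) ^ (1 / 2 : ℝ)
  else ⊤

/-- `v` is the `C¹([-L,L])`-representative of an element of
`H²_D(D) = {v ∈ H²(D) : v(±L) = ∂ₓv(±L) = 0}`. -/
def MemH2D (L : ℝ) (v : ℝ → ℝ) : Prop :=
  MemHk L 2 v ∧ ContDiffOn ℝ 1 v (Icc (-L) L) ∧ v (-L) = 0 ∧ v L = 0 ∧
    derivWithin v (Icc (-L) L) (-L) = 0 ∧ derivWithin v (Icc (-L) L) L = 0

open Classical in
/-- The norm of `H²_D(D)` (that of `H²(D)`), extended by `∞` outside the space. -/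
def normH2D (L : ℝ) (v : ℝ → ℝ) : ℝ≥0∞ := if MemH2D L v then normH L 2 v else ⊤

/-- The norm of the dual space `H^{-2}(D) = (H²_D(D))'`, for a functional given by its values on
the elements of `H²_D(D)`. -/
def normHneg2 (L : ℝ) (ξ : (ℝ → ℝ) → ℝ) : ℝ≥0∞ :=
  ⨆ (v : ℝ → ℝ) (_ : MemH2D L v ∧ normH L 2 v ≤ 1), ENNReal.ofReal |ξ v|

/-! ### Functions of time with values in function spaces

A space of functions on `D` is described by its extended norm `N`, which is `∞` outside it. -/

/-- `u : [0,∞) → X` is strongly measurable: it is a.e. a limit in `X` of simple functions. -/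
def StronglyMeas (N : (ℝ → ℝ) → ℝ≥0∞) (u : ℝ → ℝ → ℝ) : Prop :=
  ∃ w : ℕ → SimpleFunc ℝ (ℝ → ℝ), (∀ n t, N (w n t) < ⊤) ∧
    ∀ᵐ t ∂volume.restrict (Ioi (0 : ℝ)), Tendsto (fun n => N (w n t - u t)) atTop (𝓝 0)

/-- `u ∈ L_{2,loc}([0,∞), X)`. -/
def MemL2Loc (N : (ℝ → ℝ) → ℝ≥0∞) (u : ℝ → ℝ → ℝ) : Prop :=
  StronglyMeas N u ∧ ∀ T > 0, ∫⁻ t in Ioo (0 : ℝ) T, N (u t) ^ 2 < ⊤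

/-- `u ∈ L_{∞,loc}([0,∞), X)`. -/
def MemLinftyLoc (N : (ℝ → ℝ) → ℝ≥0∞) (u : ℝ → ℝ → ℝ) : Prop :=
  StronglyMeas N u ∧ ∀ T > 0, essSup (fun t => N (u t)) (volume.restrict (Ioo (0 : ℝ) T)) < ⊤

/-- `u ∈ C([0,∞), X)`. -/
def ContIn (N : (ℝ → ℝ) → ℝ≥0∞) (u : ℝ → ℝ → ℝ) : Prop :=
  ∀ t ≥ 0, N (u t) < ⊤ ∧ Tendsto (fun s => N (u s - u t)) (𝓝[Ici 0] t) (𝓝 0)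

/-- `w ∈ L_{2,loc}([0,∞), L₂(D))` is the weak time derivative of `u`. -/
def IsTimeDeriv (L : ℝ) (u w : ℝ → ℝ → ℝ) : Prop :=
  MemL2Loc (normH L 0) w ∧
    ∀ φ : ℝ → ℝ, IsTestFun (Ioi 0) φ → ∀ η : ℝ → ℝ, IsTestFun (dom L) η →
      ∫ t in Ioi 0, deriv φ t * ∫ x in dom L, u t x * η x
        = - ∫ t in Ioi 0, φ t * ∫ x in dom L, w t x * η x

/-- `u ∈ H¹_loc([0,∞), L₂(D))`. -/
def MemH1Loc (L : ℝ) (u : ℝ → ℝ → ℝ) : Prop :=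
  MemL2Loc (normH L 0) u ∧ ∃ w, IsTimeDeriv L u w

open Classical in
/-- The time derivative `∂ₜ u` of `u ∈ H¹_loc([0,∞), L₂(D))`. -/
def timeDeriv (L : ℝ) (u : ℝ → ℝ → ℝ) : ℝ → ℝ → ℝ :=
  if h : ∃ w, IsTimeDeriv L u w then h.choose else 0

/-- `ξ ∈ L_{2,loc}([0,∞), H^{-2}(D))`; as `H^{-2}(D)` is separable and reflexive,
strong measurability is the measurability of all `t ↦ ⟨ξ(t), v⟩`. -/
def MemL2LocHneg2 (L : ℝ) (ξ : ℝ → (ℝ → ℝ) → ℝ) : Prop :=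
  (∀ v, MemH2D L v → AEMeasurable (fun t => ξ t v) (volume.restrict (Ioi 0))) ∧
    ∀ T > 0, ∫⁻ t in Ioo (0 : ℝ) T, normHneg2 L (ξ t) ^ 2 < ⊤

/-- `ξ ∈ L_{2,loc}([0,∞), M₊(D))`: for a.e. `t` the functional `ξ(t)` on `H²_D(D)` is the
integration against a finite nonnegative Borel measure `μ(t)` on `D`, the map `t ↦ μ(t)` into
`M(D) = C₀(D)'` is weak-* measurable, and `t ↦ ‖μ(t)‖ = μ(t)(D)` lies in `L_{2,loc}([0,∞))`. -/
def MemL2LocMeasPos (L : ℝ) (ξ : ℝ → (ℝ → ℝ) → ℝ) : Prop :=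
  ∃ μ : ℝ → FiniteMeasure (dom L),
    (∀ᵐ t ∂volume.restrict (Ioi (0 : ℝ)), ∀ v, MemH2D L v →
      ξ t v = ∫ x : dom L, v x ∂(μ t : Measure (dom L))) ∧
    (∀ f : C₀(dom L, ℝ), AEMeasurable (fun t => ∫ x : dom L, f x ∂(μ t : Measure (dom L)))
      (volume.restrict (Ioi 0))) ∧
    AEMeasurable (fun t => (μ t).mass) (volume.restrict (Ioi 0)) ∧
    ∀ T > 0, ∫⁻ t in Ioo (0 : ℝ) T, ((μ t).mass : ℝ≥0∞) ^ 2 < ⊤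

/-! ### Sobolev spaces on planar sets -/

/-- The weak derivative in the first variable `x`. -/
def pdx (U : Set (ℝ × ℝ)) (f : ℝ × ℝ → ℝ) : ℝ × ℝ → ℝ := weakDeriv U (1, 0) f

/-- The weak derivative in the second variable `z`. -/
def pdz (U : Set (ℝ × ℝ)) (f : ℝ × ℝ → ℝ) : ℝ × ℝ → ℝ := weakDeriv U (0, 1) f

/-- The space `H¹(U)`. -/
def MemH1 (U : Set (ℝ × ℝ)) (f : ℝ × ℝ → ℝ) : Prop :=
  MemLp f 2 (volume.restrict U) ∧
    (HasWeakDeriv U (1, 0) f (pdx U f) ∧ MemLp (pdx U f) 2 (volume.restrict U)) ∧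
    (HasWeakDeriv U (0, 1) f (pdz U f) ∧ MemLp (pdz U f) 2 (volume.restrict U))

/-- The space `H¹₀(U)`, the closure of `C_c^∞(U)` in `H¹(U)`. -/
def MemH10 (U : Set (ℝ × ℝ)) (f : ℝ × ℝ → ℝ) : Prop :=
  MemH1 U f ∧ ∃ φ : ℕ → ℝ × ℝ → ℝ, (∀ n, IsTestFun U (φ n)) ∧
    Tendsto (fun n => eLpNorm (f - φ n) 2 (volume.restrict U)) atTop (𝓝 0) ∧
    Tendsto (fun n => eLpNorm (fun p => pdx U f p - fderiv ℝ (φ n) p (1, 0)) 2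
      (volume.restrict U)) atTop (𝓝 0) ∧
    Tendsto (fun n => eLpNorm (fun p => pdz U f p - fderiv ℝ (φ n) p (0, 1)) 2
      (volume.restrict U)) atTop (𝓝 0)

/-- The trace at `(x, b)` along the vertical segment below that point, as the limit of the
vertical averages. For `f ∈ H¹` of the region below the curve `{(x, b x)}` this is the usual
trace on the curve, for almost every `x`. -/
def traceBelow (f : ℝ × ℝ → ℝ) (x b : ℝ) : ℝ :=
  limUnder (𝓝[>] (0 : ℝ)) (fun ε => ε⁻¹ * ∫ z in (b - ε)..b, f (x, z))

/-! ### The device -/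

/-- The data of the device: the geometry `L`, `H`, `d`, the mechanical parameters `β`, `τ`, `a`,
the potential value `V`, the permittivities `σ₁` and `σ₂`, and the boundary data `h₁`, `h₂`. -/
structure Data where
  L : ℝ
  H : ℝ
  d : ℝ
  β : ℝ
  τ : ℝ
  a : ℝ
  V : ℝ
  σ₁ : ℝ → ℝ → ℝ
  σ₂ : ℝ
  h₁ : ℝ → ℝ → ℝ → ℝ
  h₂ : ℝ → ℝ → ℝ → ℝ

namespace Data

/-- The standing assumptions on the data. -/
structure Admissible (P : Data) : Prop where
  L_pos : 0 < P.L
  H_pos : 0 < P.H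
  d_pos : 0 < P.d
  β_pos : 0 < P.β
  τ_nonneg : 0 ≤ P.τ
  a_nonneg : 0 ≤ P.a
  V_pos : 0 < P.V
  -- the permittivity
  σ₁_smooth : ContDiffOn ℝ 2 (fun p : ℝ × ℝ => P.σ₁ p.1 p.2)
    (Icc (-P.L) P.L ×ˢ Icc (-P.H - P.d) (-P.H))
  σ₁_pos : ∀ x ∈ Icc (-P.L) P.L, ∀ z ∈ Icc (-P.H - P.d) (-P.H), 0 < P.σ₁ x z
  σ₂_pos : 0 < P.σ₂
  -- the boundary data
  h₁_smooth : ContDiffOn ℝ 2 (fun p : ℝ × ℝ × ℝ => P.h₁ p.1 p.2.1 p.2.2)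
    (Icc (-P.L) P.L ×ˢ Icc (-P.H - P.d) (-P.H) ×ˢ Ici (-P.H))
  h₂_smooth : ContDiffOn ℝ 2 (fun p : ℝ × ℝ × ℝ => P.h₂ p.1 p.2.1 p.2.2)
    (Icc (-P.L) P.L ×ˢ Ici (-P.H) ×ˢ Ici (-P.H))
  h₁_nonneg : ∀ x ∈ Icc (-P.L) P.L, ∀ z ∈ Icc (-P.H - P.d) (-P.H), ∀ w ≥ -P.H, 0 ≤ P.h₁ x z w
  h₂_nonneg : ∀ x ∈ Icc (-P.L) P.L, ∀ z ≥ -P.H, ∀ w ≥ -P.H, 0 ≤ P.h₂ x z w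
  -- transmission conditions
  jump : ∀ x ∈ dom P.L, ∀ w ≥ -P.H, P.h₁ x (-P.H) w = P.h₂ x (-P.H) w
  jump_deriv : ∀ x ∈ dom P.L, ∀ w ≥ -P.H,
    P.σ₁ x (-P.H) * derivWithin (fun z => P.h₁ x z w) (Icc (-P.H - P.d) (-P.H)) (-P.H)
      = P.σ₂ * derivWithin (fun z => P.h₂ x z w) (Ici (-P.H)) (-P.H)
  -- values on the bottom plate and on the elastic plate
  bottom : ∀ x ∈ Icc (-P.L) P.L, ∀ w ≥ -P.H, P.h₁ x (-P.H - P.d) w = 0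
  top : ∀ x ∈ Icc (-P.L) P.L, ∀ w ≥ -P.H, P.h₂ x w w = P.V
  -- growth conditions
  growth : ∃ m₁ m₂ m₃ : ℝ, 0 < m₁ ∧ 0 < m₂ ∧ 0 < m₃ ∧
    (∀ x ∈ Icc (-P.L) P.L, ∀ z ∈ Icc (-P.H - P.d) (-P.H), ∀ w ≥ -P.H,
      |derivWithin (fun y => P.h₁ y z w) (Icc (-P.L) P.L) x|
        + |derivWithin (fun y => P.h₁ x y w) (Icc (-P.H - P.d) (-P.H)) z| ≤ √(m₁ + m₂ * w ^ 2) ∧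
      |derivWithin (fun y => P.h₁ x z y) (Ici (-P.H)) w| ≤ √m₃) ∧
    (∀ x ∈ Icc (-P.L) P.L, ∀ w > -P.H, ∀ z ∈ Icc (-P.H) w,
      |derivWithin (fun y => P.h₂ y z w) (Icc (-P.L) P.L) x|
        + |derivWithin (fun y => P.h₂ x y w) (Ici (-P.H)) z|
          ≤ √((m₁ + m₂ * w ^ 2) / (P.H + w)) ∧
      |derivWithin (fun y => P.h₂ x z y) (Ici (-P.H)) w| ≤ √(m₃ / (P.H + w)))

variable (P : Data)

/-- The closed convex set of admissible deformations `S̄₀ = {v ∈ H²_D(D) : v ≥ -H in D}`. -/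
def MemSbar (v : ℝ → ℝ) : Prop := MemH2D P.L v ∧ ∀ x ∈ dom P.L, -P.H ≤ v x

/-- The insulating layer `Ω₁ = D × (-H-d, -H)`. -/
def Omega1 : Set (ℝ × ℝ) := dom P.L ×ˢ Ioo (-P.H - P.d) (-P.H)

/-- The region `Ω₂(v)` between the layer and the elastic plate. -/
def Omega2 (v : ℝ → ℝ) : Set (ℝ × ℝ) := {p | p.1 ∈ dom P.L ∧ -P.H < p.2 ∧ p.2 < v p.1}

/-- The interface `Σ(v)`. -/
def interface (v : ℝ → ℝ) : Set (ℝ × ℝ) := {p | p.1 ∈ dom P.L ∧ p.2 = -P.H ∧ -P.H < v p.1}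

/-- The domain `Ω(v) = Ω₁ ∪ Σ(v) ∪ Ω₂(v)`. -/
def Omega (v : ℝ → ℝ) : Set (ℝ × ℝ) := P.Omega1 ∪ P.interface v ∪ P.Omega2 v

open Classical in
/-- The permittivity `σ`. -/
def sigma (p : ℝ × ℝ) : ℝ := if p.2 ≤ -P.H then P.σ₁ p.1 p.2 else P.σ₂

open Classical in
/-- The boundary data `h_v`. -/
def hBdry (v : ℝ → ℝ) (p : ℝ × ℝ) : ℝ :=
  if p.2 ≤ -P.H then P.h₁ p.1 p.2 (v p.1) else P.h₂ p.1 p.2 (v p.1)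

/-- `ψ ∈ h_v + H¹₀(Ω(v))` is the variational solution to the transmission problem
`div(σ∇ψ) = 0` in `Ω(v)`, `ψ = h_v` on `∂Ω(v)`. -/
def IsPotential (v : ℝ → ℝ) (ψ : ℝ × ℝ → ℝ) : Prop :=
  MemH1 (P.Omega v) ψ ∧ MemH10 (P.Omega v) (ψ - P.hBdry v) ∧
    ∀ φ, IsTestFun (P.Omega v) φ →
      ∫ p in P.Omega v, P.sigma p * (pdx (P.Omega v) ψ p * fderiv ℝ φ p (1, 0)
        + pdz (P.Omega v) ψ p * fderiv ℝ φ p (0, 1)) = 0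

open Classical in
/-- The electrostatic potential `ψ_v` (unique up to null sets on `Ω(v)`). -/
def potential (v : ℝ → ℝ) : ℝ × ℝ → ℝ :=
  if h : ∃ ψ, P.IsPotential v ψ then h.choose else 0

open Classical in
/-- The electrostatic force `g(v)`. On the coincidence set `{v = -H}` the trace of `∂_z ψ_v` is
taken from `Ω₁`, elsewhere from `Ω₂(v)`. -/
def force (v : ℝ → ℝ) (x : ℝ) : ℝ :=
  if v x = -P.H then
    P.σ₁ x (-P.H) ^ 2 / (2 * P.σ₂)
      * traceBelow (pdz (P.Omega v) (P.potential v)) x (-P.H) ^ 2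
  else
    P.σ₂ / 2 * (1 + dx P.L v x ^ 2)
      * traceBelow (pdz (P.Omega v) (P.potential v)) x (v x) ^ 2

/-- The squared norm `‖f‖₂²` in `L₂(D)`. -/
def sqNorm (f : ℝ → ℝ) : ℝ := ∫ x in dom P.L, f x ^ 2

/-- The mechanical energy. -/
def energyM (v : ℝ → ℝ) : ℝ :=
  P.β / 2 * P.sqNorm (dx P.L (dx P.L v))
    + (P.τ / 2 + P.a / 4 * P.sqNorm (dx P.L v)) * P.sqNorm (dx P.L v)

open Classical in
/-- The contact energy. -/
def energyC (v : ℝ → ℝ) : ℝ≥0∞ := ∫⁻ x in dom P.L, if -P.H ≤ v x then 0 else ⊤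

/-- The electrostatic energy. -/
def energyE (v : ℝ → ℝ) : ℝ :=
  -(1 / 2) * ∫ p in P.Omega v, P.sigma p *
    (pdx (P.Omega v) (P.potential v) p ^ 2 + pdz (P.Omega v) (P.potential v) p ^ 2)

/-- The total energy. -/
def energy (v : ℝ → ℝ) : EReal := ((P.energyM v + P.energyE v : ℝ) : EReal) + (P.energyC v : EReal)

/-- The multiplier `ζ(t) = -∂ₜu - β∂ₓ⁴u + (τ + a‖∂ₓu‖₂²)∂ₓ²u - g(u)`, as a functional on
`H²_D(D)`, with `⟨∂ₓ⁴u, v⟩ = ∫ ∂ₓ²u ∂ₓ²v dx`. -/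
def zeta (u : ℝ → ℝ → ℝ) (t : ℝ) (v : ℝ → ℝ) : ℝ :=
  - (∫ x in dom P.L, timeDeriv P.L u t x * v x)
    - P.β * (∫ x in dom P.L, dx P.L (dx P.L (u t)) x * dx P.L (dx P.L v) x)
    + (P.τ + P.a * P.sqNorm (dx P.L (u t))) * (∫ x in dom P.L, dx P.L (dx P.L (u t)) x * v x)
    - ∫ x in dom P.L, P.force (u t) x * v x

/-- `ξ ∈ ∂𝕀_{S̄₀}(v)`. -/
def MemSubdiff (ξ : (ℝ → ℝ) → ℝ) (v : ℝ → ℝ) : Prop := ∀ w, P.MemSbar w → ξ (w - v) ≤ 0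

/-- Weak solutions to the evolution problem with initial value `u₀`. -/
structure IsWeakSolution (u₀ : ℝ → ℝ) (u : ℝ → ℝ → ℝ) : Prop where
  cont : ContIn (normH P.L 1) u
  bdd : MemLinftyLoc (normH2D P.L) u
  time : MemH1Loc P.L u
  constraint : ∀ t ≥ 0, P.MemSbar (u t)
  init : ∀ x ∈ dom P.L, u 0 x = u₀ x
  /-- The integrals of `g(u(t)) v` that occur below make sense. -/
  pairing : ∀ᵐ t ∂volume.restrict (Ioi (0 : ℝ)), ∀ v, MemH2D P.L v →
    IntegrableOn (fun x => P.force (u t) x * v x) (dom P.L)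
  zeta_mem : MemL2LocHneg2 P.L (P.zeta u)
  weak : ∀ t > 0, ∀ v, MemH2D P.L v →
    ∫ x in dom P.L, (u t x - u₀ x) * v x =
      - (∫ s in (0 : ℝ)..t, ∫ x in dom P.L,
          (P.force (u s) x
            - (P.τ + P.a * P.sqNorm (dx P.L (u s))) * dx P.L (dx P.L (u s)) x) * v x)
      - (∫ s in (0 : ℝ)..t, ∫ x in dom P.L,
          P.β * dx P.L (dx P.L (u s)) x * dx P.L (dx P.L v) x)
      - ∫ s in (0 : ℝ)..t, P.zeta u s v
  subdiff : ∀ᵐ t ∂volume.restrict (Ioi (0 : ℝ)), P.MemSubdiff (P.zeta u t) (u t)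
  energy_le : ∀ t > 0,
    (((1 / 2) * ∫ s in (0 : ℝ)..t, P.sqNorm (timeDeriv P.L u s) : ℝ) : EReal) + P.energy (u t)
      ≤ P.energy u₀

end Data

end MEMS

end

/-! At almost every time the evolution reduces to a stationary equation, β∂ₓ⁴u = -ζ - ∂ₜu + (τ +
a‖∂ₓu‖²)∂ₓ²u - g(u) on D. If its right-hand side is a finite measure, then ∂ₓ³u is a function of
bounded variation, and such functions lie in H^θ(D) for θ < 1/2; this is the range s < 7/2. The work
consists in showing that -ζ and g(u) have finite mass, with bounds that are square integrable in
time. The resulting bound on the variation of ∂ₓ³u(t) is C(1 + ‖∂ₜu(t)‖₂ + |⟨ζ(t), χ⟩|), with C and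
the cutoff χ depending only on the local bound of u in H².

The multiplier. A bound in H² and the clamped boundary conditions keep the plate above -H/8 outside
some interval [-r, r], r < L. Hence u + εφ is admissible for small ε as soon as φ ≥ 0 on [-r, r]
(`residual_nonneg`), so -ζ is a positive functional that sees only restrictions to [-r, r]. The M.
Riesz extension theorem and the Riesz-Markov-Kakutani theorem turn it into a measure
(`exists_finiteMeasure_of_nonneg`). Its mass is ⟨-ζ, χ⟩ for any cutoff χ = 1 on [-r, r], which the
H^{-2}-norm controls. Positivity on nonnegative functions alone would not exclude infinite mass near
±L.

The force. Where u ≥ -H/8, an L₁-bound follows from an estimate of order ε for the energy of ψ_u in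
the strip of width ε below the plate (`exists_strip_bound`). The variational equation is tested with
η(Φ(x, z+ε) - Φ(x, z)), where Φ approximates ψ_u - h_u: upward translation does not increase the
energy weighted by the monotone cutoff η, and the energy of the points pushed out of the domain is a
gain that the errors of order ε have to pay for. Only the fact that the domain lies below a graph
enters, not the H²-regularity of ψ_u. Fatou's lemma passes from strips to traces. The remaining
points lie in [-r, r], where χ = 1; since g ≥ 0, the integral of gχ, read off from the equation
itself, bounds the force there (`exists_integral_force_le`).

Time dependence. The measures μ(t) are chosen separately for each t; their measurability follows
from that of ⟨ζ(t), φ⟩. Strong measurability in H^s is obtained by replacing H²-approximations by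
almost nearest elements among the functions with a prescribed bound on the variation of ∂ₓ³; under
such a bound, convergence in H² implies convergence in H^s (`tendsto_normH`). -/

namespace MEMS

/-! ### Test functions and weak derivatives on subsets of a normed space. -/

section WeakDerivatives

variable {E : Type*} [NormedAddCommGroup E] [NormedSpace ℝ E]

theorem IsTestFun.continuous {U : Set E} {φ : E → ℝ} (hφ : IsTestFun U φ) : Continuous φ :=
  hφ.1.continuous

theorem IsTestFun.differentiable {U : Set E} {φ : E → ℝ} (hφ : IsTestFun U φ) :
    Differentiable ℝ φ := hφ.1.differentiable (by simp)

theorem IsTestFun.continuous_fderiv {U : Set E} {φ : E → ℝ} (hφ : IsTestFun U φ) (e : E) :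
    Continuous (fun x => fderiv ℝ φ x e) :=
  (hφ.1.continuous_fderiv (by simp)).clm_apply continuous_const

theorem IsTestFun.mono {U V : Set E} {φ : E → ℝ} (hφ : IsTestFun U φ) (h : U ⊆ V) :
    IsTestFun V φ := ⟨hφ.1, hφ.2.1, hφ.2.2.trans h⟩

theorem IsTestFun.hasCompactSupport_fderiv {U : Set E} {φ : E → ℝ} (hφ : IsTestFun U φ) (e : E) :
    HasCompactSupport (fun x => fderiv ℝ φ x e) := hφ.2.1.fderiv_apply ℝ e

theorem tsupport_fderiv_apply_subset' (φ : E → ℝ) (e : E) :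
    tsupport (fun x => fderiv ℝ φ x e) ⊆ tsupport φ := tsupport_fderiv_apply_subset ℝ e

theorem IsTestFun.fderiv_apply {U : Set E} {φ : E → ℝ} (hφ : IsTestFun U φ) (e : E) :
    IsTestFun U (fun x => fderiv ℝ φ x e) :=
  ⟨(hφ.1.fderiv_right (m := ∞) (by simp)).clm_apply contDiff_const,
    hφ.hasCompactSupport_fderiv e, (tsupport_fderiv_apply_subset' φ e).trans hφ.2.2⟩

theorem IsTestFun.add {U : Set E} {φ χ : E → ℝ} (hφ : IsTestFun U φ) (hχ : IsTestFun U χ) :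
    IsTestFun U (fun x => φ x + χ x) :=
  ⟨hφ.1.add hχ.1, hφ.2.1.add hχ.2.1,
    (tsupport_add φ χ).trans (union_subset hφ.2.2 hχ.2.2)⟩

theorem IsTestFun.const_mul {U : Set E} {φ : E → ℝ} (hφ : IsTestFun U φ) (c : ℝ) :
    IsTestFun U (fun x => c * φ x) :=
  ⟨contDiff_const.mul hφ.1, hφ.2.1.mul_left,
    (tsupport_mul_subset_right).trans hφ.2.2⟩

theorem IsTestFun.smooth_mul {U : Set E} {φ η : E → ℝ} (hφ : IsTestFun U φ)
    (hη : ContDiff ℝ ∞ η) : IsTestFun U (fun x => η x * φ x) :=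
  ⟨hη.mul hφ.1, hφ.2.1.mul_left, (tsupport_mul_subset_right).trans hφ.2.2⟩

theorem IsTestFun.sub {U : Set E} {φ χ : E → ℝ} (hφ : IsTestFun U φ) (hχ : IsTestFun U χ) :
    IsTestFun U (fun x => φ x - χ x) := by
  simpa [sub_eq_add_neg] using hφ.add (hχ.const_mul (-1))

variable [MeasureSpace E]

theorem IsTestFun.integrable_mul [OpensMeasurableSpace E] {U : Set E} {f φ : E → ℝ}
    (hf : LocallyIntegrableOn f U volume)
    (hφ : Continuous φ) (hc : HasCompactSupport φ) (hs : tsupport φ ⊆ U) :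
    Integrable (fun x => f x * φ x) (volume.restrict U) := by
  have h1 : IntegrableOn f (tsupport φ) volume := hf.integrableOn_compact_subset hs hc
  have h2 : IntegrableOn (fun x => f x * φ x) (tsupport φ) volume :=
    h1.mul_continuousOn hφ.continuousOn hc
  have h3 : Integrable (fun x => f x * φ x) volume := by
    refine (integrableOn_iff_integrable_of_support_subset ?_).1 h2
    intro x hx
    apply subset_tsupport
    simp only [Function.mem_support] at hx ⊢
    exact fun h => hx (by simp [h])
  exact h3.restrict

theorem HasWeakDeriv.integrable_left [OpensMeasurableSpace E] {U : Set E} {e : E} {f f' : E → ℝ}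
    (h : HasWeakDeriv U e f f')
    {φ : E → ℝ} (hφ : IsTestFun U φ) :
    Integrable (fun x => f x * fderiv ℝ φ x e) (volume.restrict U) :=
  IsTestFun.integrable_mul h.1 (hφ.continuous_fderiv e) (hφ.hasCompactSupport_fderiv e)
    ((tsupport_fderiv_apply_subset' φ e).trans hφ.2.2)

theorem HasWeakDeriv.integrable_right [OpensMeasurableSpace E] {U : Set E} {e : E} {f f' : E → ℝ}
    (h : HasWeakDeriv U e f f')
    {φ : E → ℝ} (hφ : IsTestFun U φ) :
    Integrable (fun x => f' x * φ x) (volume.restrict U) :=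
  IsTestFun.integrable_mul h.2.1 hφ.continuous hφ.2.1 hφ.2.2

theorem locallyIntegrableOn_congr_restrict {U : Set E} {f g : E → ℝ}
    (hf : LocallyIntegrableOn f U volume) (h : f =ᵐ[volume.restrict U] g) :
    LocallyIntegrableOn g U volume := by
  intro x hx
  obtain ⟨s, hs, hs'⟩ := hf x hx
  refine ⟨s ∩ U, inter_mem hs self_mem_nhdsWithin, ?_⟩
  exact (hs'.mono_set inter_subset_left).congr (ae_restrict_of_ae_restrict_of_subset inter_subset_right h)

theorem HasWeakDeriv.congr {U : Set E} {e : E} {f f' g g' : E → ℝ}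
    (h : HasWeakDeriv U e f f') (hf : f =ᵐ[volume.restrict U] g)
    (hf' : f' =ᵐ[volume.restrict U] g') : HasWeakDeriv U e g g' := by
  refine ⟨locallyIntegrableOn_congr_restrict h.1 hf,
    locallyIntegrableOn_congr_restrict h.2.1 hf', fun φ hφ => ?_⟩
  have e1 : ∫ x in U, g x * fderiv ℝ φ x e = ∫ x in U, f x * fderiv ℝ φ x e :=
    integral_congr_ae (by filter_upwards [hf] with x hx; rw [hx])
  have e2 : ∫ x in U, g' x * φ x = ∫ x in U, f' x * φ x :=
    integral_congr_ae (by filter_upwards [hf'] with x hx; rw [hx])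
  rw [e1, e2]
  exact h.2.2 φ hφ

theorem HasWeakDeriv.add [OpensMeasurableSpace E] {U : Set E} {e : E} {f f' g g' : E → ℝ}
    (h : HasWeakDeriv U e f f') (k : HasWeakDeriv U e g g') :
    HasWeakDeriv U e (f + g) (f' + g') := by
  refine ⟨h.1.add k.1, h.2.1.add k.2.1, fun φ hφ => ?_⟩
  simp only [Pi.add_apply, add_mul]
  rw [integral_add (h.integrable_left hφ) (k.integrable_left hφ),
    integral_add (h.integrable_right hφ) (k.integrable_right hφ), h.2.2 φ hφ, k.2.2 φ hφ]
  ring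

theorem locallyIntegrableOn_const_mul {U : Set E} {f : E → ℝ}
    (hf : LocallyIntegrableOn f U volume) (c : ℝ) :
    LocallyIntegrableOn (fun x => c * f x) U volume := by
  intro x hx
  obtain ⟨s, hs, hs'⟩ := hf x hx
  exact ⟨s, hs, Integrable.const_mul hs' c⟩

theorem HasWeakDeriv.const_mul {U : Set E} {e : E} {f f' : E → ℝ}
    (h : HasWeakDeriv U e f f') (c : ℝ) :
    HasWeakDeriv U e (fun x => c * f x) (fun x => c * f' x) := by
  refine ⟨locallyIntegrableOn_const_mul h.1 c, locallyIntegrableOn_const_mul h.2.1 c, fun φ hφ => ?_⟩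
  simp only [mul_assoc]
  rw [integral_const_mul, integral_const_mul, h.2.2 φ hφ]
  ring

theorem HasWeakDeriv.sub [OpensMeasurableSpace E] {U : Set E} {e : E} {f f' g g' : E → ℝ}
    (h : HasWeakDeriv U e f f') (k : HasWeakDeriv U e g g') :
    HasWeakDeriv U e (f - g) (f' - g') := by
  have := h.add (k.const_mul (-1))
  convert this using 1 <;> (ext x; simp [sub_eq_add_neg])

theorem HasWeakDeriv.mono [OpensMeasurableSpace E] {U V : Set E} {e : E} {f f' : E → ℝ}
    (h : HasWeakDeriv U e f f') (hVU : V ⊆ U) : HasWeakDeriv V e f f' := by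
  refine ⟨h.1.mono_set hVU, h.2.1.mono_set hVU, fun φ hφ => ?_⟩
  have key : ∀ (F Φ : E → ℝ), tsupport Φ ⊆ V → ∫ x in V, F x * Φ x = ∫ x in U, F x * Φ x := by
    intro F Φ hs
    have h0 : ∀ x, x ∉ V → F x * Φ x = 0 := by
      intro x hx
      have : Φ x = 0 := by
        by_contra hne
        exact hx (hs (subset_tsupport _ hne))
      simp [this]
    rw [setIntegral_eq_integral_of_forall_compl_eq_zero (fun x hx => h0 x hx),
      setIntegral_eq_integral_of_forall_compl_eq_zero (fun x hx => h0 x (fun hx' => hx (hVU hx')))]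
  rw [key _ _ ((tsupport_fderiv_apply_subset' φ e).trans hφ.2.2), key _ _ hφ.2.2]
  exact h.2.2 φ (hφ.mono hVU)

theorem hasWeakDeriv_weakDeriv {U : Set E} {e : E} {f f' : E → ℝ} (h : HasWeakDeriv U e f f') :
    HasWeakDeriv U e f (weakDeriv U e f) := by
  have hex : ∃ f', HasWeakDeriv U e f f' := ⟨f', h⟩
  rw [weakDeriv, dif_pos hex]
  exact hex.choose_spec

variable [FiniteDimensional ℝ E] [BorelSpace E]

/-- This is the fundamental lemma of the calculus of variations. As `weakDeriv` is selected by
choice, it is what identifies `dx`, `pdx` and `pdz` with concrete functions. -/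
theorem HasWeakDeriv.unique {U : Set E} (hU : IsOpen U) {e : E} {f g g' : E → ℝ}
    (h : HasWeakDeriv U e f g) (k : HasWeakDeriv U e f g') : g =ᵐ[volume.restrict U] g' := by
  have h0 : ∀ᵐ x ∂(volume : Measure E), x ∈ U → (g - g') x = 0 := by
    refine hU.ae_eq_zero_of_integral_contDiff_smul_eq_zero (h.2.1.sub k.2.1) ?_
    intro φ hφ hc hs
    have hT : IsTestFun U φ := ⟨hφ, hc, hs⟩
    have e1 := h.2.2 φ hT
    have e2 := k.2.2 φ hT
    have hz : ∫ x, φ x • (g - g') x = ∫ x in U, (g x * φ x - g' x * φ x) := by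
      rw [setIntegral_eq_integral_of_forall_compl_eq_zero]
      · congr 1; ext x; simp; ring
      · intro x hx
        have : φ x = 0 := by
          by_contra hne
          exact hx (hs (subset_tsupport _ hne))
        simp [this]
    rw [hz, integral_sub (h.integrable_right hT) (k.integrable_right hT)]
    linarith
  filter_upwards [ae_restrict_of_ae h0, ae_restrict_mem hU.measurableSet] with x hx hxU
  have := hx hxU
  simpa [sub_eq_zero] using this

theorem HasWeakDeriv.weakDeriv_eq {U : Set E} (hU : IsOpen U) {e : E} {f f' : E → ℝ}
    (h : HasWeakDeriv U e f f') : weakDeriv U e f =ᵐ[volume.restrict U] f' :=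
  (hasWeakDeriv_weakDeriv h).unique hU h

/-- A function that is continuously differentiable on an open set has its classical derivatives
as weak derivatives. -/
theorem hasWeakDeriv_of_hasFDerivAt [(volume : Measure E).IsAddHaarMeasure] {U : Set E}
    (hU : IsOpen U) (e : E)
    {f : E → ℝ} {f' : E → E →L[ℝ] ℝ} (hf : ∀ x ∈ U, HasFDerivAt f (f' x) x)
    (hf' : ContinuousOn (fun x => f' x e) U) :
    HasWeakDeriv U e f (fun x => f' x e) := by
  have hfc : ContinuousOn f U := fun x hx => (hf x hx).continuousAt.continuousWithinAt
  refine ⟨hfc.locallyIntegrableOn hU.measurableSet, hf'.locallyIntegrableOn hU.measurableSet,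
    fun φ hφ => ?_⟩
  have i1 := IsTestFun.integrable_mul (hfc.locallyIntegrableOn (μ := volume) hU.measurableSet)
    (hφ.continuous_fderiv e) (hφ.hasCompactSupport_fderiv e)
    ((tsupport_fderiv_apply_subset' φ e).trans hφ.2.2)
  have i2 := IsTestFun.integrable_mul (hf'.locallyIntegrableOn (μ := volume) hU.measurableSet)
    hφ.continuous hφ.2.1 hφ.2.2
  have i0 := IsTestFun.integrable_mul (hfc.locallyIntegrableOn (μ := volume) hU.measurableSet)
    hφ.continuous hφ.2.1 hφ.2.2
  have z0 : ∀ x, x ∉ U → φ x = 0 := fun x hx => by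
    by_contra hne
    exact hx (hφ.2.2 (subset_tsupport _ hne))
  have z1 : ∀ x, x ∉ U → fderiv ℝ φ x e = 0 := fun x hx => by
    by_contra hne
    exact hx (hφ.2.2 (tsupport_fderiv_apply_subset' φ e (subset_tsupport _ hne)))
  have conv : ∀ {F : E → ℝ}, (∀ x, x ∉ U → F x = 0) →
      (Integrable F (volume.restrict U) → Integrable F) ∧ ∫ x in U, F x = ∫ x, F x := by
    intro F hF
    refine ⟨fun h => (integrableOn_iff_integrable_of_support_subset ?_).1 h,
      setIntegral_eq_integral_of_forall_compl_eq_zero fun x hx => hF x hx⟩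
    intro x hx
    by_contra hxU
    exact hx (hF x hxU)
  have I1 := (conv (F := fun x => f x * fderiv ℝ φ x e) fun x hx => by simp [z1 x hx])
  have I2 := (conv (F := fun x => f' x e * φ x) fun x hx => by simp [z0 x hx])
  have I0 := (conv (F := fun x => f x * φ x) fun x hx => by simp [z0 x hx])
  rw [I1.2, I2.2]
  exact integral_bilinear_hasFDerivAt_right_eq_neg_left_of_integrable
    (μ := (volume : Measure E)) (B := ContinuousLinearMap.mul ℝ ℝ) (g := φ)
    (g' := fderiv ℝ φ) (by simpa using I2.1 i2) (by simpa using I1.1 i1)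
    (by simpa using I0.1 i0) (fun x hx => hf x (hφ.2.2 hx))
    (fun x _ => (hφ.differentiable x).hasFDerivAt)

end WeakDerivatives

/-! ### Sobolev functions on the interval D. -/

section Interval

variable {L : ℝ}

theorem isTestFun_dom_of_radius {r : ℝ} (hr : r < L) {φ : ℝ → ℝ} (hφ : ContDiff ℝ ∞ φ)
    (h0 : ∀ x, r < |x| → φ x = 0) : IsTestFun (dom L) φ := by
  have hs : tsupport φ ⊆ Icc (-r) r := by
    refine closure_minimal (fun x hx => ?_) isClosed_Icc
    by_contra h
    refine hx (h0 x ?_)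
    rw [mem_Icc, ← abs_le] at h
    exact not_le.1 h
  refine ⟨hφ, isCompact_Icc.of_isClosed_subset (isClosed_tsupport φ) hs, hs.trans ?_⟩
  exact fun x hx => ⟨by linarith [hx.1], by linarith [hx.2]⟩

theorem IsTestFun.exists_radius (hL : 0 < L) {φ : ℝ → ℝ} (hφ : IsTestFun (dom L) φ) :
    ∃ r, 0 < r ∧ r < L ∧ ∀ x, r < |x| → φ x = 0 := by
  rcases (tsupport φ).eq_empty_or_nonempty with he | hne
  · refine ⟨L / 2, by linarith, by linarith, fun x _ => ?_⟩
    have : φ = 0 := tsupport_eq_empty_iff.1 he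
    simp [this]
  · obtain ⟨x₀, hx₀, hmax⟩ := hφ.2.1.exists_isMaxOn hne (continuous_abs.continuousOn)
    have hx₀' : |x₀| < L := abs_lt.2 (hφ.2.2 hx₀)
    refine ⟨max |x₀| (L / 2), lt_max_of_lt_right (by linarith), max_lt hx₀' (by linarith),
      fun x hx => ?_⟩
    by_contra hne
    have := hmax (subset_tsupport _ hne)
    have h2 := le_max_left |x₀| (L / 2)
    simp only [mem_ofPred_eq] at this
    linarith

theorem integral_dom_eq {F : ℝ → ℝ} (h : ∀ x ∉ dom L, F x = 0) : ∫ x in dom L, F x = ∫ x, F x :=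
  setIntegral_eq_integral_of_forall_compl_eq_zero fun x hx => h x hx

theorem IsTestFun.eq_zero {E : Type*} [NormedAddCommGroup E] [NormedSpace ℝ E] {U : Set E}
    {φ : E → ℝ} (hφ : IsTestFun U φ) {x : E} (hx : x ∉ U) : φ x = 0 := by
  by_contra hne
  exact hx (hφ.2.2 (subset_tsupport _ hne))

theorem IsTestFun.deriv {φ : ℝ → ℝ} {U : Set ℝ} (hφ : IsTestFun U φ) :
    IsTestFun U (deriv φ) := by
  have := hφ.fderiv_apply (1 : ℝ)
  simpa only [fderiv_apply_one_eq_deriv] using this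

theorem IsTestFun.integrable {φ : ℝ → ℝ} {U : Set ℝ} (hφ : IsTestFun U φ) : Integrable φ :=
  hφ.continuous.integrable_of_hasCompactSupport hφ.2.1

/-- A test function of mean zero has an antiderivative which is a test function. -/
theorem IsTestFun.exists_antideriv (hL : 0 < L) {θ : ℝ → ℝ} (hθ : IsTestFun (dom L) θ)
    (h0 : ∫ x, θ x = 0) : ∃ φ, IsTestFun (dom L) φ ∧ _root_.deriv φ = θ := by
  obtain ⟨r, hr0, hrL, hr⟩ := hθ.exists_radius hL
  have hd : ∀ x, HasDerivAt (fun y => ∫ t in (-L)..y, θ t) (θ x) x := fun x =>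
    (hθ.continuous.integral_hasStrictDerivAt (-L) x).hasDerivAt
  have hde : _root_.deriv (fun y => ∫ t in (-L)..y, θ t) = θ := funext fun x => (hd x).deriv
  refine ⟨fun y => ∫ t in (-L)..y, θ t, isTestFun_dom_of_radius hrL ?_ ?_, hde⟩
  · refine contDiff_infty_iff_deriv.2 ⟨fun x => (hd x).differentiableAt, ?_⟩
    rw [hde]; exact hθ.1
  · intro x hx
    rcases le_or_gt x 0 with hx0 | hx0
    · rw [abs_of_nonpos hx0] at hx
      refine intervalIntegral.integral_zero_ae (ae_of_all _ fun t ht => hr t ?_)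
      rw [mem_uIoc] at ht
      rw [lt_abs]; right
      rcases ht with ht | ht <;> linarith
    · rw [abs_of_pos hx0] at hx
      have e1 : ∫ t in (-L)..x, θ t = ∫ t, θ t := by
        apply intervalIntegral.integral_eq_integral_of_support_subset
        intro t ht
        by_contra hn
        refine ht (hr t ?_)
        rw [lt_abs]
        by_contra hcon
        push Not at hcon
        exact hn ⟨by linarith, by linarith⟩
      rw [e1, h0]

theorem exists_testFun_integral_one (hL : 0 < L) :
    ∃ ρ : ℝ → ℝ, IsTestFun (dom L) ρ ∧ ∫ x, ρ x = 1 := by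
  let b : ContDiffBump (0 : ℝ) := ⟨L / 4, L / 2, by linarith, by linarith⟩
  refine ⟨b.normed volume, isTestFun_dom_of_radius (r := L / 2) (by linarith)
    b.contDiff_normed (fun x hx => ?_), b.integral_normed⟩
  have : x ∉ Function.support (b.normed volume) := by
    rw [b.support_normed_eq]
    simpa using hx.le
  simpa using this

/-- A smooth cut-off function on `D`. -/
theorem exists_cutoff {r : ℝ} (hr0 : 0 < r) (hr : r < L) :
    ∃ χ : ℝ → ℝ, IsTestFun (dom L) χ ∧ (∀ x, 0 ≤ χ x ∧ χ x ≤ 1) ∧ ∀ x, |x| ≤ r → χ x = 1 := by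
  let b : ContDiffBump (0 : ℝ) := ⟨r, (r + L) / 2, hr0, by linarith⟩
  refine ⟨b, isTestFun_dom_of_radius (r := (r + L) / 2) (by linarith) b.contDiff (fun x hx => ?_),
    fun x => ⟨b.nonneg, b.le_one⟩, fun x hx => b.one_of_mem_closedBall (by simpa using hx)⟩
  have : x ∉ Function.support b := by
    rw [b.support_eq]
    simpa using hx.le
  simpa using this

theorem isOpen_dom : IsOpen (dom L) := isOpen_Ioo

/-- The lemma of du Bois-Reymond. With ρ of integral one, θ - (∫θ)ρ has mean zero and is the
derivative of a test function; testing with it shows that f and the constant ∫fρ have the same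
integral against θ. -/
theorem ae_eq_const_of_integral_deriv_eq_zero (hL : 0 < L) {f : ℝ → ℝ}
    (hf : LocallyIntegrableOn f (dom L) volume)
    (h : ∀ φ, IsTestFun (dom L) φ → ∫ x in dom L, f x * deriv φ x = 0) :
    ∃ c : ℝ, f =ᵐ[volume.restrict (dom L)] fun _ => c := by
  obtain ⟨ρ, hρ, hρ1⟩ := exists_testFun_integral_one hL
  have int : ∀ θ, IsTestFun (dom L) θ → Integrable (fun x => f x * θ x) (volume.restrict (dom L)) :=
    fun θ hθ => IsTestFun.integrable_mul hf hθ.continuous hθ.2.1 hθ.2.2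
  set c := ∫ x in dom L, f x * ρ x with hc
  refine ⟨c, ?_⟩
  have h0 : ∀ᵐ x ∂(volume : Measure ℝ), x ∈ dom L → (f - Function.const ℝ c) x = 0 := by
    refine isOpen_dom.ae_eq_zero_of_integral_contDiff_smul_eq_zero
      (hf.sub (continuous_const.locallyIntegrable.locallyIntegrableOn _)) ?_
    intro θ hθ1 hθ2 hθ3
    have hθ : IsTestFun (dom L) θ := ⟨hθ1, hθ2, hθ3⟩
    obtain ⟨φ, hφ, hφ'⟩ := (hθ.sub (hρ.const_mul (∫ x, θ x))).exists_antideriv hL (by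
      rw [integral_sub hθ.integrable (hρ.integrable.const_mul _), integral_const_mul, hρ1]; ring)
    have e := h φ hφ
    rw [hφ'] at e
    have e2 : ∫ x in dom L, f x * (θ x - (∫ x, θ x) * ρ x)
        = (∫ x in dom L, f x * θ x) - (∫ x, θ x) * c := by
      rw [hc, ← integral_const_mul, ← integral_sub (int θ hθ) ((int ρ hρ).const_mul _)]
      congr 1; ext x; ring
    have e3 : ∫ x, θ x • (f - Function.const ℝ c) x = ∫ x in dom L, (f x * θ x - c * θ x) := by
      rw [integral_dom_eq (fun x hx => by rw [hθ.eq_zero hx]; ring)]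
      congr 1; ext x; simp; ring
    rw [e3, integral_sub (int θ hθ) (hθ.integrable.restrict.const_mul c), integral_const_mul,
      integral_dom_eq (fun x hx => hθ.eq_zero hx)]
    rw [e2] at e
    linarith
  filter_upwards [ae_restrict_of_ae h0, ae_restrict_mem measurableSet_Ioo] with x hx hxU
  have := hx hxU
  simpa [sub_eq_zero] using this

/-- Integration by parts against the distribution function of a measure. -/
theorem integral_primitive_mul_deriv (κ : Measure ℝ) [IsFiniteMeasure κ] {g : ℝ → ℝ}
    (hg : Integrable g κ) {φ : ℝ → ℝ} (hφ : IsTestFun (dom L) φ) :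
    ∫ x in dom L, (∫ t in Iic x, g t ∂κ) * deriv φ x = - ∫ t, g t * φ t ∂κ := by
  rw [integral_dom_eq (fun x hx => by rw [hφ.deriv.eq_zero hx, mul_zero])]
  have hi : Integrable (fun p : ℝ × ℝ => deriv φ p.1 * g p.2) (volume.prod κ) :=
    hφ.deriv.integrable.mul_prod hg
  have hm : MeasurableSet {p : ℝ × ℝ | p.2 ≤ p.1} := measurableSet_le measurable_snd measurable_fst
  -- Fubini's theorem on {t ≤ x}: the inner integral of φ' over [t, ∞) is -φ(t).
  have e1 : ∀ x, (∫ t in Iic x, g t ∂κ) * deriv φ x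
      = ∫ t, {p : ℝ × ℝ | p.2 ≤ p.1}.indicator (fun p => deriv φ p.1 * g p.2) (x, t) ∂κ := by
    intro x
    rw [← integral_indicator measurableSet_Iic, mul_comm, ← integral_const_mul]
    congr 1; ext t
    by_cases h : t ≤ x <;> simp [h]
  simp_rw [e1]
  rw [integral_integral_swap (f := fun x t => {p : ℝ × ℝ | p.2 ≤ p.1}.indicator
    (fun p => deriv φ p.1 * g p.2) (x, t)) (hi.indicator hm), ← integral_neg]
  congr 1; ext t
  have e2 : ∀ x, {p : ℝ × ℝ | p.2 ≤ p.1}.indicator (fun p => deriv φ p.1 * g p.2) (x, t)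
      = g t * (Ici t).indicator (deriv φ) x := by
    intro x
    by_cases h : t ≤ x <;> simp [h, mul_comm]
  simp_rw [e2]
  rw [integral_const_mul, integral_indicator measurableSet_Ici, integral_Ici_eq_integral_Ioi,
    HasCompactSupport.integral_Ioi_deriv_eq (hφ.1.of_le (by simp)) hφ.2.1]
  ring

theorem abs_primitive_le (κ : Measure ℝ) {g : ℝ → ℝ} (hg : Integrable g κ) (x : ℝ) :
    |∫ t in Iic x, g t ∂κ| ≤ ∫ t, |g t| ∂κ :=
  (abs_integral_le_integral_abs).trans
    (setIntegral_le_integral hg.abs (ae_of_all _ fun _ => abs_nonneg _))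

theorem continuous_primitive_dom {g : ℝ → ℝ} (hg : IntegrableOn g (dom L)) :
    Continuous (fun x => ∫ t in Iic x, g t ∂(volume.restrict (dom L))) := by
  have : (fun x => ∫ t in Iic x, g t ∂(volume.restrict (dom L)))
      = fun x => ∫ t in Iic x, (dom L).indicator g t := by
    ext x
    rw [setIntegral_indicator measurableSet_Ioo, Measure.restrict_restrict measurableSet_Iic]
  rw [this]
  have hi : Integrable ((dom L).indicator g) := (integrable_indicator_iff measurableSet_Ioo).2 hg
  have e : ∀ x, ∫ t in Iic x, (dom L).indicator g t
      = (∫ t in Iic (0 : ℝ), (dom L).indicator g t) + ∫ t in (0 : ℝ)..x, (dom L).indicator g t := by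
    intro x
    rw [← intervalIntegral.integral_Iic_sub_Iic hi.integrableOn hi.integrableOn]
    ring
  rw [funext e]
  exact continuous_const.add (intervalIntegral.continuous_primitive
    (fun a b => hi.intervalIntegrable) 0)

theorem hasWeakDeriv_primitive {κ : Measure ℝ} [IsFiniteMeasure κ] {g : ℝ → ℝ}
    (hκ : κ = volume.restrict (dom L)) (hg : IntegrableOn g (dom L)) :
    HasWeakDeriv (dom L) 1 (fun x => ∫ t in Iic x, g t ∂κ) g := by
  subst hκ
  refine ⟨(continuous_primitive_dom hg).locallyIntegrable.locallyIntegrableOn _,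
    IntegrableOn.locallyIntegrableOn hg, fun φ hφ => ?_⟩
  simp only [fderiv_apply_one_eq_deriv]
  exact integral_primitive_mul_deriv _ hg hφ

instance : IsFiniteMeasure (volume.restrict (dom L)) := ⟨by simp⟩

theorem HasWeakDeriv.exists_eq_primitive (hL : 0 < L) {f g : ℝ → ℝ}
    (h : HasWeakDeriv (dom L) 1 f g) (hg : IntegrableOn g (dom L)) :
    ∃ c : ℝ, f =ᵐ[volume.restrict (dom L)]
      fun x => c + ∫ t in Iic x, g t ∂(volume.restrict (dom L)) := by
  have k := hasWeakDeriv_primitive (L := L) rfl hg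
  have hs := h.sub k
  obtain ⟨c, hc⟩ := ae_eq_const_of_integral_deriv_eq_zero hL hs.1 (fun φ hφ => by
    have := hs.2.2 φ hφ
    simpa [fderiv_apply_one_eq_deriv] using this)
  refine ⟨c, ?_⟩
  filter_upwards [hc] with x hx
  simp only [Pi.sub_apply] at hx
  linarith

theorem hasWeakDeriv_dom_of_hasDerivAt {f f' : ℝ → ℝ} (hf : ∀ x ∈ dom L, HasDerivAt f (f' x) x)
    (hf' : ContinuousOn f' (dom L)) : HasWeakDeriv (dom L) 1 f f' := by
  have := hasWeakDeriv_of_hasFDerivAt (isOpen_dom (L := L)) (1 : ℝ)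
    (f' := fun x => ContinuousLinearMap.toSpanSingleton ℝ (f' x))
    (fun x hx => (hf x hx).hasFDerivAt) (by
      simpa only [ContinuousLinearMap.toSpanSingleton_apply, one_smul] using hf')
  simpa only [ContinuousLinearMap.toSpanSingleton_apply, one_smul] using this

/-! ### The spaces `H^k(D)` -/

theorem dx_eq_of_hasWeakDeriv {f f' : ℝ → ℝ} (h : HasWeakDeriv (dom L) 1 f f') :
    dx L f =ᵐ[volume.restrict (dom L)] f' := h.weakDeriv_eq isOpen_dom

theorem weakDeriv_congr {E : Type*} [NormedAddCommGroup E] [NormedSpace ℝ E] [MeasureSpace E]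
    {U : Set E} {e : E} {f g : E → ℝ} (h : f =ᵐ[volume.restrict U] g) :
    weakDeriv U e f = weakDeriv U e g := by
  have : HasWeakDeriv U e f = HasWeakDeriv U e g := funext fun f' => propext
    ⟨fun k => k.congr h ae_eq_rfl, fun k => k.congr h.symm ae_eq_rfl⟩
  unfold weakDeriv
  rw [this]

theorem dx_congr {f g : ℝ → ℝ} (h : f =ᵐ[volume.restrict (dom L)] g) : dx L f = dx L g :=
  weakDeriv_congr h

/-- Iterates of `dx` involve arbitrary representatives. A chain of explicit weak derivatives
replaces them, because `dx` depends only on the class of its argument modulo null sets. -/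
theorem dx_iterate_of_chain {k : ℕ} {v : ℝ → ℝ} (g : ℕ → ℝ → ℝ)
    (h0 : v =ᵐ[volume.restrict (dom L)] g 0)
    (hg : ∀ j < k, HasWeakDeriv (dom L) 1 (g j) (g (j + 1))) :
    ∀ j ≤ k, (dx L)^[j] v =ᵐ[volume.restrict (dom L)] g j := by
  intro j
  induction j with
  | zero => intro _; exact h0
  | succ j ih =>
    intro hj
    rw [Function.iterate_succ_apply', dx_congr (ih (by omega))]
    exact dx_eq_of_hasWeakDeriv (hg j (by omega))

theorem memHk_of_chain {k : ℕ} {v : ℝ → ℝ} (g : ℕ → ℝ → ℝ)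
    (h0 : v =ᵐ[volume.restrict (dom L)] g 0)
    (hg : ∀ j < k, HasWeakDeriv (dom L) 1 (g j) (g (j + 1)))
    (hL2 : ∀ j ≤ k, MemLp (g j) 2 (volume.restrict (dom L))) : MemHk L k v := by
  have h := dx_iterate_of_chain g h0 hg
  exact ⟨fun j hj => (memLp_congr_ae (h j hj)).2 (hL2 j hj), fun j hj =>
    (hg j hj).congr (h j hj.le).symm (h (j + 1) hj).symm⟩

theorem MemHk.linComb {k : ℕ} {v w : ℝ → ℝ} (hv : MemHk L k v) (hw : MemHk L k w) (a b : ℝ) :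
    MemHk L k (fun x => a * v x + b * w x) ∧
    ∀ j ≤ k, (dx L)^[j] (fun x => a * v x + b * w x) =ᵐ[volume.restrict (dom L)]
      fun x => a * (dx L)^[j] v x + b * (dx L)^[j] w x := by
  have hg : ∀ j < k, HasWeakDeriv (dom L) 1 (fun x => a * (dx L)^[j] v x + b * (dx L)^[j] w x)
      (fun x => a * (dx L)^[j + 1] v x + b * (dx L)^[j + 1] w x) := fun j hj =>
    ((hv.2 j hj).const_mul a).add ((hw.2 j hj).const_mul b)
  exact ⟨memHk_of_chain (fun j x => a * (dx L)^[j] v x + b * (dx L)^[j] w x) ae_eq_rfl hg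
    (fun j hj => ((hv.1 j hj).const_mul a).add ((hw.1 j hj).const_mul b)),
    dx_iterate_of_chain (fun j x => a * (dx L)^[j] v x + b * (dx L)^[j] w x) ae_eq_rfl hg⟩

theorem MemHk.mono {k l : ℕ} {v : ℝ → ℝ} (h : MemHk L k v) (hl : l ≤ k) : MemHk L l v :=
  ⟨fun j hj => h.1 j (hj.trans hl), fun j hj => h.2 j (hj.trans_le hl)⟩

theorem MemHk.sub {k : ℕ} {v w : ℝ → ℝ} (hv : MemHk L k v) (hw : MemHk L k w) :
    MemHk L k (v - w) ∧ ∀ j ≤ k, (dx L)^[j] (v - w) =ᵐ[volume.restrict (dom L)]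
      (dx L)^[j] v - (dx L)^[j] w := by
  have := hv.linComb hw 1 (-1)
  have e : (fun x => 1 * v x + -1 * w x) = v - w := by ext x; simp [sub_eq_add_neg]
  rw [e] at this
  refine ⟨this.1, fun j hj => (this.2 j hj).trans (ae_of_all _ fun x => ?_)⟩
  simp [sub_eq_add_neg]

theorem MemH2D.linComb (hL : 0 < L) {v w : ℝ → ℝ} (hv : MemH2D L v) (hw : MemH2D L w) (a b : ℝ) :
    MemH2D L (fun x => a * v x + b * w x) := by
  obtain ⟨v1, v2, v3, v4, v5, v6⟩ := hv
  obtain ⟨w1, w2, w3, w4, w5, w6⟩ := hw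
  have hd : ∀ x ∈ Icc (-L) L, derivWithin (fun x => a * v x + b * w x) (Icc (-L) L) x
      = a * derivWithin v (Icc (-L) L) x + b * derivWithin w (Icc (-L) L) x := by
    intro x hx
    have hdv := ((v2.differentiableOn (by simp)) x hx).hasDerivWithinAt
    have hdw := ((w2.differentiableOn (by simp)) x hx).hasDerivWithinAt
    exact ((hdv.const_mul a).add (hdw.const_mul b)).derivWithin
      (uniqueDiffOn_Icc (by linarith) x hx)
  refine ⟨(v1.linComb w1 a b).1, (contDiffOn_const.mul v2).add (contDiffOn_const.mul w2),
    by simp [v3, w3], by simp [v4, w4], ?_, ?_⟩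
  · rw [hd _ (left_mem_Icc.2 (by linarith)), v5, w5]; simp
  · rw [hd _ (right_mem_Icc.2 (by linarith)), v6, w6]; simp

theorem IsTestFun.iterate_deriv {φ : ℝ → ℝ} {U : Set ℝ} (hφ : IsTestFun U φ) (j : ℕ) :
    IsTestFun U (_root_.deriv^[j] φ) := by
  induction j with
  | zero => exact hφ
  | succ j ih => rw [Function.iterate_succ_apply']; exact ih.deriv

theorem IsTestFun.hasWeakDeriv {φ : ℝ → ℝ} (hφ : IsTestFun (dom L) φ) :
    HasWeakDeriv (dom L) 1 φ (_root_.deriv φ) :=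
  hasWeakDeriv_dom_of_hasDerivAt (fun x _ => (hφ.differentiable x).hasDerivAt)
    hφ.deriv.continuous.continuousOn

theorem IsTestFun.dx_iterate {φ : ℝ → ℝ} (hφ : IsTestFun (dom L) φ) (j : ℕ) :
    (dx L)^[j] φ =ᵐ[volume.restrict (dom L)] _root_.deriv^[j] φ :=
  dx_iterate_of_chain (k := j) (fun j => _root_.deriv^[j] φ) ae_eq_rfl (fun i _ => by
    simp only [Function.iterate_succ_apply']
    exact (hφ.iterate_deriv i).hasWeakDeriv) j le_rfl

theorem IsTestFun.memLp {φ : ℝ → ℝ} {U : Set ℝ} (hφ : IsTestFun U φ) (p : ℝ≥0∞) (μ : Measure ℝ)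
    [IsFiniteMeasureOnCompacts μ] : MemLp φ p μ :=
  hφ.continuous.memLp_of_hasCompactSupport hφ.2.1

theorem IsTestFun.memHk {φ : ℝ → ℝ} (hφ : IsTestFun (dom L) φ) (k : ℕ) : MemHk L k φ :=
  memHk_of_chain (fun j => _root_.deriv^[j] φ) ae_eq_rfl (fun i _ => by
    simp only [Function.iterate_succ_apply']
    exact (hφ.iterate_deriv i).hasWeakDeriv) (fun j _ => (hφ.iterate_deriv j).memLp _ _)

theorem IsTestFun.memH2D (hL : 0 < L) {φ : ℝ → ℝ} (hφ : IsTestFun (dom L) φ) : MemH2D L φ := by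
  have hd : ∀ x ∈ Icc (-L) L, derivWithin φ (Icc (-L) L) x = _root_.deriv φ x := fun x hx =>
    (hφ.differentiable x).hasDerivAt.hasDerivWithinAt.derivWithin
      (uniqueDiffOn_Icc (by linarith) x hx)
  refine ⟨hφ.memHk 2, (hφ.1.of_le (by simp)).contDiffOn, hφ.eq_zero (by simp), hφ.eq_zero (by simp),
    ?_, ?_⟩
  · rw [hd _ (left_mem_Icc.2 (by linarith))]; exact hφ.deriv.eq_zero (by simp)
  · rw [hd _ (right_mem_Icc.2 (by linarith))]; exact hφ.deriv.eq_zero (by simp)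

/-- The norm of `L₂(D)` as a real number. -/
noncomputable def l2 (L : ℝ) (g : ℝ → ℝ) : ℝ := (eLpNorm g 2 (volume.restrict (dom L))).toReal

theorem integral_abs_le_l2 (hL : 0 < L) {g : ℝ → ℝ} (hg : MemLp g 2 (volume.restrict (dom L))) :
    ∫ x in dom L, |g x| ≤ √(2 * L) * l2 L g := by
  have h1 := eLpNorm_le_eLpNorm_mul_rpow_measure_univ (p := 1) (q := 2)
    (μ := volume.restrict (dom L)) (by norm_num) hg.1
  have e1 : ∫ x in dom L, |g x| = (eLpNorm g 1 (volume.restrict (dom L))).toReal := by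
    rw [eLpNorm_one_eq_lintegral_enorm]
    rw [← integral_norm_eq_lintegral_enorm hg.1]
    rfl
  have e2 : (volume.restrict (dom L)) univ = ENNReal.ofReal (2 * L) := by
    rw [Measure.restrict_apply_univ, Real.volume_Ioo]; ring_nf
  have e3 : (1 / ENNReal.toReal 1 - 1 / ENNReal.toReal 2 : ℝ) = 1 / 2 := by norm_num
  rw [e3, e2] at h1
  rw [e1, l2]
  have h2 := ENNReal.toReal_mono (ENNReal.mul_ne_top hg.2.ne
    (ENNReal.rpow_ne_top_of_nonneg (by norm_num) ENNReal.ofReal_ne_top)) h1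
  refine h2.trans ?_
  rw [ENNReal.toReal_mul, ← ENNReal.toReal_rpow, ENNReal.toReal_ofReal (by linarith),
    Real.sqrt_eq_rpow, mul_comm]

theorem integrableOn_of_memLp {g : ℝ → ℝ} (hg : MemLp g 2 (volume.restrict (dom L))) :
    IntegrableOn g (dom L) := hg.integrable (by norm_num)

/-- The structure of the elements of `H²_D(D)`. -/
theorem MemH2D.structure (hL : 0 < L) {v : ℝ → ℝ} (hv : MemH2D L v) :
    ∃ v' : ℝ → ℝ, Continuous v' ∧ (∀ x ∈ dom L, HasDerivAt v (v' x) x) ∧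
      dx L v =ᵐ[volume.restrict (dom L)] v' ∧
      (∀ x, |v' x| ≤ √(2 * L) * l2 L (dx L (dx L v))) ∧
      ∀ x ∈ Icc (-L) L, |v x| ≤ √(2 * L) * l2 L (dx L (dx L v)) * (L - |x|) := by
  obtain ⟨h1, h2, h3, h4, h5, h6⟩ := hv
  have hL2 : MemLp (dx L (dx L v)) 2 (volume.restrict (dom L)) := h1.1 2 le_rfl
  have hint := integrableOn_of_memLp hL2
  -- This primitive of ∂ₓ²v vanishes at -L. It differs from the classical derivative by a constant
  -- almost everywhere, hence everywhere by continuity, and the clamped condition at -L makes that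
  -- constant zero.
  set v' : ℝ → ℝ := fun x => ∫ t in Iic x, dx L (dx L v) t ∂(volume.restrict (dom L)) with hv'
  have hcont : Continuous v' := continuous_primitive_dom hint
  have hb : ∀ x, |v' x| ≤ √(2 * L) * l2 L (dx L (dx L v)) := fun x =>
    (abs_primitive_le _ hint x).trans (integral_abs_le_l2 hL hL2)
  have hU : UniqueDiffOn ℝ (Icc (-L) L) := uniqueDiffOn_Icc (by linarith)
  set f := derivWithin v (Icc (-L) L) with hf
  have hfc : ContinuousOn f (Icc (-L) L) := h2.continuousOn_derivWithin hU (by simp)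
  have hfd : ∀ x ∈ Icc (-L) L, HasDerivWithinAt v (f x) (Icc (-L) L) x := fun x hx =>
    ((h2.differentiableOn (by simp)) x hx).hasDerivWithinAt
  have hfd' : ∀ x ∈ dom L, HasDerivAt v (f x) x := fun x hx =>
    (hfd x (Ioo_subset_Icc_self hx)).hasDerivAt (Icc_mem_nhds hx.1 hx.2)
  have hw : HasWeakDeriv (dom L) 1 v f :=
    hasWeakDeriv_dom_of_hasDerivAt hfd' (hfc.mono Ioo_subset_Icc_self)
  have hdx := dx_eq_of_hasWeakDeriv hw
  have hw2 : HasWeakDeriv (dom L) 1 f (dx L (dx L v)) := (h1.2 1 (by norm_num)).congr hdx ae_eq_rfl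
  obtain ⟨c, hc⟩ := hw2.exists_eq_primitive hL hint
  have hc' : f =ᵐ[volume.restrict (Icc (-L) L)] fun x => c + v' x := by
    rw [← restrict_Ioo_eq_restrict_Icc]; exact hc
  have hEq : EqOn f (fun x => c + v' x) (Icc (-L) L) :=
    Measure.eqOn_of_ae_eq hc' hfc (continuous_const.add hcont).continuousOn (by
      rw [interior_Icc, closure_Ioo (by linarith)])
  have hv'L : v' (-L) = 0 := by
    simp only [hv']
    rw [Measure.restrict_restrict measurableSet_Iic]
    have : Iic (-L) ∩ dom L = ∅ := by
      ext x; simp only [mem_inter_iff, mem_Iic, mem_Ioo, mem_empty_iff_false, iff_false]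
      rintro ⟨a, b, _⟩; linarith
    rw [this]; simp
  have hc0 : c = 0 := by
    have := hEq (left_mem_Icc.2 (by linarith))
    simp only [hv'L, hf] at this
    linarith
  have hEq' : ∀ x ∈ Icc (-L) L, f x = v' x := fun x hx => by
    have := hEq hx
    simpa [hc0] using this
  refine ⟨v', hcont, fun x hx => ?_, ?_, hb, ?_⟩
  · rw [← hEq' x (Ioo_subset_Icc_self hx)]; exact hfd' x hx
  · filter_upwards [hdx, ae_restrict_mem measurableSet_Ioo] with x hx hxD
    rw [hx, hEq' x (Ioo_subset_Icc_self hxD)]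
  · intro x hx
    -- The mean value inequality is applied between x and the nearer end point, where v = 0; its
    -- distance to x is L - |x|.
    have lip : ∀ y ∈ Icc (-L) L, |v x - v y| ≤ √(2 * L) * l2 L (dx L (dx L v)) * |x - y| :=
      fun y hy => (convex_Icc (-L) L).norm_image_sub_le_of_norm_hasDerivWithin_le
        (f' := f) hfd (fun z hz => by rw [hEq' z hz]; exact hb z) hy hx
    rcases le_total x 0 with h | h
    · have := lip (-L) (left_mem_Icc.2 (by linarith))
      rw [h3, sub_zero, abs_of_nonneg (a := x - -L) (by linarith [hx.1])] at this
      rw [abs_of_nonpos h]; convert this using 2; ring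
    · have := lip L (right_mem_Icc.2 (by linarith))
      rw [h4, sub_zero, abs_of_nonpos (a := x - L) (by linarith [hx.2])] at this
      rw [abs_of_nonneg h]; convert this using 2; ring

end Interval

/-! ### Functions whose third derivative has bounded variation. -/

section ThirdDerivative

variable {L : ℝ}

/-- `e ∈ H³(D)` and the third derivative is a function of bounded variation, with the bound `m`
on its value at the left end point and on its positive and negative variations. -/
def BV3 (L m : ℝ) (e : ℝ → ℝ) : Prop :=
  MemHk L 3 e ∧ ∃ (κ₁ κ₂ : Measure ℝ) (c : ℝ), IsFiniteMeasure κ₁ ∧ IsFiniteMeasure κ₂ ∧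
    |c| ≤ m ∧ κ₁.real univ ≤ m ∧ κ₂.real univ ≤ m ∧
    (dx L)^[3] e =ᵐ[volume.restrict (dom L)] fun x => c + (κ₁.real (Iic x) - κ₂.real (Iic x))

theorem monotone_real_Iic (κ : Measure ℝ) [IsFiniteMeasure κ] : Monotone fun x => κ.real (Iic x) :=
  fun _ _ h => measureReal_mono (Iic_subset_Iic.2 h)

theorem BV3.mono {m m' : ℝ} {e : ℝ → ℝ} (h : BV3 L m e) (hm : m ≤ m') : BV3 L m' e := by
  obtain ⟨h1, κ₁, κ₂, c, f1, f2, hc, k1, k2, he⟩ := h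
  exact ⟨h1, κ₁, κ₂, c, f1, f2, hc.trans hm, k1.trans hm, k2.trans hm, he⟩

theorem BV3.nonneg {m : ℝ} {e : ℝ → ℝ} (h : BV3 L m e) : 0 ≤ m := by
  obtain ⟨h1, κ₁, κ₂, c, f1, f2, hc, k1, k2, he⟩ := h
  exact (abs_nonneg c).trans hc

theorem BV3.sub {m : ℝ} {v w : ℝ → ℝ} (hv : BV3 L m v) (hw : BV3 L m w) :
    BV3 L (2 * m) (v - w) := by
  obtain ⟨h1, κ₁, κ₂, c, f1, f2, hc, k1, k2, he⟩ := hv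
  obtain ⟨h1', κ₁', κ₂', c', f1', f2', hc', k1', k2', he'⟩ := hw
  refine ⟨(h1.sub h1').1, κ₁ + κ₂', κ₂ + κ₁', c - c', inferInstance, inferInstance, ?_, ?_, ?_, ?_⟩
  · exact (abs_sub c c').trans (by linarith)
  · rw [measureReal_add_apply]; linarith
  · rw [measureReal_add_apply]; linarith
  · filter_upwards [(h1.sub h1').2 3 le_rfl, he, he'] with x hx h3 h4
    rw [hx, Pi.sub_apply, h3, h4, measureReal_add_apply, measureReal_add_apply]
    ring

theorem integrable_dom_of_bounded {f : ℝ → ℝ} (hf : Measurable f) {C : ℝ} (h : ∀ x, |f x| ≤ C) :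
    IntegrableOn f (dom L) :=
  Integrable.of_bound hf.aestronglyMeasurable C (ae_of_all _ h)

theorem setIntegral_one_Iic (κ : Measure ℝ) [IsFiniteMeasure κ] (x : ℝ) :
    ∫ _ in Iic x, (1 : ℝ) ∂κ = κ.real (Iic x) := by simp [Measure.real]

/-- If `∂ₓ⁴v` is the difference of two finite measures, then `∂ₓ³v` has bounded variation. -/
theorem exists_bv3_of_integral (hL : 0 < L) : ∃ C : ℝ, 0 < C ∧ ∀ (v : ℝ → ℝ) (m : ℝ)
    (κ₁ κ₂ : Measure ℝ) [IsFiniteMeasure κ₁] [IsFiniteMeasure κ₂], MemH2D L v →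
    κ₁.real univ ≤ m → κ₂.real univ ≤ m →
    (∀ φ, IsTestFun (dom L) φ → ∫ x in dom L, dx L (dx L v) x * deriv (deriv φ) x
      = ∫ x, φ x ∂κ₁ - ∫ x, φ x ∂κ₂) →
    BV3 L (C * (l2 L (dx L (dx L v)) + m)) v := by
  obtain ⟨ρ, hρ, hρ1⟩ := exists_testFun_integral_one hL
  obtain ⟨R, hR⟩ := hρ.deriv.continuous.bounded_above_of_compact_support hρ.deriv.2.1
  have hR0 : 0 ≤ R := (norm_nonneg _).trans (hR 0)
  -- The part with R bounds the slope A below; the summand 1 takes care of the masses of κ₁ and κ₂.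
  -- Here 4L²m is the bound of the integral of |Y| over D.
  refine ⟨1 + R * (√(2 * L) + 4 * L ^ 2), by positivity, ?_⟩
  intro v m κ₁ κ₂ _ _ hv hk1 hk2 hid
  have hm0 : 0 ≤ m := measureReal_nonneg.trans hk1
  set w := dx L (dx L v) with hw
  have hw2 : MemLp w 2 (volume.restrict (dom L)) := hv.1.1 2 le_rfl
  have hwi : IntegrableOn w (dom L) := integrableOn_of_memLp hw2
  have hl2 : 0 ≤ l2 L w := ENNReal.toReal_nonneg
  set b : ℝ → ℝ := fun x => κ₁.real (Iic x) - κ₂.real (Iic x) with hb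
  have hbm : Measurable b :=
    (monotone_real_Iic κ₁).measurable.sub (monotone_real_Iic κ₂).measurable
  have hbb : ∀ x, |b x| ≤ m := fun x => by
    have a1 : κ₁.real (Iic x) ≤ m := (measureReal_mono (subset_univ _)).trans hk1
    have a2 : κ₂.real (Iic x) ≤ m := (measureReal_mono (subset_univ _)).trans hk2
    have a3 : 0 ≤ κ₁.real (Iic x) := measureReal_nonneg
    have a4 : 0 ≤ κ₂.real (Iic x) := measureReal_nonneg
    rw [abs_le]; constructor <;> simp only [hb] <;> linarith
  have hbi : IntegrableOn b (dom L) := integrable_dom_of_bounded hbm hbb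
  set Y : ℝ → ℝ := fun x => ∫ t in Iic x, b t ∂(volume.restrict (dom L)) with hY
  have hYw : HasWeakDeriv (dom L) 1 Y b := hasWeakDeriv_primitive rfl hbi
  have hYc : Continuous Y := continuous_primitive_dom hbi
  have hYb : ∀ x, |Y x| ≤ 2 * L * m := fun x => by
    refine (abs_primitive_le _ hbi x).trans ?_
    have := integral_mono (μ := volume.restrict (dom L)) hbi.abs (integrable_const m) hbb
    refine this.trans ?_
    simp [Measure.real, ENNReal.toReal_ofReal (show (0 : ℝ) ≤ L + L by linarith)]
    linarith
  have hYi : IntegrableOn Y (dom L) := integrable_dom_of_bounded hYc.measurable hYb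
  -- the second derivatives of `w - Y` vanish
  have hbφ : ∀ φ, IsTestFun (dom L) φ →
      ∫ x in dom L, b x * deriv φ x = -(∫ x, φ x ∂κ₁ - ∫ x, φ x ∂κ₂) := by
    intro φ hφ
    have i1 := integral_primitive_mul_deriv κ₁ (g := fun _ => 1) (integrable_const _) hφ
    have i2 := integral_primitive_mul_deriv κ₂ (g := fun _ => 1) (integrable_const _) hφ
    simp only [setIntegral_one_Iic, one_mul] at i1 i2
    have ii : ∀ (κ : Measure ℝ) [IsFiniteMeasure κ],
        IntegrableOn (fun x => κ.real (Iic x) * deriv φ x) (dom L) := fun κ _ =>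
      hφ.deriv.integrable.restrict.bdd_mul
        (monotone_real_Iic κ).measurable.aestronglyMeasurable
        (ae_of_all _ fun x => by
          rw [Real.norm_of_nonneg measureReal_nonneg]
          exact measureReal_mono (subset_univ _))
    simp only [hb, sub_mul]
    rw [integral_sub (ii κ₁) (ii κ₂), i1, i2]
    ring
  have hF : ∀ φ, IsTestFun (dom L) φ → ∫ x in dom L, (w x - Y x) * deriv (deriv φ) x = 0 := by
    intro φ hφ
    have e1 := hYw.2.2 _ hφ.deriv
    simp only [fderiv_apply_one_eq_deriv] at e1
    simp only [sub_mul]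
    rw [integral_sub, hid φ hφ, e1, hbφ φ hφ]
    · ring
    · exact IsTestFun.integrable_mul (hwi.locallyIntegrableOn) hφ.deriv.deriv.continuous
        hφ.deriv.deriv.2.1 hφ.deriv.deriv.2.2
    · exact IsTestFun.integrable_mul hYw.1 hφ.deriv.deriv.continuous
        hφ.deriv.deriv.2.1 hφ.deriv.deriv.2.2
  set F : ℝ → ℝ := fun x => w x - Y x with hFdef
  have hFi : IntegrableOn F (dom L) := hwi.sub hYi
  have hFl : ∀ θ, IsTestFun (dom L) θ → IntegrableOn (fun x => F x * θ x) (dom L) := fun θ hθ =>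
    IsTestFun.integrable_mul hFi.locallyIntegrableOn hθ.continuous hθ.2.1 hθ.2.2
  -- F integrates to zero against second derivatives, so it is affine with slope -A. The argument of
  -- du Bois-Reymond is repeated one order higher: θ' - (∫θ)ρ' is the second derivative of a test
  -- function.
  set A := ∫ x in dom L, F x * deriv ρ x with hA
  have hid' : HasWeakDeriv (dom L) 1 (fun x : ℝ => x) (fun _ => 1) :=
    hasWeakDeriv_dom_of_hasDerivAt (fun x _ => hasDerivAt_id x) continuousOn_const
  obtain ⟨c, hc⟩ := ae_eq_const_of_integral_deriv_eq_zero hL (f := fun x => F x + A * x)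
    (hFi.locallyIntegrableOn.add (hid'.const_mul A).1) (by
      intro θ hθ
      obtain ⟨φ, hφ, hφ'⟩ := (hθ.sub (hρ.const_mul (∫ x, θ x))).exists_antideriv hL (by
        rw [integral_sub hθ.integrable (hρ.integrable.const_mul _), integral_const_mul, hρ1]; ring)
      have e := hF φ hφ
      have e0 : deriv (deriv φ) = fun x => deriv θ x - (∫ x, θ x) * deriv ρ x := by
        rw [hφ']; ext x
        exact ((hθ.differentiable x).hasDerivAt.sub
          ((hρ.differentiable x).hasDerivAt.const_mul _)).deriv
      rw [e0] at e
      have e2 : ∫ x in dom L, F x * (deriv θ x - (∫ x, θ x) * deriv ρ x)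
          = (∫ x in dom L, F x * deriv θ x) - (∫ x, θ x) * A := by
        rw [hA, ← integral_const_mul, ← integral_sub (hFl _ hθ.deriv)
          ((hFl _ hρ.deriv).const_mul _)]
        congr 1; ext x; ring
      have e3 := hid'.2.2 θ hθ
      simp only [fderiv_apply_one_eq_deriv, one_mul] at e3
      rw [integral_dom_eq (F := θ) (fun x hx => hθ.eq_zero hx)] at e3
      have e4 : ∫ x in dom L, (F x + A * x) * deriv θ x
          = (∫ x in dom L, F x * deriv θ x) + A * ∫ x in dom L, x * deriv θ x := by
        rw [← integral_const_mul, ← integral_add (hFl _ hθ.deriv)]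
        · congr 1; ext x; ring
        · exact (IsTestFun.integrable_mul hid'.1 hθ.deriv.continuous hθ.deriv.2.1
            hθ.deriv.2.2).const_mul _
      rw [e4, e3]
      rw [e2] at e
      linarith)
  have hwd : HasWeakDeriv (dom L) 1 w (fun x => -A + b x) := by
    have k1 : HasWeakDeriv (dom L) 1 (fun x => c - A * x + Y x) (fun x => -A + b x) := by
      refine HasWeakDeriv.add (f := fun x => c - A * x) (f' := fun _ => -A) ?_ hYw
      refine hasWeakDeriv_dom_of_hasDerivAt (fun x _ => ?_) continuousOn_const
      simpa using ((hasDerivAt_id x).const_mul A).const_sub c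
    refine k1.congr ?_ ae_eq_rfl
    filter_upwards [hc] with x hx
    simp only [hFdef] at hx
    linarith
  have hAb : |A| ≤ R * (√(2 * L) * l2 L w + 4 * L ^ 2 * m) := by
    have s1 : |A| ≤ ∫ x in dom L, R * (|w x| + 2 * L * m) := by
      refine abs_integral_le_integral_abs.trans (integral_mono ?_ ?_ ?_)
      · exact (hFl _ hρ.deriv).abs
      · exact ((hwi.abs).add (integrable_const _)).const_mul R
      · intro x
        simp only [abs_mul, hFdef]
        rw [mul_comm]
        gcongr
        · exact hR x
        · exact (abs_sub _ _).trans (by gcongr; exact hYb x)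
    rw [integral_const_mul, integral_add hwi.abs (integrable_const _)] at s1
    refine s1.trans ?_
    gcongr
    · exact integral_abs_le_l2 hL hw2
    · simp [Measure.real, ENNReal.toReal_ofReal (show (0 : ℝ) ≤ L + L by linarith)]
      apply le_of_eq; ring
  refine ⟨memHk_of_chain (fun j => if j = 3 then fun x => -A + b x else (dx L)^[j] v) ?_ ?_ ?_,
    κ₁, κ₂, -A, inferInstance, inferInstance, ?_, ?_, ?_, ?_⟩
  · exact ae_eq_rfl
  · intro j hj
    interval_cases j
    · exact hv.1.2 0 (by norm_num)
    · exact hv.1.2 1 (by norm_num)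
    · exact hwd
  · intro j hj
    interval_cases j
    · exact hv.1.1 0 (by norm_num)
    · exact hv.1.1 1 (by norm_num)
    · exact hv.1.1 2 (by norm_num)
    · simp only [if_true]
      refine MemLp.of_bound (measurable_const.add hbm).aestronglyMeasurable (|A| + m)
        (ae_of_all _ fun x => ?_)
      exact (abs_add_le _ _).trans (by rw [abs_neg]; gcongr; exact hbb x)
  · rw [abs_neg]
    have p1 : 0 ≤ R * √(2 * L) * m := by positivity
    have p2 : 0 ≤ R * (4 * L ^ 2) * l2 L w := by positivity
    nlinarith
  · refine hk1.trans ?_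
    have : 0 ≤ R * (√(2 * L) + 4 * L ^ 2) * (l2 L w + m) := by positivity
    nlinarith
  · refine hk2.trans ?_
    have : 0 ≤ R * (√(2 * L) + 4 * L ^ 2) * (l2 L w + m) := by positivity
    nlinarith
  · exact dx_eq_of_hasWeakDeriv hwd

end ThirdDerivative

/-! ### Estimates of Gagliardo seminorms: bounded variation, Lipschitz continuity, interpolation. -/

section Gagliardo

variable {L : ℝ}

theorem eLpNorm_two_sq {α : Type*} [MeasurableSpace α] (f : α → ℝ) (μ : Measure α) :
    eLpNorm f 2 μ ^ 2 = ∫⁻ x, ENNReal.ofReal (f x ^ 2) ∂μ := by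
  have := eLpNorm_nnreal_pow_eq_lintegral (f := f) (μ := μ) (p := 2) (by norm_num)
  simp only [NNReal.coe_ofNat, ENNReal.coe_ofNat, ENNReal.rpow_ofNat] at this
  rw [this]
  refine lintegral_congr fun x => ?_
  rw [Real.enorm_eq_ofReal_abs, ← ENNReal.ofReal_pow (abs_nonneg _), sq_abs]

theorem gagliardoSq_congr {θ : ℝ} {f g : ℝ → ℝ} (h : f =ᵐ[volume.restrict (dom L)] g) :
    gagliardoSq L θ f = gagliardoSq L θ g := by
  unfold gagliardoSq
  split_ifs
  · rfl
  · refine lintegral_congr_ae ?_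
    filter_upwards [h] with x hx
    refine lintegral_congr_ae ?_
    filter_upwards [h] with y hy
    rw [hx, hy]

/-- The weakly singular kernel `|s|^{-α}`. -/
noncomputable def singKer (α s : ℝ) : ℝ≥0∞ := ENNReal.ofReal |s| ^ (-α)

theorem measurable_singKer (α : ℝ) : Measurable (singKer α) := by
  unfold singKer; fun_prop

theorem singKer_neg (α s : ℝ) : singKer α (-s) = singKer α s := by simp [singKer]

theorem lintegral_singKer_Ioo {α : ℝ} (h0 : 0 < α) (h1 : α < 1) :
    ∫⁻ s in Ioo (0 : ℝ) 1, singKer α s < ⊤ := by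
  have hi : IntegrableOn (fun s : ℝ => s ^ (-α)) (Ioo 0 1) := by
    have := intervalIntegral.intervalIntegrable_rpow' (a := 0) (b := 1) (r := -α) (by linarith)
    rw [intervalIntegrable_iff_integrableOn_Ioo_of_le zero_le_one] at this
    exact this
  refine lt_of_le_of_lt (le_of_eq ?_) hi.lintegral_lt_top
  refine setLIntegral_congr_fun measurableSet_Ioo fun s hs => ?_
  simp only [singKer]
  rw [abs_of_pos hs.1, ENNReal.ofReal_rpow_of_pos hs.1]

/-- Within distance one of the singularity the kernel is covered by two integrable pieces, and it is
at most 1 elsewhere. Translation invariance makes the bound uniform in the position r of the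
singularity. -/
theorem exists_lintegral_singKer_le {α : ℝ} (h0 : 0 < α) (h1 : α < 1) (L : ℝ) :
    ∃ C : ℝ≥0∞, C ≠ ⊤ ∧ ∀ r, ∫⁻ x in dom L, singKer α (x - r) ≤ C := by
  set I := ∫⁻ s in Ioo (0 : ℝ) 1, singKer α s
  have hI : I ≠ ⊤ := (lintegral_singKer_Ioo h0 h1).ne
  refine ⟨I + I + ENNReal.ofReal (L - -L), by finiteness, fun r => ?_⟩
  set k₁ : ℝ → ℝ≥0∞ := (Ioo (0 : ℝ) 1).indicator (singKer α)
  set k₂ : ℝ → ℝ≥0∞ := fun s => k₁ (-s)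
  have m1 : Measurable k₁ := (measurable_singKer α).indicator measurableSet_Ioo
  have m2 : Measurable k₂ := m1.comp measurable_neg
  have hk : ∀ s, s ≠ 0 → singKer α s ≤ k₁ s + k₂ s + 1 := by
    intro s hs
    by_cases h : 1 ≤ |s|
    · have : singKer α s ≤ 1 := ENNReal.rpow_le_one_of_one_le_of_neg (by simpa using h) (by linarith)
      exact this.trans le_add_self
    · push Not at h
      rw [abs_lt] at h
      rcases lt_or_gt_of_ne hs with hs | hs
      · have : k₂ s = singKer α s := by
          simp only [k₂, k₁]
          rw [indicator_of_mem (by constructor <;> linarith), singKer_neg]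
        rw [this]
        exact le_add_right le_add_self
      · have : k₁ s = singKer α s := by
          simp only [k₁]
          rw [indicator_of_mem (by constructor <;> linarith)]
        rw [this]
        exact le_add_right le_self_add
  have hae : ∀ᵐ x ∂(volume.restrict (dom L)), singKer α (x - r) ≤ k₁ (x - r) + k₂ (x - r) + 1 := by
    have : ∀ᵐ x : ℝ, x ≠ r := by simp [ae_iff]
    filter_upwards [ae_restrict_of_ae this] with x hx
    exact hk _ (sub_ne_zero.2 hx)
  have e1 : ∫⁻ x, k₁ (x - r) = I := by
    rw [lintegral_sub_right_eq_self k₁ r, lintegral_indicator measurableSet_Ioo]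
  have e2 : ∫⁻ x, k₂ (x - r) = I := by
    rw [lintegral_sub_right_eq_self k₂ r, lintegral_neg_eq_self k₁,
      lintegral_indicator measurableSet_Ioo]
  calc ∫⁻ x in dom L, singKer α (x - r)
      ≤ ∫⁻ x in dom L, (k₁ (x - r) + k₂ (x - r) + 1) := lintegral_mono_ae hae
    _ = (∫⁻ x in dom L, k₁ (x - r)) + (∫⁻ x in dom L, k₂ (x - r)) + ∫⁻ x in dom L, 1 := by
        rw [lintegral_add_right _ measurable_const, lintegral_add_right]
        exact m2.comp (measurable_id.sub_const r)
    _ ≤ I + I + ENNReal.ofReal (L - -L) := by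
        gcongr
        · exact (setLIntegral_le_lintegral _ _).trans e1.le
        · exact (setLIntegral_le_lintegral _ _).trans e2.le
        · simp

theorem ofReal_div_rpow_le {α d N : ℝ} (hd : 0 < d) (hN : 0 ≤ N) :
    ENNReal.ofReal (N / d ^ α) = ENNReal.ofReal N * ENNReal.ofReal d ^ (-α) := by
  rw [ENNReal.ofReal_rpow_of_pos hd, ← ENNReal.ofReal_mul hN, Real.rpow_neg hd.le, div_eq_mul_inv]

/-- Functions of bounded variation belong to `H^θ(D)` for `θ < 1/2`. -/
theorem exists_gagliardoSq_bv_le {θ : ℝ} (h0 : 0 < θ) (h1 : θ < 1 / 2) (L : ℝ) :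
    ∃ C : ℝ≥0∞, C ≠ ⊤ ∧ ∀ (m c : ℝ) (κ₁ κ₂ : Measure ℝ) [IsFiniteMeasure κ₁] [IsFiniteMeasure κ₂],
      κ₁.real univ ≤ m → κ₂.real univ ≤ m →
      gagliardoSq L θ (fun x => c + (κ₁.real (Iic x) - κ₂.real (Iic x)))
        ≤ C * ENNReal.ofReal (m ^ 2) := by
  obtain ⟨W, hW, hWb⟩ := exists_lintegral_singKer_le (α := θ + 1 / 2) (by linarith) (by linarith) L
  refine ⟨4 * (W * W), by finiteness, fun m c κ₁ κ₂ _ _ hm1 hm2 => ?_⟩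
  have hm0 : 0 ≤ m := measureReal_nonneg.trans hm1
  set α := θ + 1 / 2 with hα
  set κ := κ₁ + κ₂ with hκ
  have hκm : κ.real univ ≤ 2 * m := by rw [hκ, measureReal_add_apply]; linarith
  have inc : ∀ (κ : Measure ℝ) [IsFiniteMeasure κ] (x y : ℝ), x ≤ y →
      κ.real (Iic y) - κ.real (Iic x) = κ.real (Ioc x y) := by
    intro κ _ x y hxy
    have hdj : Disjoint (Iic x) (Ioc x y) := by
      rw [Set.disjoint_left]
      intro z hz hz'
      exact absurd hz'.1 (not_lt.2 hz)
    rw [← Iic_union_Ioc_eq_Iic hxy, measureReal_union hdj measurableSet_Ioc]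
    ring
  set f : ℝ → ℝ := fun x => c + (κ₁.real (Iic x) - κ₂.real (Iic x)) with hf
  have hinc : ∀ x y, x ≤ y → |f x - f y| ≤ κ.real (Ioc x y) := by
    intro x y hxy
    have a1 := inc κ₁ x y hxy
    have a2 := inc κ₂ x y hxy
    have a3 : 0 ≤ κ₁.real (Ioc x y) := measureReal_nonneg
    have a4 : 0 ≤ κ₂.real (Ioc x y) := measureReal_nonneg
    rw [hκ, measureReal_add_apply, abs_le]
    constructor <;> simp only [hf] <;> linarith
  -- One factor |f(x) - f(y)| is bounded by the total mass, the other by κ((x, y]). For r in (x, y]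
  -- the distances |x - r| and |y - r| are at most |x - y|, and 1 + 2θ = 2α, so the kernel is
  -- dominated by a product of two kernels of order α < 1, which can be integrated one after the
  -- other.
  have hpt' : ∀ x y, x < y → ENNReal.ofReal ((f x - f y) ^ 2 / |x - y| ^ (1 + 2 * θ))
      ≤ ENNReal.ofReal (2 * m) * ∫⁻ r, singKer α (x - r) * singKer α (y - r) ∂κ := by
    intro x y hxy
    have hd : 0 < |x - y| := abs_pos.2 (by linarith)
    rw [ofReal_div_rpow_le hd (sq_nonneg _)]
    have s1 : ENNReal.ofReal ((f x - f y) ^ 2) ≤ ENNReal.ofReal (2 * m) * κ (Ioc x y) := by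
      have : κ (Ioc x y) = ENNReal.ofReal (κ.real (Ioc x y)) := (ofReal_measureReal).symm
      rw [this, ← ENNReal.ofReal_mul (by linarith)]
      refine ENNReal.ofReal_le_ofReal ?_
      have b1 := hinc x y hxy.le
      have b2 : κ.real (Ioc x y) ≤ 2 * m := (measureReal_mono (subset_univ _)).trans hκm
      rw [← sq_abs, sq]
      exact mul_le_mul (b1.trans b2) b1 (abs_nonneg _) (by linarith)
    have s2 : κ (Ioc x y) * ENNReal.ofReal |x - y| ^ (-(1 + 2 * θ))
        ≤ ∫⁻ r, singKer α (x - r) * singKer α (y - r) ∂κ := by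
      rw [mul_comm, ← setLIntegral_const]
      refine (setLIntegral_mono' measurableSet_Ioc fun r hr => ?_).trans
        (setLIntegral_le_lintegral _ _)
      have e : ENNReal.ofReal |x - y| ^ (-(1 + 2 * θ)) = singKer α (x - y) * singKer α (x - y) := by
        rw [singKer, ← ENNReal.rpow_add _ _ (by simpa using hd) (by finiteness)]
        congr 1; rw [hα]; ring
      rw [e]
      have hr1 := hr.1
      have hr2 := hr.2
      have mono : ∀ a b : ℝ, |a| ≤ |b| → singKer α b ≤ singKer α a := by
        intro a b hab
        rw [singKer, singKer, ENNReal.rpow_neg, ENNReal.rpow_neg]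
        gcongr
      gcongr
      · apply mono; rw [abs_of_neg (by linarith), abs_of_neg (by linarith)]; linarith
      · apply mono; rw [abs_of_nonneg (by linarith), abs_of_neg (by linarith)]; linarith
    calc _ ≤ ENNReal.ofReal (2 * m) * κ (Ioc x y) * ENNReal.ofReal |x - y| ^ (-(1 + 2 * θ)) := by
          gcongr
      _ ≤ _ := by rw [mul_assoc]; gcongr
  have hpt : ∀ x y, ENNReal.ofReal ((f x - f y) ^ 2 / |x - y| ^ (1 + 2 * θ))
      ≤ ENNReal.ofReal (2 * m) * ∫⁻ r, singKer α (x - r) * singKer α (y - r) ∂κ := by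
    intro x y
    rcases lt_trichotomy x y with h | h | h
    · exact hpt' x y h
    · subst h; simp
    · have := hpt' y x h
      rw [abs_sub_comm, ← neg_sub (f y), neg_sq, abs_sub_comm x y, abs_sub_comm y x] at *
      refine this.trans (le_of_eq ?_)
      congr 1
      exact lintegral_congr fun r => mul_comm _ _
  have mk : ∀ x, Measurable fun r => singKer α (x - r) := fun x =>
    (measurable_singKer α).comp (measurable_const.sub measurable_id)
  have mk' : ∀ r, Measurable fun x => singKer α (x - r) := fun x =>
    (measurable_singKer α).comp (measurable_id.sub measurable_const)
  have mk2 : Measurable fun p : ℝ × ℝ => singKer α (p.1 - p.2) :=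
    (measurable_singKer α).comp (measurable_fst.sub measurable_snd)
  rw [gagliardoSq, if_neg h0.ne']
  calc ∫⁻ x in dom L, ∫⁻ y in dom L, ENNReal.ofReal ((f x - f y) ^ 2 / |x - y| ^ (1 + 2 * θ))
      ≤ ∫⁻ x in dom L, ∫⁻ y in dom L, ENNReal.ofReal (2 * m)
          * ∫⁻ r, singKer α (x - r) * singKer α (y - r) ∂κ :=
        lintegral_mono fun x => lintegral_mono fun y => hpt x y
    _ = ENNReal.ofReal (2 * m) * ∫⁻ x in dom L, ∫⁻ y in dom L,
          ∫⁻ r, singKer α (x - r) * singKer α (y - r) ∂κ := by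
        rw [← lintegral_const_mul' _ _ ENNReal.ofReal_ne_top]
        refine lintegral_congr fun x => ?_
        rw [lintegral_const_mul' _ _ ENNReal.ofReal_ne_top]
    _ = ENNReal.ofReal (2 * m) * ∫⁻ x in dom L, ∫⁻ r, singKer α (x - r) *
          (∫⁻ y in dom L, singKer α (y - r)) ∂κ := by
        congr 1
        refine lintegral_congr fun x => ?_
        rw [lintegral_lintegral_swap]
        · refine lintegral_congr fun r => ?_
          rw [lintegral_const_mul _ (mk' r)]
        · exact (((mk x).comp measurable_snd).mul mk2).aemeasurable
    _ ≤ ENNReal.ofReal (2 * m) * ∫⁻ x in dom L, ∫⁻ r, singKer α (x - r) * W ∂κ := by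
        gcongr with x r
        exact hWb r
    _ = ENNReal.ofReal (2 * m) * ∫⁻ r, (∫⁻ x in dom L, singKer α (x - r)) * W ∂κ := by
        rw [lintegral_lintegral_swap]
        · congr 1
          refine lintegral_congr fun r => ?_
          rw [lintegral_mul_const _ (mk' r)]
        · exact (mk2.mul_const W).aemeasurable
    _ ≤ ENNReal.ofReal (2 * m) * ∫⁻ r, W * W ∂κ := by
        gcongr with r
        exact hWb r
    _ = ENNReal.ofReal (2 * m) * (W * W * κ univ) := by rw [lintegral_const]
    _ ≤ ENNReal.ofReal (2 * m) * (W * W * ENNReal.ofReal (2 * m)) := by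
        gcongr
        rw [← ofReal_measureReal (μ := κ) (s := univ)]
        exact ENNReal.ofReal_le_ofReal hκm
    _ = 4 * (W * W) * ENNReal.ofReal (m ^ 2) := by
        have : ENNReal.ofReal (2 * m) = 2 * ENNReal.ofReal m := by
          rw [ENNReal.ofReal_mul (by norm_num)]; simp
        rw [this, ENNReal.ofReal_pow hm0]
        ring

/-- Lipschitz functions belong to `H^θ(D)` for `θ < 1`. -/
theorem exists_gagliardoSq_lipschitz_le {θ : ℝ} (h0 : 1 / 2 < θ) (h1 : θ < 1) (L : ℝ) :
    ∃ C : ℝ≥0∞, C ≠ ⊤ ∧ ∀ (K : ℝ) (f : ℝ → ℝ), (∀ x y, |f x - f y| ≤ K * |x - y|) →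
      gagliardoSq L θ f ≤ C * ENNReal.ofReal (K ^ 2) := by
  -- Lipschitz continuity cancels two of the 1 + 2θ powers; the remaining order 2θ - 1 lies in (0,
  -- 1).
  obtain ⟨W, hW, hWb⟩ := exists_lintegral_singKer_le (α := 2 * θ - 1) (by linarith) (by linarith) L
  refine ⟨W * ENNReal.ofReal (L - -L), by finiteness, fun K f hf => ?_⟩
  have hpt : ∀ x y, ENNReal.ofReal ((f x - f y) ^ 2 / |x - y| ^ (1 + 2 * θ))
      ≤ ENNReal.ofReal (K ^ 2) * singKer (2 * θ - 1) (y - x) := by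
    intro x y
    by_cases hxy : x = y
    · subst hxy; simp
    have hd : 0 < |y - x| := abs_pos.2 (sub_ne_zero.2 (Ne.symm hxy))
    rw [singKer, ← ofReal_div_rpow_le hd (sq_nonneg _), abs_sub_comm x y]
    refine ENNReal.ofReal_le_ofReal ?_
    have e : |y - x| ^ (1 + 2 * θ) = |y - x| ^ 2 * |y - x| ^ (2 * θ - 1) := by
      rw [← Real.rpow_natCast, ← Real.rpow_add hd]; congr 1; push_cast; ring
    have hp : 0 < |y - x| ^ (2 * θ - 1) := Real.rpow_pos_of_pos hd _
    rw [e, ← div_div]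
    gcongr
    rw [div_le_iff₀ (by positivity), ← sq_abs (f x - f y), ← mul_pow, abs_sub_comm y x]
    exact pow_le_pow_left₀ (abs_nonneg _) (hf x y) 2
  rw [gagliardoSq, if_neg (by linarith)]
  calc _ ≤ ∫⁻ x in dom L, ∫⁻ y in dom L, ENNReal.ofReal (K ^ 2) * singKer (2 * θ - 1) (y - x) :=
        lintegral_mono fun x => lintegral_mono fun y => hpt x y
    _ ≤ ∫⁻ x in dom L, ENNReal.ofReal (K ^ 2) * W := by
        refine lintegral_mono fun x => ?_
        rw [lintegral_const_mul' _ _ ENNReal.ofReal_ne_top]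
        gcongr
        exact hWb x
    _ = W * ENNReal.ofReal (L - -L) * ENNReal.ofReal (K ^ 2) := by
        rw [lintegral_const, Measure.restrict_apply_univ, Real.volume_Ioo]; ring

/-- Interpolation between `L₂(D)` and `H^{θ'}(D)`. -/
theorem gagliardoSq_interpolation (hL : 0 < L) {θ θ' δ : ℝ} (h0 : 0 < θ) (h1 : θ < θ')
    (hδ : 0 < δ) {f : ℝ → ℝ} (hf : AEStronglyMeasurable f (volume.restrict (dom L))) :
    gagliardoSq L θ f ≤ ENNReal.ofReal (δ ^ (2 * (θ' - θ))) * gagliardoSq L θ' f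
      + ENNReal.ofReal (δ ^ (-(1 + 2 * θ)) * (8 * L))
        * eLpNorm f 2 (volume.restrict (dom L)) ^ 2 := by
  rw [gagliardoSq_congr (θ := θ) hf.ae_eq_mk, gagliardoSq_congr (θ := θ') hf.ae_eq_mk,
    eLpNorm_congr_ae hf.ae_eq_mk]
  set g := hf.mk f
  have hg : Measurable g := hf.stronglyMeasurable_mk.measurable
  have hpt : ∀ x y, ENNReal.ofReal ((g x - g y) ^ 2 / |x - y| ^ (1 + 2 * θ))
      ≤ ENNReal.ofReal (δ ^ (2 * (θ' - θ)))
          * ENNReal.ofReal ((g x - g y) ^ 2 / |x - y| ^ (1 + 2 * θ'))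
        + ENNReal.ofReal (δ ^ (-(1 + 2 * θ)))
          * (2 * ENNReal.ofReal (g x ^ 2) + 2 * ENNReal.ofReal (g y ^ 2)) := by
    intro x y
    by_cases hxy : x = y
    · subst hxy; simp
    have hd : 0 < |x - y| := abs_pos.2 (sub_ne_zero.2 hxy)
    have e2 : (2 : ℝ≥0∞) = ENNReal.ofReal 2 := by simp
    rw [e2, ← ENNReal.ofReal_mul (by positivity), ← ENNReal.ofReal_mul (by positivity),
      ← ENNReal.ofReal_mul (by positivity), ← ENNReal.ofReal_add (by positivity) (by positivity),
      ← ENNReal.ofReal_mul (by positivity), ← ENNReal.ofReal_add (by positivity) (by positivity)]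
    refine ENNReal.ofReal_le_ofReal ?_
    have hN : (g x - g y) ^ 2 ≤ 2 * g x ^ 2 + 2 * g y ^ 2 := by nlinarith [sq_nonneg (g x + g y)]
    rw [div_eq_mul_inv, div_eq_mul_inv, ← Real.rpow_neg hd.le, ← Real.rpow_neg hd.le]
    have hNn := sq_nonneg (g x - g y)
    have hp' : 0 ≤ |x - y| ^ (-(1 + 2 * θ')) := by positivity
    have hδp : 0 ≤ δ ^ (-(1 + 2 * θ)) := by positivity
    have hδq : 0 ≤ δ ^ (2 * (θ' - θ)) := by positivity
    -- Close to the diagonal the excess power |x - y|^{2(θ' - θ)} is small; away from it the kernel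
    -- is bounded by a power of δ and the L₂-norm suffices.
    rcases le_total |x - y| δ with h | h
    · have e : |x - y| ^ (-(1 + 2 * θ))
          = |x - y| ^ (2 * (θ' - θ)) * |x - y| ^ (-(1 + 2 * θ')) := by
        rw [← Real.rpow_add hd]; congr 1; ring
      have : |x - y| ^ (2 * (θ' - θ)) ≤ δ ^ (2 * (θ' - θ)) :=
        Real.rpow_le_rpow hd.le h (by linarith)
      rw [e]
      have q1 : (g x - g y) ^ 2 * (|x - y| ^ (2 * (θ' - θ)) * |x - y| ^ (-(1 + 2 * θ')))
          ≤ δ ^ (2 * (θ' - θ)) * ((g x - g y) ^ 2 * |x - y| ^ (-(1 + 2 * θ'))) := by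
        calc _ = |x - y| ^ (2 * (θ' - θ)) * ((g x - g y) ^ 2 * |x - y| ^ (-(1 + 2 * θ'))) := by ring
          _ ≤ _ := by gcongr
      have q2 : 0 ≤ δ ^ (-(1 + 2 * θ)) * (2 * g x ^ 2 + 2 * g y ^ 2) := by positivity
      linarith
    · have : |x - y| ^ (-(1 + 2 * θ)) ≤ δ ^ (-(1 + 2 * θ)) :=
        Real.rpow_le_rpow_of_nonpos hδ h (by linarith)
      have q1 : (g x - g y) ^ 2 * |x - y| ^ (-(1 + 2 * θ))
          ≤ δ ^ (-(1 + 2 * θ)) * (2 * g x ^ 2 + 2 * g y ^ 2) := by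
        rw [mul_comm]
        exact mul_le_mul this hN hNn hδp
      have q2 : 0 ≤ δ ^ (2 * (θ' - θ)) * ((g x - g y) ^ 2 * |x - y| ^ (-(1 + 2 * θ'))) := by
        positivity
      linarith
  have hvol : (volume.restrict (dom L)) univ = ENNReal.ofReal (2 * L) := by
    rw [Measure.restrict_apply_univ, Real.volume_Ioo]; ring_nf
  set G := ∫⁻ y in dom L, ENNReal.ofReal (g y ^ 2) with hG
  have mg : Measurable fun y => 2 * ENNReal.ofReal (g y ^ 2) := by fun_prop
  rw [gagliardoSq, if_neg h0.ne', gagliardoSq, if_neg (h0.trans h1).ne', eLpNorm_two_sq, ← hG]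
  calc _ ≤ ∫⁻ x in dom L, ∫⁻ y in dom L, (ENNReal.ofReal (δ ^ (2 * (θ' - θ)))
          * ENNReal.ofReal ((g x - g y) ^ 2 / |x - y| ^ (1 + 2 * θ'))
        + ENNReal.ofReal (δ ^ (-(1 + 2 * θ)))
          * (2 * ENNReal.ofReal (g x ^ 2) + 2 * ENNReal.ofReal (g y ^ 2))) :=
        lintegral_mono fun x => lintegral_mono fun y => hpt x y
    _ = ∫⁻ x in dom L, (ENNReal.ofReal (δ ^ (2 * (θ' - θ))) * (∫⁻ y in dom L,
            ENNReal.ofReal ((g x - g y) ^ 2 / |x - y| ^ (1 + 2 * θ')))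
        + ENNReal.ofReal (δ ^ (-(1 + 2 * θ)))
          * (2 * ENNReal.ofReal (g x ^ 2) * ENNReal.ofReal (2 * L) + 2 * G)) := by
        refine lintegral_congr fun x => ?_
        rw [lintegral_add_right _ (show Measurable fun y => ENNReal.ofReal (δ ^ (-(1 + 2 * θ)))
            * (2 * ENNReal.ofReal (g x ^ 2) + 2 * ENNReal.ofReal (g y ^ 2)) by fun_prop),
          lintegral_const_mul' _ _ ENNReal.ofReal_ne_top,
          lintegral_const_mul' _ _ ENNReal.ofReal_ne_top,
          lintegral_add_right _ mg, lintegral_const, hvol, lintegral_const_mul' _ _ (by simp)]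
    _ = ENNReal.ofReal (δ ^ (2 * (θ' - θ))) * (∫⁻ x in dom L, ∫⁻ y in dom L,
            ENNReal.ofReal ((g x - g y) ^ 2 / |x - y| ^ (1 + 2 * θ')))
        + ENNReal.ofReal (δ ^ (-(1 + 2 * θ)))
          * (2 * G * ENNReal.ofReal (2 * L) + 2 * G * ENNReal.ofReal (2 * L)) := by
        rw [lintegral_add_right _ (show Measurable fun x => ENNReal.ofReal (δ ^ (-(1 + 2 * θ)))
            * (2 * ENNReal.ofReal (g x ^ 2) * ENNReal.ofReal (2 * L) + 2 * G) by fun_prop),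
          lintegral_const_mul' _ _ ENNReal.ofReal_ne_top,
          lintegral_const_mul' _ _ ENNReal.ofReal_ne_top,
          lintegral_add_right _ measurable_const, lintegral_const, hvol,
          lintegral_mul_const' _ _ ENNReal.ofReal_ne_top, lintegral_const_mul' _ _ (by simp)]
    _ = _ := by
        congr 1
        have : ENNReal.ofReal (δ ^ (-(1 + 2 * θ)) * (8 * L))
            = ENNReal.ofReal (δ ^ (-(1 + 2 * θ))) * (4 * ENNReal.ofReal (2 * L)) := by
          rw [ENNReal.ofReal_mul (by positivity)]
          congr 1
          rw [show (8 : ℝ) * L = 4 * (2 * L) by ring, ENNReal.ofReal_mul (by norm_num)]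
          simp
        rw [this]; ring

end Gagliardo

/-! ### Strong measurability with values in H^s(D), s < 7/2. -/

section StrongMeasurability

variable {L : ℝ}

theorem abs_bv_le {m c : ℝ} {κ₁ κ₂ : Measure ℝ} [IsFiniteMeasure κ₁] [IsFiniteMeasure κ₂]
    (hc : |c| ≤ m) (h1 : κ₁.real univ ≤ m) (h2 : κ₂.real univ ≤ m) (x : ℝ) :
    |c + (κ₁.real (Iic x) - κ₂.real (Iic x))| ≤ 2 * m := by
  have a1 : κ₁.real (Iic x) ≤ m := (measureReal_mono (subset_univ _)).trans h1
  have a2 : κ₂.real (Iic x) ≤ m := (measureReal_mono (subset_univ _)).trans h2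
  have a3 : 0 ≤ κ₁.real (Iic x) := measureReal_nonneg
  have a4 : 0 ≤ κ₂.real (Iic x) := measureReal_nonneg
  have := abs_le.1 hc
  rw [abs_le]; constructor <;> linarith

theorem integral_real_Iic_mul (κ : Measure ℝ) [IsFiniteMeasure κ] {f : ℝ → ℝ}
    (hf : IntegrableOn f (dom L)) :
    ∫ x in dom L, κ.real (Iic x) * f x
      = ∫ t, (∫ x in Ici t, f x ∂(volume.restrict (dom L))) ∂κ := by
  have hi : Integrable (fun p : ℝ × ℝ => f p.1 * (1 : ℝ)) ((volume.restrict (dom L)).prod κ) :=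
    Integrable.mul_prod (g := fun _ : ℝ => (1 : ℝ)) hf (integrable_const _)
  have hm : MeasurableSet {p : ℝ × ℝ | p.2 ≤ p.1} := measurableSet_le measurable_snd measurable_fst
  have e1 : ∀ x, κ.real (Iic x) * f x
      = ∫ t, {p : ℝ × ℝ | p.2 ≤ p.1}.indicator (fun p => f p.1 * 1) (x, t) ∂κ := by
    intro x
    rw [← setIntegral_one_Iic, ← integral_indicator measurableSet_Iic, mul_comm,
      ← integral_const_mul]
    congr 1; ext t
    by_cases h : t ≤ x <;> simp [h]
  simp_rw [e1]
  rw [integral_integral_swap (f := fun x t => {p : ℝ × ℝ | p.2 ≤ p.1}.indicator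
    (fun p => f p.1 * 1) (x, t)) (hi.indicator hm)]
  congr 1; ext t
  rw [← integral_indicator measurableSet_Ici]
  congr 1; ext x
  by_cases h : t ≤ x <;> simp [h]

/-- The continuous representative E of the second derivative has the bounded derivative f = ∂ₓ³e.
The last bound interpolates between ∂ₓ²e in L₂ and the variation of f: averaging over intervals of
length h gives |E| ≤ S, and integrating f² by parts leaves increments of E integrated against the
two measures, at most 2Sm each, together with the term from c. -/
theorem BV3.exists_primitive (hL : 0 < L) {m : ℝ} {e : ℝ → ℝ} (he : BV3 L m e) :
    ∃ E : ℝ → ℝ, (dx L)^[2] e =ᵐ[volume.restrict (dom L)] E ∧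
      (∀ x y, |E x - E y| ≤ 2 * m * |x - y|) ∧ ∀ h, 0 < h → h ≤ L →
        eLpNorm ((dx L)^[3] e) 2 (volume.restrict (dom L)) ^ 2
          ≤ ENNReal.ofReal (6 * m * (√(2 * L) * l2 L ((dx L)^[2] e) / h + 2 * m * h)) := by
  have hm0 := he.nonneg
  obtain ⟨h3, κ₁, κ₂, c, _, _, hc, k1, k2, hf⟩ := he
  set f : ℝ → ℝ := fun x => c + (κ₁.real (Iic x) - κ₂.real (Iic x)) with hfdef
  have hfb : ∀ x, |f x| ≤ 2 * m := abs_bv_le hc k1 k2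
  have mκ : ∀ (κ : Measure ℝ) [IsFiniteMeasure κ], Measurable fun x => κ.real (Iic x) :=
    fun κ _ => (monotone_real_Iic κ).measurable
  have hfm : Measurable f := measurable_const.add ((mκ κ₁).sub (mκ κ₂))
  have hfi : IntegrableOn f (dom L) := integrable_dom_of_bounded hfm hfb
  obtain ⟨c', hc'⟩ := ((h3.2 2 (by norm_num)).congr ae_eq_rfl hf).exists_eq_primitive hL hfi
  set E : ℝ → ℝ := fun x => c' + ∫ t in Iic x, f t ∂(volume.restrict (dom L)) with hE
  have hEinc : ∀ x y, x ≤ y → E y - E x = ∫ t in Ioc x y, f t ∂(volume.restrict (dom L)) := by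
    intro x y hxy
    rw [← intervalIntegral.integral_of_le hxy,
      ← intervalIntegral.integral_Iic_sub_Iic (Integrable.integrableOn hfi)
        (Integrable.integrableOn hfi)]
    simp only [hE]; ring
  have hlip' : ∀ x y, x ≤ y → |E x - E y| ≤ 2 * m * |x - y| := by
    intro x y hxy
    rw [abs_sub_comm, hEinc x y hxy, abs_sub_comm x y, abs_of_nonneg (sub_nonneg.2 hxy)]
    have := norm_setIntegral_le_of_norm_le_const (μ := volume.restrict (dom L)) (f := f)
      (s := Ioc x y) (C := 2 * m) (measure_lt_top _ _) (fun t _ => hfb t)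
    refine this.trans ?_
    gcongr
    rw [← sub_nonneg] at hxy
    refine ENNReal.toReal_le_of_le_ofReal hxy ?_
    exact (Measure.restrict_apply_le _ _).trans (by rw [Real.volume_Ioc])
  have hlip : ∀ x y, |E x - E y| ≤ 2 * m * |x - y| := by
    intro x y
    rcases le_total x y with h | h
    · exact hlip' x y h
    · rw [abs_sub_comm, abs_sub_comm x]; exact hlip' y x h
  refine ⟨E, hc', hlip, fun h hh hhL => ?_⟩
  have hE2 : MemLp E 2 (volume.restrict (dom L)) := (memLp_congr_ae hc').1 (h3.1 2 (by norm_num))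
  have hEi : IntegrableOn (fun x => |E x|) (dom L) := (integrableOn_of_memLp hE2).abs
  have hl2 : l2 L ((dx L)^[2] e) = l2 L E := by rw [l2, l2, eLpNorm_congr_ae hc']
  set S := √(2 * L) * l2 L ((dx L)^[2] e) / h + 2 * m * h with hS
  have hS0 : 0 ≤ S := by
    have : 0 ≤ l2 L ((dx L)^[2] e) := ENNReal.toReal_nonneg
    positivity
  have hEb : ∀ r ∈ Icc (-L) L, |E r| ≤ S := by
    intro r hr
    -- The interval of length h extends from r towards the centre of D; since h ≤ L it stays inside.
    obtain ⟨a, ha1, ha2⟩ : ∃ a, Ioo a (a + h) ⊆ dom L ∧ ∀ y ∈ Ioo a (a + h), |r - y| ≤ h := by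
      rcases le_total r 0 with h0 | h0
      · exact ⟨r, fun y hy => ⟨by linarith [hy.1, hr.1], by linarith [hy.2]⟩, fun y hy => by
          rw [abs_le]; constructor <;> linarith [hy.1, hy.2]⟩
      · exact ⟨r - h, fun y hy => ⟨by linarith [hy.1], by linarith [hy.2, hr.2]⟩, fun y hy => by
          rw [abs_le]; constructor <;> linarith [hy.1, hy.2]⟩
    have e1 : ∫ _ in Ioo a (a + h), |E r| = h * |E r| := by
      rw [setIntegral_const, Measure.real, Real.volume_Ioo, add_sub_cancel_left,
        ENNReal.toReal_ofReal hh.le, smul_eq_mul]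
    have e2 : ∫ _ in Ioo a (a + h), 2 * m * h = h * (2 * m * h) := by
      rw [setIntegral_const, Measure.real, Real.volume_Ioo, add_sub_cancel_left,
        ENNReal.toReal_ofReal hh.le, smul_eq_mul]
    have hvol : volume (Ioo a (a + h)) ≠ ⊤ := by rw [Real.volume_Ioo]; exact ENNReal.ofReal_ne_top
    have e3 : ∫ _ in Ioo a (a + h), |E r| ≤ ∫ y in Ioo a (a + h), (|E y| + 2 * m * h) := by
      refine setIntegral_mono_on (integrableOn_const hvol)
        ((hEi.mono_set ha1).add (integrableOn_const hvol))
        measurableSet_Ioo fun y hy => ?_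
      have q1 := (abs_sub_abs_le_abs_sub (E r) (E y)).trans (hlip r y)
      have q2 : 2 * m * |r - y| ≤ 2 * m * h := by gcongr; exact ha2 y hy
      linarith
    rw [integral_add (hEi.mono_set ha1) (integrableOn_const hvol), e1, e2] at e3
    have e4 : ∫ y in Ioo a (a + h), |E y| ≤ √(2 * L) * l2 L ((dx L)^[2] e) := by
      rw [hl2]
      exact (setIntegral_mono_set hEi (ae_of_all _ fun _ => abs_nonneg _)
        (HasSubset.Subset.eventuallyLE ha1)).trans (integral_abs_le_l2 hL hE2)
    have e5 : h * |E r| ≤ h * S := by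
      have : h * S = √(2 * L) * l2 L ((dx L)^[2] e) + h * (2 * m * h) := by
        rw [hS]; field_simp
      linarith
    exact le_of_mul_le_mul_left e5 hh
  -- The measures live on the whole line, so E has to be bounded outside [-L, L] too; there it is
  -- constant on either side, being a primitive with respect to the measure restricted to D.
  have hEb' : ∀ r, |E r| ≤ S := by
    intro r
    have : E r = E (max (-L) (min r L)) := by
      simp only [hE]
      rw [Measure.restrict_restrict measurableSet_Iic, Measure.restrict_restrict measurableSet_Iic]
      congr 3
      ext x
      simp only [mem_inter_iff, mem_Iic, mem_Ioo, le_max_iff, le_min_iff]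
      constructor
      · rintro ⟨p1, p2, p3⟩; exact ⟨Or.inr ⟨p1, p3.le⟩, p2, p3⟩
      · rintro ⟨p1, p2, p3⟩
        refine ⟨?_, p2, p3⟩
        rcases p1 with p1 | p1
        · linarith
        · exact p1.1
    rw [this]
    exact hEb _ ⟨le_max_left _ _, max_le (by linarith) (min_le_right _ _)⟩
  have hEL : ∀ r, ∫ t in Ici r, f t ∂(volume.restrict (dom L)) = E L - E r := by
    intro r
    have a1 : ∫ t in Ici r, f t ∂(volume.restrict (dom L))
        = (∫ t in dom L, f t) - ∫ t in Iic r, f t ∂(volume.restrict (dom L)) := by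
      rw [integral_Ici_eq_integral_Ioi, ← compl_Iic, setIntegral_compl measurableSet_Iic hfi]
    have a2 : ∫ t in Iic L, f t ∂(volume.restrict (dom L)) = ∫ t in dom L, f t := by
      rw [Measure.restrict_restrict measurableSet_Iic, inter_eq_self_of_subset_right]
      exact fun x hx => hx.2.le
    rw [a1, ← a2]; simp only [hE]; ring
  have hT : ∀ r, |E L - E r| ≤ 2 * S := fun r =>
    (abs_sub _ _).trans (by linarith [hEb' L, hEb' r])
  have hTκ : ∀ (κ : Measure ℝ) [IsFiniteMeasure κ], κ.real univ ≤ m →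
      |∫ x in dom L, κ.real (Iic x) * f x| ≤ 2 * S * m := by
    intro κ _ hk
    rw [integral_real_Iic_mul κ hfi]
    simp_rw [hEL]
    refine (norm_integral_le_of_norm_le_const (f := fun t => E L - E t) (C := 2 * S)
      (ae_of_all _ hT)).trans ?_
    gcongr
  have hκi : ∀ (κ : Measure ℝ) [IsFiniteMeasure κ],
      IntegrableOn (fun x => κ.real (Iic x) * f x) (dom L) := fun κ _ =>
    Integrable.bdd_mul hfi (mκ κ).aestronglyMeasurable (ae_of_all _ fun x => by
      rw [Real.norm_of_nonneg measureReal_nonneg]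
      exact measureReal_mono (subset_univ _))
  have hf0 : |∫ x in dom L, f x| ≤ 2 * S := by
    have := hEL (-L)
    rw [integral_Ici_eq_integral_Ioi, Measure.restrict_restrict measurableSet_Ioi,
      inter_eq_self_of_subset_right (fun x hx => hx.1)] at this
    rw [this]; exact hT _
  -- Only one of the two factors f is expanded into the constant and the distribution functions; the
  -- other one is integrated by parts against κ₁ and κ₂.
  have hff : ∫ x in dom L, f x ^ 2 = c * (∫ x in dom L, f x)
      + ((∫ x in dom L, κ₁.real (Iic x) * f x) - ∫ x in dom L, κ₂.real (Iic x) * f x) := by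
    rw [← integral_const_mul, ← integral_sub (hκi κ₁) (hκi κ₂), ← integral_add (hfi.const_mul c)
      (g := fun x => κ₁.real (Iic x) * f x - κ₂.real (Iic x) * f x) ((hκi κ₁).sub (hκi κ₂))]
    congr 1; ext x; simp only [hfdef]; ring
  rw [eLpNorm_congr_ae hf, eLpNorm_two_sq, ← ofReal_integral_eq_lintegral_ofReal]
  · refine ENNReal.ofReal_le_ofReal ?_
    rw [hff]
    have t1 := abs_le.1 (hTκ κ₁ k1)
    have t2 := abs_le.1 (hTκ κ₂ k2)
    have t3 : c * (∫ x in dom L, f x) ≤ m * (2 * S) :=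
      (le_abs_self _).trans (by rw [abs_mul]; gcongr)
    linarith [t1.2, t2.1]
  · exact integrable_dom_of_bounded (hfm.pow_const 2) (C := (2 * m) ^ 2) fun x => by
      rw [abs_pow]; exact pow_le_pow_left₀ (abs_nonneg _) (hfb x) 2
  · exact ae_of_all _ fun x => sq_nonneg _

theorem BV3.eLpNorm_le (hL : 0 < L) {m : ℝ} {e : ℝ → ℝ} (he : BV3 L m e) :
    eLpNorm ((dx L)^[3] e) 2 (volume.restrict (dom L)) ^ 2
      ≤ ENNReal.ofReal (8 * L) * ENNReal.ofReal (m ^ 2) := by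
  obtain ⟨h3, κ₁, κ₂, c, _, _, hc, k1, k2, hf⟩ := he
  rw [eLpNorm_congr_ae hf, eLpNorm_two_sq]
  calc _ ≤ ∫⁻ _ in dom L, ENNReal.ofReal (4 * m ^ 2) := by
        refine lintegral_mono fun x => ENNReal.ofReal_le_ofReal ?_
        rw [← sq_abs]
        have := pow_le_pow_left₀ (abs_nonneg _) (abs_bv_le hc k1 k2 x) 2
        linarith
    _ = _ := by
        rw [lintegral_const, Measure.restrict_apply_univ, Real.volume_Ioo,
          ← ENNReal.ofReal_mul (by positivity), ← ENNReal.ofReal_mul (by positivity)]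
        congr 1; ring

theorem tendsto_eLpNorm_dx_three (hL : 0 < L) {m : ℝ} {e : ℕ → ℝ → ℝ} (he : ∀ n, BV3 L m (e n))
    (h2 : Tendsto (fun n => eLpNorm ((dx L)^[2] (e n)) 2 (volume.restrict (dom L))) atTop (𝓝 0)) :
    Tendsto (fun n => eLpNorm ((dx L)^[3] (e n)) 2 (volume.restrict (dom L)) ^ 2) atTop (𝓝 0) := by
  have hl : Tendsto (fun n => l2 L ((dx L)^[2] (e n))) atTop (𝓝 0) := by
    have := (ENNReal.tendsto_toReal ENNReal.zero_ne_top).comp h2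
    rwa [ENNReal.toReal_zero] at this
  have hm0 := (he 0).nonneg
  rw [ENNReal.tendsto_nhds_zero]
  intro ε hε
  have hlim : Tendsto (fun h : ℝ => ENNReal.ofReal (6 * m * (1 * h + 2 * m * h))) (𝓝[>] 0)
      (𝓝 0) := by
    have : Tendsto (fun h : ℝ => ENNReal.ofReal (6 * m * (1 * h + 2 * m * h))) (𝓝 0)
        (𝓝 (ENNReal.ofReal (6 * m * (1 * 0 + 2 * m * 0)))) :=
      (ENNReal.continuous_ofReal.comp (by fun_prop)).tendsto 0
    simp only [mul_zero, add_zero, ENNReal.ofReal_zero] at this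
    exact this.mono_left nhdsWithin_le_nhds
  obtain ⟨h, ⟨hh1, hh2⟩, hh0⟩ := (((ENNReal.tendsto_nhds_zero.1 hlim ε hε).and
    (nhdsWithin_le_nhds (Iic_mem_nhds hL))).and self_mem_nhdsWithin).exists
  have hh0' : (0 : ℝ) < h := hh0
  -- With this threshold for the norm of the second derivative, the quotient √(2L)·l2/h is at most
  -- h.
  have hpos : 0 < h ^ 2 / √(2 * L) := by positivity
  filter_upwards [hl.eventually (Iic_mem_nhds hpos)] with n hn
  obtain ⟨E, -, -, hE⟩ := (he n).exists_primitive hL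
  refine (hE h hh0' hh2).trans (le_trans (ENNReal.ofReal_le_ofReal ?_) hh1)
  gcongr
  rw [div_le_iff₀ hh0', one_mul]
  have hn' : l2 L ((dx L)^[2] (e n)) ≤ h ^ 2 / √(2 * L) := hn
  rw [le_div_iff₀ (by positivity)] at hn'
  nlinarith

/-- In the interpolation inequality δ is fixed first, which makes the term of order θ' small
uniformly in n; afterwards the L₂-term tends to zero. -/
theorem tendsto_gagliardoSq (hL : 0 < L) {θ θ' : ℝ} (h0 : 0 < θ) (h1 : θ < θ') {B : ℝ≥0∞}
    (hB : B ≠ ⊤) {f : ℕ → ℝ → ℝ} (hf : ∀ n, AEStronglyMeasurable (f n) (volume.restrict (dom L)))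
    (hfB : ∀ n, gagliardoSq L θ' (f n) ≤ B)
    (h2 : Tendsto (fun n => eLpNorm (f n) 2 (volume.restrict (dom L)) ^ 2) atTop (𝓝 0)) :
    Tendsto (fun n => gagliardoSq L θ (f n)) atTop (𝓝 0) := by
  rw [ENNReal.tendsto_nhds_zero]
  intro ε hε
  have hq : 0 < 2 * (θ' - θ) := by linarith
  have hlim : Tendsto (fun δ : ℝ => ENNReal.ofReal (δ ^ (2 * (θ' - θ))) * B) (𝓝[>] 0) (𝓝 0) := by
    have a1 : Tendsto (fun δ : ℝ => δ ^ (2 * (θ' - θ))) (𝓝 0) (𝓝 0) := by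
      have := (Real.continuousAt_rpow_const 0 _ (Or.inr hq.le)).tendsto
      rwa [Real.zero_rpow hq.ne'] at this
    have a2 := ENNReal.Tendsto.mul_const (b := B) (ENNReal.tendsto_ofReal a1) (Or.inr hB)
    rw [ENNReal.ofReal_zero, zero_mul] at a2
    exact a2.mono_left nhdsWithin_le_nhds
  have hε2 : 0 < ε / 2 := ENNReal.half_pos hε.ne'
  obtain ⟨δ, hδ1, hδ0⟩ := ((ENNReal.tendsto_nhds_zero.1 hlim _ hε2).and
    self_mem_nhdsWithin).exists
  have hlim2 := ENNReal.Tendsto.const_mul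
    (a := ENNReal.ofReal (δ ^ (-(1 + 2 * θ)) * (8 * L))) h2 (Or.inr ENNReal.ofReal_ne_top)
  rw [mul_zero] at hlim2
  filter_upwards [ENNReal.tendsto_nhds_zero.1 hlim2 _ hε2] with n hn
  refine (gagliardoSq_interpolation hL h0 h1 hδ0 (hf n)).trans ?_
  calc _ ≤ ε / 2 + ε / 2 := by
        gcongr
        exact (mul_le_mul_right (hfB n) _).trans hδ1
    _ = ε := ENNReal.add_halves ε

theorem gagliardoSq_zero (f : ℝ → ℝ) : gagliardoSq L 0 f = 0 := by simp [gagliardoSq]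

theorem normH_sq {s : ℝ} {v : ℝ → ℝ} (hv : MemHk L ⌊s⌋₊ v) : normH L s v ^ 2 =
    (∑ j ∈ Finset.range (⌊s⌋₊ + 1), eLpNorm ((dx L)^[j] v) 2 (volume.restrict (dom L)) ^ 2)
      + gagliardoSq L (Int.fract s) ((dx L)^[⌊s⌋₊] v) := by
  rw [normH, if_pos hv, ← ENNReal.rpow_ofNat, ← ENNReal.rpow_mul]
  norm_num

theorem normH_two_sq {v : ℝ → ℝ} (hv : MemHk L 2 v) : normH L 2 v ^ 2 =
    ∑ j ∈ Finset.range 3, eLpNorm ((dx L)^[j] v) 2 (volume.restrict (dom L)) ^ 2 := by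
  have h := normH_sq (L := L) (s := 2) (v := v) (by simpa using hv)
  have : Int.fract (2 : ℝ) = 0 := by simp
  rw [this, gagliardoSq_zero] at h
  simpa using h

theorem normH_two_lt_top {v : ℝ → ℝ} (hv : MemHk L 2 v) : normH L 2 v < ⊤ := by
  have h : normH L 2 v ^ 2 < ⊤ := by
    rw [normH_two_sq hv, ENNReal.sum_lt_top]
    intro j hj
    rw [Finset.mem_range] at hj
    exact ENNReal.pow_lt_top (hv.1 j (by omega)).2
  by_contra hcon
  rw [not_lt, top_le_iff] at hcon
  rw [hcon] at h
  simp at h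

theorem eLpNorm_le_normH_two {v : ℝ → ℝ} (hv : MemHk L 2 v) {j : ℕ} (hj : j ≤ 2) :
    eLpNorm ((dx L)^[j] v) 2 (volume.restrict (dom L)) ≤ normH L 2 v := by
  have h := normH_two_sq hv
  have h2 : eLpNorm ((dx L)^[j] v) 2 (volume.restrict (dom L)) ^ 2 ≤ normH L 2 v ^ 2 := by
    rw [h]
    exact Finset.single_le_sum (f := fun j => eLpNorm ((dx L)^[j] v) 2 (volume.restrict (dom L)) ^ 2)
      (fun _ _ => zero_le) (Finset.mem_range.2 (by omega))
  exact (ENNReal.pow_le_pow_left_iff (by norm_num)).1 h2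

theorem normH_two_le_sum {v : ℝ → ℝ} (hv : MemHk L 2 v) : normH L 2 v ≤
    ∑ j ∈ Finset.range 3, eLpNorm ((dx L)^[j] v) 2 (volume.restrict (dom L)) := by
  refine (ENNReal.pow_le_pow_left_iff (n := 2) (by norm_num)).1 ?_
  rw [normH_two_sq hv]
  simp only [Finset.sum_range_succ, Finset.sum_range_zero, zero_add]
  set a := eLpNorm ((dx L)^[0] v) 2 (volume.restrict (dom L))
  set b := eLpNorm ((dx L)^[1] v) 2 (volume.restrict (dom L))
  set c := eLpNorm ((dx L)^[2] v) 2 (volume.restrict (dom L))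
  calc a ^ 2 + b ^ 2 + c ^ 2 ≤ a ^ 2 + b ^ 2 + c ^ 2 + 2 * (a * b + a * c + b * c) := le_self_add
    _ = (a + b + c) ^ 2 := by ring

theorem normH_two_sub_le {v w z : ℝ → ℝ} (hv : MemHk L 2 v) (hw : MemHk L 2 w)
    (hz : MemHk L 2 z) :
    normH L 2 (v - w) ≤ 3 * (normH L 2 (v - z) + normH L 2 (z - w)) := by
  refine (normH_two_le_sum (hv.sub hw).1).trans ?_
  have : ∀ j ∈ Finset.range 3, eLpNorm ((dx L)^[j] (v - w)) 2 (volume.restrict (dom L))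
      ≤ normH L 2 (v - z) + normH L 2 (z - w) := by
    intro j hj
    have hj : j ≤ 2 := by rw [Finset.mem_range] at hj; omega
    have e : (dx L)^[j] (v - w) =ᵐ[volume.restrict (dom L)]
        (dx L)^[j] (v - z) + (dx L)^[j] (z - w) := by
      filter_upwards [(hv.sub hw).2 j hj, (hv.sub hz).2 j hj, (hz.sub hw).2 j hj] with x h1 h2 h3
      rw [h1, Pi.add_apply, h2, h3]; simp
    rw [eLpNorm_congr_ae e]
    refine (eLpNorm_add_le ((hv.sub hz).1.1 j hj).1 ((hz.sub hw).1.1 j hj).1 (by norm_num)).trans ?_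
    gcongr
    · exact eLpNorm_le_normH_two (hv.sub hz).1 hj
    · exact eLpNorm_le_normH_two (hz.sub hw).1 hj
  refine (Finset.sum_le_sum this).trans ?_
  simp [mul_add]

theorem normH_two_sub_comm {v w : ℝ → ℝ} (hv : MemHk L 2 v) (hw : MemHk L 2 w) :
    normH L 2 (v - w) = normH L 2 (w - v) := by
  have h : normH L 2 (v - w) ^ 2 = normH L 2 (w - v) ^ 2 := by
    rw [normH_two_sq (hv.sub hw).1, normH_two_sq (hw.sub hv).1]
    refine Finset.sum_congr rfl fun j hj => ?_
    have hj : j ≤ 2 := by rw [Finset.mem_range] at hj; omega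
    rw [eLpNorm_congr_ae ((hv.sub hw).2 j hj), eLpNorm_congr_ae ((hw.sub hv).2 j hj),
      eLpNorm_sub_comm]
  exact le_antisymm ((ENNReal.pow_le_pow_left_iff (by norm_num)).1 h.le)
    ((ENNReal.pow_le_pow_left_iff (by norm_num)).1 h.ge)

theorem floor_fract_of_lt_three {s : ℝ} (h1 : 2 < s) (h2 : s < 3) :
    ⌊s⌋₊ = 2 ∧ Int.fract s = s - 2 := by
  refine ⟨(Nat.floor_eq_iff (by linarith)).2 ⟨by norm_num; linarith, by norm_num; linarith⟩, ?_⟩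
  rw [Int.fract_eq_iff]
  exact ⟨by linarith, by linarith, 2, by norm_num⟩

theorem floor_fract_of_three_le {s : ℝ} (h1 : 3 ≤ s) (h2 : s < 7 / 2) :
    ⌊s⌋₊ = 3 ∧ Int.fract s = s - 3 := by
  refine ⟨(Nat.floor_eq_iff (by linarith)).2 ⟨by norm_num; linarith, by norm_num; linarith⟩, ?_⟩
  rw [Int.fract_eq_iff]
  exact ⟨by linarith, by linarith, 3, by norm_num⟩

theorem BV3.exists_gagliardoSq_two_le (hL : 0 < L) {θ : ℝ} (h0 : 1 / 2 < θ) (h1 : θ < 1) :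
    ∃ C : ℝ≥0∞, C ≠ ⊤ ∧ ∀ m e, BV3 L m e →
      gagliardoSq L θ ((dx L)^[2] e) ≤ C * ENNReal.ofReal (m ^ 2) := by
  obtain ⟨C, hC, hCb⟩ := exists_gagliardoSq_lipschitz_le h0 h1 L
  refine ⟨C * 4, by finiteness, fun m e he => ?_⟩
  obtain ⟨E, hE, hlip, -⟩ := he.exists_primitive hL
  rw [gagliardoSq_congr hE]
  refine (hCb _ E hlip).trans (le_of_eq ?_)
  rw [mul_pow, ENNReal.ofReal_mul (by norm_num), ← mul_assoc]
  norm_num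

theorem BV3.exists_gagliardoSq_three_le {θ : ℝ} (h0 : 0 < θ) (h1 : θ < 1 / 2) :
    ∃ C : ℝ≥0∞, C ≠ ⊤ ∧ ∀ m e, BV3 L m e →
      gagliardoSq L θ ((dx L)^[3] e) ≤ C * ENNReal.ofReal (m ^ 2) := by
  obtain ⟨C, hC, hCb⟩ := exists_gagliardoSq_bv_le h0 h1 L
  refine ⟨C, hC, fun m e he => ?_⟩
  obtain ⟨h3, κ₁, κ₂, c, _, _, hc, k1, k2, hf⟩ := he
  rw [gagliardoSq_congr hf]
  exact hCb m c κ₁ κ₂ k1 k2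

theorem exists_normH_sq_le (hL : 0 < L) {s : ℝ} (h1 : 2 < s) (h2 : s < 7 / 2) :
    ∃ C : ℝ≥0∞, C ≠ ⊤ ∧ ∀ m e, BV3 L m e →
      normH L s e ^ 2 ≤ C * (normH L 2 e ^ 2 + ENNReal.ofReal (m ^ 2)) := by
  rcases lt_or_ge s 3 with h3 | h3
  · obtain ⟨f1, f2⟩ := floor_fract_of_lt_three h1 h3
    -- The midpoint of s - 2 and 1 exceeds both s - 2 and 1/2, the latter as the Lipschitz estimate
    -- requires. Order s - 2 then follows by interpolation with δ = 1.
    obtain ⟨C, hC, hCb⟩ := BV3.exists_gagliardoSq_two_le hL (θ := (s - 1) / 2) (by linarith)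
      (by linarith)
    refine ⟨1 + C + ENNReal.ofReal (1 ^ (-(1 + 2 * (s - 2))) * (8 * L)), by finiteness,
      fun m e he => ?_⟩
    have hM : MemHk L 2 e := he.1.mono (by norm_num)
    rw [normH_sq (by rw [f1]; exact hM), f1, f2, ← normH_two_sq hM]
    have g := gagliardoSq_interpolation hL (θ := s - 2) (θ' := (s - 1) / 2) (δ := 1) (by linarith)
      (by linarith) one_pos (hM.1 2 le_rfl).1
    rw [Real.one_rpow, ENNReal.ofReal_one, one_mul] at g
    have g2 : eLpNorm ((dx L)^[2] e) 2 (volume.restrict (dom L)) ^ 2 ≤ normH L 2 e ^ 2 := by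
      gcongr; exact eLpNorm_le_normH_two hM le_rfl
    set K := ENNReal.ofReal (1 ^ (-(1 + 2 * (s - 2))) * (8 * L))
    calc _ ≤ normH L 2 e ^ 2 + (C * ENNReal.ofReal (m ^ 2) + K * normH L 2 e ^ 2) := by
          gcongr; exact g.trans (by gcongr; exact hCb m e he)
      _ ≤ normH L 2 e ^ 2 + (C * ENNReal.ofReal (m ^ 2) + K * normH L 2 e ^ 2)
          + (ENNReal.ofReal (m ^ 2) + C * normH L 2 e ^ 2 + K * ENNReal.ofReal (m ^ 2)) :=
          le_self_add
      _ = _ := by ring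
  · obtain ⟨f1, f2⟩ := floor_fract_of_three_le h3 h2
    obtain ⟨C, hC, hCb⟩ : ∃ C : ℝ≥0∞, C ≠ ⊤ ∧ ∀ m e, BV3 L m e →
        gagliardoSq L (s - 3) ((dx L)^[3] e) ≤ C * ENNReal.ofReal (m ^ 2) := by
      -- For s = 3 the seminorm is absent by definition, and the estimate for functions of bounded
      -- variation needs a positive order.
      rcases h3.eq_or_lt with h | h
      · refine ⟨0, by simp, fun m e _ => ?_⟩
        rw [← h, sub_self, gagliardoSq_zero]; exact zero_le
      · exact BV3.exists_gagliardoSq_three_le (by linarith) (by linarith)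
    refine ⟨1 + C + ENNReal.ofReal (8 * L), by finiteness, fun m e he => ?_⟩
    have hM : MemHk L 2 e := he.1.mono (by norm_num)
    rw [normH_sq (by rw [f1]; exact he.1), f1, f2, Finset.sum_range_succ, ← normH_two_sq hM]
    have g := hCb m e he
    have g2 := he.eLpNorm_le hL
    set K := ENNReal.ofReal (8 * L)
    calc _ ≤ normH L 2 e ^ 2 + K * ENNReal.ofReal (m ^ 2) + C * ENNReal.ofReal (m ^ 2) := by
          gcongr
      _ ≤ normH L 2 e ^ 2 + K * ENNReal.ofReal (m ^ 2) + C * ENNReal.ofReal (m ^ 2)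
          + (ENNReal.ofReal (m ^ 2) + C * normH L 2 e ^ 2 + K * normH L 2 e ^ 2) :=
          le_self_add
      _ = _ := by ring

theorem tendsto_zero_of_sq {a : ℕ → ℝ≥0∞} (h : Tendsto (fun n => a n ^ 2) atTop (𝓝 0)) :
    Tendsto a atTop (𝓝 0) := by
  have := (ENNReal.continuous_rpow_const (y := 1 / 2)).tendsto 0 |>.comp h
  rw [ENNReal.zero_rpow_of_pos (by norm_num)] at this
  refine this.congr fun n => ?_
  simp only [Function.comp]
  rw [← ENNReal.rpow_ofNat, ← ENNReal.rpow_mul]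
  norm_num

theorem tendsto_sq_zero {a : ℕ → ℝ≥0∞} (h : Tendsto a atTop (𝓝 0)) :
    Tendsto (fun n => a n ^ 2) atTop (𝓝 0) := by
  have := ENNReal.Tendsto.pow (n := 2) h
  simpa using this

/-- A fixed bound on the variation of ∂ₓ³ bounds seminorms of order strictly above s, so
interpolation with the vanishing L₂-norms of ∂ₓ² or ∂ₓ³ applies. The auxiliary order is halfway
between the fractional part of s and 1, respectively 1/2. -/
theorem tendsto_normH (hL : 0 < L) {s : ℝ} (h1 : 2 < s) (h2 : s < 7 / 2) {m : ℝ}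
    {e : ℕ → ℝ → ℝ} (he : ∀ n, BV3 L m (e n))
    (hlim : Tendsto (fun n => normH L 2 (e n)) atTop (𝓝 0)) :
    Tendsto (fun n => normH L s (e n)) atTop (𝓝 0) := by
  apply tendsto_zero_of_sq
  have hM : ∀ n, MemHk L 2 (e n) := fun n => (he n).1.mono (by norm_num)
  have t2 : Tendsto (fun n => eLpNorm ((dx L)^[2] (e n)) 2 (volume.restrict (dom L)))
      atTop (𝓝 0) :=
    tendsto_of_tendsto_of_tendsto_of_le_of_le tendsto_const_nhds hlim (fun _ => zero_le)
      (fun n => eLpNorm_le_normH_two (hM n) le_rfl)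
  have t3 := tendsto_eLpNorm_dx_three hL he t2
  have tN := tendsto_sq_zero hlim
  rcases lt_or_ge s 3 with h3 | h3
  · obtain ⟨f1, f2⟩ := floor_fract_of_lt_three h1 h3
    obtain ⟨C, hC, hCb⟩ := BV3.exists_gagliardoSq_two_le hL (θ := (s - 1) / 2) (by linarith)
      (by linarith)
    have tg := tendsto_gagliardoSq hL (θ := s - 2) (θ' := (s - 1) / 2) (by linarith)
      (by linarith) (B := C * ENNReal.ofReal (m ^ 2)) (by finiteness)
      (fun n => ((hM n).1 2 le_rfl).1) (fun n => hCb m _ (he n)) (tendsto_sq_zero t2)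
    have := tN.add tg
    rw [add_zero] at this
    refine this.congr fun n => ?_
    rw [normH_sq (s := s) (by rw [f1]; exact hM n), f1, f2, ← normH_two_sq (hM n)]
  · obtain ⟨f1, f2⟩ := floor_fract_of_three_le h3 h2
    have tg : Tendsto (fun n => gagliardoSq L (s - 3) ((dx L)^[3] (e n))) atTop (𝓝 0) := by
      rcases h3.eq_or_lt with h | h
      · simp only [← h, sub_self, gagliardoSq_zero]; exact tendsto_const_nhds
      · obtain ⟨C, hC, hCb⟩ := BV3.exists_gagliardoSq_three_le (L := L)
          (θ := (s - 3 + 1 / 2) / 2) (by linarith) (by linarith)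
        exact tendsto_gagliardoSq hL (θ := s - 3) (θ' := (s - 3 + 1 / 2) / 2) (by linarith)
          (by linarith) (B := C * ENNReal.ofReal (m ^ 2)) (by finiteness)
          (fun n => ((he n).1.1 3 le_rfl).1) (fun n => hCb m _ (he n)) t3
    have := (tN.add t3).add tg
    rw [add_zero, add_zero] at this
    refine this.congr fun n => ?_
    rw [normH_sq (s := s) (by rw [f1]; exact (he n).1), f1, f2, Finset.sum_range_succ,
      ← normH_two_sq (hM n)]

theorem bv3_zero {m : ℝ} (hm : 0 ≤ m) : BV3 L m 0 := by
  have h0 : IsTestFun (dom L) (0 : ℝ → ℝ) := by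
    refine ⟨contDiff_const, HasCompactSupport.zero, ?_⟩
    rw [tsupport_eq_empty_iff.2 rfl]; exact empty_subset _
  refine ⟨h0.memHk 3, 0, 0, 0, inferInstance, inferInstance, by simpa, by simpa, by simpa, ?_⟩
  refine (h0.dx_iterate 3).trans (ae_of_all _ fun x => ?_)
  have : ∀ j, deriv^[j] (0 : ℝ → ℝ) = 0 := by
    intro j
    induction j with
    | zero => rfl
    | succ j ih => rw [Function.iterate_succ_apply', ih]; exact deriv_const' (0 : ℝ)
  rw [this]; simp

/-- An almost minimiser of the H²-distance from a suffices, so no compactness is needed; the slack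
1/(n+1) disappears in the limit. If the infimum is infinite, the inequality is trivial. -/
theorem exists_almost_nearest (m n : ℕ) (a : ℝ → ℝ) : ∃ b, BV3 L m b ∧
    ∀ v, BV3 L m v → normH L 2 (b - a) ≤ normH L 2 (v - a) + (n + 1 : ℝ≥0∞)⁻¹ := by
  by_cases h : (⨅ b : {b // BV3 L m b}, normH L 2 (b.1 - a)) = ⊤
  · refine ⟨0, bv3_zero (by positivity), fun v hv => ?_⟩
    rw [iInf_eq_top] at h
    have := h ⟨v, hv⟩
    simp only at this
    rw [this]; simp
  · have hlt : (⨅ b : {b // BV3 L m b}, normH L 2 (b.1 - a))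
        < (⨅ b : {b // BV3 L m b}, normH L 2 (b.1 - a)) + (n + 1 : ℝ≥0∞)⁻¹ :=
      ENNReal.lt_add_right h (ENNReal.inv_ne_zero.2 (by finiteness))
    obtain ⟨b, hb⟩ := iInf_lt_iff.1 hlt
    refine ⟨b.1, b.2, fun v hv => hb.le.trans ?_⟩
    gcongr
    exact iInf_le (fun b : {b // BV3 L m b} => normH L 2 (b.1 - a)) ⟨v, hv⟩

theorem MemH2D.of_normH2D_lt_top {v : ℝ → ℝ} (h : normH2D L v < ⊤) : MemH2D L v := by
  by_contra hv
  rw [normH2D, if_neg hv] at h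
  exact lt_irrefl _ h

theorem normH_two_le_normH2D (v : ℝ → ℝ) : normH L 2 v ≤ normH2D L v := by
  unfold normH2D
  split_ifs
  · exact le_rfl
  · exact le_top

/-- Strong measurability with values in `H²_D(D)` improves to `H^s(D)`, `s < 7/2`, if the third
derivatives are functions of bounded variation. -/
theorem stronglyMeas_normH (hL : 0 < L) {s : ℝ} (h1 : 2 < s) (h2 : s < 7 / 2) {u : ℝ → ℝ → ℝ}
    {M : ℝ → ℝ} (hu : StronglyMeas (normH2D L) u)
    (hM : AEMeasurable M (volume.restrict (Ioi 0)))
    (hb : ∀ᵐ t ∂volume.restrict (Ioi (0 : ℝ)), BV3 L (M t) (u t)) :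
    StronglyMeas (normH L s) u := by
  obtain ⟨w, hw1, hw2⟩ := hu
  choose q hq1 hq2 using fun m n a => exists_almost_nearest (L := L) m n a
  have hkm : ∀ n : ℕ, Measurable fun t => min ⌈hM.mk M t⌉₊ n := fun n =>
    (Nat.measurable_ceil.comp hM.measurable_mk).min measurable_const
  -- Truncation at n leaves finitely many values, so that k n is simple; for fixed t the truncation
  -- is inactive for all large n.
  let k : ℕ → SimpleFunc ℝ ℕ := fun n =>
    ⟨fun t => min ⌈hM.mk M t⌉₊ n, fun x => hkm n (measurableSet_singleton x),
      (finite_Iic n).subset (by rintro _ ⟨t, rfl⟩; exact min_le_right (⌈hM.mk M t⌉₊) n)⟩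
  -- The selection q need not be measurable: any map composed with a simple function is simple.
  let W : ℕ → SimpleFunc ℝ (ℝ → ℝ) := fun n => ((w n).pair (k n)).map fun p => q p.2 n p.1
  have hW : ∀ n t, W n t = q (min ⌈hM.mk M t⌉₊ n) n (w n t) := fun n t => rfl
  refine ⟨W, fun n t => ?_, ?_⟩
  · rw [hW]
    obtain ⟨C, hC, hCb⟩ := exists_normH_sq_le hL h1 h2
    have hbv := hq1 (min ⌈hM.mk M t⌉₊ n) n (w n t)
    have := hCb _ _ hbv
    have hfin := normH_two_lt_top (hbv.1.mono (l := 2) (by norm_num))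
    by_contra hcon
    rw [not_lt, top_le_iff] at hcon
    rw [hcon] at this
    have h3 : C * (normH L 2 (q (min ⌈hM.mk M t⌉₊ n) n (w n t)) ^ 2
      + ENNReal.ofReal (((min ⌈hM.mk M t⌉₊ n : ℕ) : ℝ) ^ 2)) < ⊤ := by finiteness
    exact absurd (lt_of_le_of_lt this h3) (by simp)
  · filter_upwards [hw2, hb, hM.ae_eq_mk] with t ht hbt hMt
    set N := ⌈hM.mk M t⌉₊ with hN
    have huN : BV3 L N (u t) := hbt.mono (by rw [hMt]; exact Nat.le_ceil _)
    have huM : MemHk L 2 (u t) := huN.1.mono (by norm_num)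
    have hwM : ∀ n, MemHk L 2 (w n t) := fun n => (MemH2D.of_normH2D_lt_top (hw1 n t)).1
    have ht' : Tendsto (fun n => normH L 2 (w n t - u t)) atTop (𝓝 0) :=
      tendsto_of_tendsto_of_tendsto_of_le_of_le tendsto_const_nhds ht (fun _ => zero_le)
        (fun n => normH_two_le_normH2D _)
    have key : Tendsto (fun n => normH L s (q N n (w n t) - u t)) atTop (𝓝 0) := by
      refine tendsto_normH hL h1 h2 (m := 2 * N) (fun n => (hq1 N n (w n t)).sub huN) ?_
      -- u t itself competes in the choice of q, so q lies almost as close to w n t as u t does.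
      have hbd : ∀ n : ℕ, normH L 2 (q N n (w n t) - u t)
          ≤ 3 * (normH L 2 (w n t - u t) + ((n : ℝ≥0∞) + 1)⁻¹ + normH L 2 (w n t - u t)) := by
        intro n
        refine (normH_two_sub_le ((hq1 N n (w n t)).1.mono (by norm_num)) huM (hwM n)).trans ?_
        gcongr
        rw [normH_two_sub_comm (hwM n) huM]
        exact hq2 N n (w n t) (u t) huN
      have hinv : Tendsto (fun n : ℕ => ((n : ℝ≥0∞) + 1)⁻¹) atTop (𝓝 0) := by
        have := (tendsto_add_atTop_iff_nat 1).2 ENNReal.tendsto_inv_nat_nhds_zero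
        simpa using this
      have hl := ENNReal.Tendsto.const_mul (a := 3) ((ht'.add hinv).add ht') (Or.inr (by simp))
      simp only [add_zero, mul_zero] at hl
      exact tendsto_of_tendsto_of_tendsto_of_le_of_le tendsto_const_nhds hl (fun _ => zero_le) hbd
    refine key.congr' ?_
    filter_upwards [eventually_ge_atTop N] with n hn
    rw [hW, ← hN, min_eq_left hn]

end StrongMeasurability

/-! ### The space L₂ of a general measure. -/

section SquareIntegrable

variable {α : Type*} [MeasurableSpace α] {μ : Measure α}

/-- The Cauchy-Schwarz inequality on a finite measure space, without integrability assumptions. -/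
theorem ofReal_sq_integral_le (μ : Measure α) (f : α → ℝ) :
    ENNReal.ofReal ((∫ x, f x ∂μ) ^ 2) ≤ μ univ * ∫⁻ x, ENNReal.ofReal (f x ^ 2) ∂μ := by
  by_cases hf : AEStronglyMeasurable f μ
  · have h1 := eLpNorm_le_eLpNorm_mul_rpow_measure_univ (p := 1) (q := 2) (μ := μ) (by norm_num) hf
    have e3 : (1 / ENNReal.toReal 1 - 1 / ENNReal.toReal 2 : ℝ) = 1 / 2 := by norm_num
    rw [e3] at h1
    have h2 : ENNReal.ofReal ((∫ x, f x ∂μ) ^ 2) = ‖∫ x, f x ∂μ‖ₑ ^ 2 := by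
      rw [Real.enorm_eq_ofReal_abs, ← ENNReal.ofReal_pow (abs_nonneg _), sq_abs]
    have h3 : ‖∫ x, f x ∂μ‖ₑ ≤ eLpNorm f 1 μ := by
      rw [eLpNorm_one_eq_lintegral_enorm]
      exact enorm_integral_le_lintegral_enorm f
    rw [h2, ← eLpNorm_two_sq]
    calc _ ≤ (eLpNorm f 2 μ * μ univ ^ (1 / 2 : ℝ)) ^ 2 := by gcongr; exact h3.trans h1
      _ = _ := by
        rw [mul_pow, ← ENNReal.rpow_natCast (μ univ ^ (1 / 2 : ℝ)), ← ENNReal.rpow_mul]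
        norm_num [mul_comm]
  -- Without measurability the integral is 0 by convention.
  · rw [integral_non_aestronglyMeasurable hf]; simp

/-- The norm of `L₂(μ)` as a real number. -/
noncomputable def nrm2 (μ : Measure α) (f : α → ℝ) : ℝ := (eLpNorm f 2 μ).toReal

theorem nrm2_nonneg (μ : Measure α) (f : α → ℝ) : 0 ≤ nrm2 μ f := ENNReal.toReal_nonneg

theorem nrm2_sq {f : α → ℝ} (hf : MemLp f 2 μ) : nrm2 μ f ^ 2 = ∫ x, f x ^ 2 ∂μ := by
  rw [nrm2, ← ENNReal.toReal_pow, eLpNorm_two_sq,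
    integral_eq_lintegral_of_nonneg_ae (ae_of_all _ fun x => sq_nonneg _) (hf.1.pow 2)]

theorem integrable_mul_of_memLp {f g : α → ℝ} (hf : MemLp f 2 μ) (hg : MemLp g 2 μ) :
    Integrable (fun x => f x * g x) μ := hf.integrable_mul hg

theorem abs_integral_mul_le {f g : α → ℝ} (hf : MemLp f 2 μ) (hg : MemLp g 2 μ) :
    |∫ x, f x * g x ∂μ| ≤ nrm2 μ f * nrm2 μ g := by
  have h := eLpNorm_smul_le_mul_eLpNorm (p := 2) (q := 2) (r := 1) hg.1 hf.1
  have h2 : ‖∫ x, f x * g x ∂μ‖ₑ ≤ eLpNorm f 2 μ * eLpNorm g 2 μ := by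
    refine (enorm_integral_le_lintegral_enorm _).trans ?_
    rw [← eLpNorm_one_eq_lintegral_enorm]
    exact h
  have h3 := ENNReal.toReal_mono (ENNReal.mul_ne_top hf.2.ne hg.2.ne) h2
  rwa [ENNReal.toReal_mul, toReal_enorm] at h3

theorem tendsto_integral_mul_of_eLpNorm {f g : α → ℝ} {G : ℕ → α → ℝ} (hf : MemLp f 2 μ)
    (hg : MemLp g 2 μ) (hG : ∀ n, MemLp (G n) 2 μ)
    (h : Tendsto (fun n => eLpNorm (fun x => g x - G n x) 2 μ) atTop (𝓝 0)) :
    Tendsto (fun n => ∫ x, f x * G n x ∂μ) atTop (𝓝 (∫ x, f x * g x ∂μ)) := by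
  rw [tendsto_iff_norm_sub_tendsto_zero]
  have h' : Tendsto (fun n => nrm2 μ f * nrm2 μ (fun x => g x - G n x)) atTop (𝓝 0) := by
    have := ((ENNReal.tendsto_toReal ENNReal.zero_ne_top).comp h).const_mul (nrm2 μ f)
    rw [ENNReal.toReal_zero, mul_zero] at this
    exact this
  refine squeeze_zero (fun _ => norm_nonneg _) (fun n => ?_) h'
  have e : ∫ x, f x * G n x ∂μ - ∫ x, f x * g x ∂μ = -∫ x, f x * (g x - G n x) ∂μ := by
    rw [← integral_sub (integrable_mul_of_memLp hf (hG n)) (integrable_mul_of_memLp hf hg),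
      ← integral_neg]
    congr 1; ext x; ring
  rw [e, norm_neg]
  exact abs_integral_mul_le hf (hg.sub (hG n))

theorem nrm2_le_of_tendsto {g : α → ℝ} {G : ℕ → α → ℝ} (hg : MemLp g 2 μ)
    (hG : ∀ n, MemLp (G n) 2 μ)
    (h : Tendsto (fun n => eLpNorm (fun x => g x - G n x) 2 μ) atTop (𝓝 0)) :
    Tendsto (fun n => nrm2 μ (G n)) atTop (𝓝 (nrm2 μ g)) := by
  rw [tendsto_iff_norm_sub_tendsto_zero]
  have h' : Tendsto (fun n => nrm2 μ (fun x => g x - G n x)) atTop (𝓝 0) := by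
    have := (ENNReal.tendsto_toReal ENNReal.zero_ne_top).comp h
    rw [ENNReal.toReal_zero] at this
    exact this
  refine squeeze_zero (fun _ => norm_nonneg _) (fun n => ?_) h'
  have hsub : MemLp (fun x => g x - G n x) 2 μ := hg.sub (hG n)
  have a1 : nrm2 μ (G n) ≤ nrm2 μ g + nrm2 μ (fun x => g x - G n x) := by
    rw [nrm2, nrm2, nrm2, ← ENNReal.toReal_add hg.2.ne hsub.2.ne]
    refine ENNReal.toReal_mono (ENNReal.add_ne_top.2 ⟨hg.2.ne, hsub.2.ne⟩) ?_
    have : G n = g - fun x => g x - G n x := by ext x; simp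
    conv_lhs => rw [this]
    exact eLpNorm_sub_le hg.1 hsub.1 (by norm_num)
  have a2 : nrm2 μ g ≤ nrm2 μ (G n) + nrm2 μ (fun x => g x - G n x) := by
    rw [nrm2, nrm2, nrm2, ← ENNReal.toReal_add (hG n).2.ne hsub.2.ne]
    refine ENNReal.toReal_mono (ENNReal.add_ne_top.2 ⟨(hG n).2.ne, hsub.2.ne⟩) ?_
    have : g = G n + fun x => g x - G n x := by ext x; simp
    conv_lhs => rw [this]
    exact eLpNorm_add_le (hG n).1 hsub.1 (by norm_num)
  rw [Real.norm_eq_abs, abs_le]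
  constructor <;> linarith

end SquareIntegrable

/-! ### Vertical translations and difference quotients. -/

section Shift

/-- The vertical translation by `ε`. -/
def shiftUp (ε : ℝ) (p : ℝ × ℝ) : ℝ × ℝ := (p.1, p.2 + ε)

theorem measurePreserving_shiftUp (ε : ℝ) :
    MeasurePreserving (shiftUp ε) (volume : Measure (ℝ × ℝ)) volume := by
  have h := measurePreserving_add_right (volume : Measure (ℝ × ℝ)) ((0 : ℝ), ε)
  have e : shiftUp ε = fun p => p + ((0 : ℝ), ε) := by ext p <;> simp [shiftUp]
  rw [e]; exact h

theorem hasFDerivAt_shiftUp (ε : ℝ) (p : ℝ × ℝ) :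
    HasFDerivAt (shiftUp ε) (ContinuousLinearMap.id ℝ (ℝ × ℝ)) p := by
  have e : shiftUp ε = fun p => p + ((0 : ℝ), ε) := by ext p <;> simp [shiftUp]
  rw [e]; exact (hasFDerivAt_id p).add_const _

theorem contDiff_shiftUp (ε : ℝ) : ContDiff ℝ ∞ (shiftUp ε) := by
  unfold shiftUp
  exact contDiff_fst.prodMk (contDiff_snd.add contDiff_const)

/-- Difference quotients are bounded by derivatives in `L₂`. -/
theorem nrm2_shiftUp_sub_le {U : Set (ℝ × ℝ)} {φ : ℝ × ℝ → ℝ} (hφ : IsTestFun U φ) {ε : ℝ}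
    (hε : 0 < ε) :
    nrm2 volume (fun p => φ (shiftUp ε p) - φ p)
      ≤ ε * nrm2 volume (fun p => fderiv ℝ φ p (0, 1)) := by
  set D : ℝ × ℝ → ℝ := fun p => fderiv ℝ φ p (0, 1) with hD
  have hDc : Continuous D := hφ.continuous_fderiv _
  have hD2 : MemLp D 2 volume := hDc.memLp_of_hasCompactSupport (hφ.hasCompactSupport_fderiv _)
  -- The increment is an integral along a vertical segment. The Cauchy-Schwarz inequality
  -- contributes one factor ε to its square; Tonelli's theorem and translation invariance contribute
  -- the second.
  have hid : ∀ p, φ (shiftUp ε p) - φ p = ∫ s in Ioc 0 ε, D (shiftUp s p) := by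
    intro p
    rw [← intervalIntegral.integral_of_le hε.le]
    have hd : ∀ s : ℝ, HasDerivAt (fun s => φ (shiftUp s p)) (D (shiftUp s p)) s := by
      intro s
      have h1 : HasDerivAt (fun s => shiftUp s p) ((0 : ℝ), (1 : ℝ)) s :=
        (hasDerivAt_const s p.1).prodMk ((hasDerivAt_id s).const_add p.2)
      exact (hφ.differentiable (shiftUp s p)).hasFDerivAt.comp_hasDerivAt s h1
    have hc : Continuous fun s => D (shiftUp s p) := by
      unfold shiftUp; fun_prop
    rw [intervalIntegral.integral_eq_sub_of_hasDerivAt (fun s _ => hd s)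
      (hc.intervalIntegrable _ _)]
    simp [shiftUp]
  have hpt : ∀ p, ENNReal.ofReal ((φ (shiftUp ε p) - φ p) ^ 2)
      ≤ ENNReal.ofReal ε * ∫⁻ s in Ioc 0 ε, ENNReal.ofReal (D (shiftUp s p) ^ 2) := by
    intro p
    rw [hid p]
    refine (ofReal_sq_integral_le _ _).trans ?_
    gcongr
    rw [Measure.restrict_apply_univ, Real.volume_Ioc, sub_zero]
  have hm : Measurable fun q : (ℝ × ℝ) × ℝ => ENNReal.ofReal (D (shiftUp q.2 q.1) ^ 2) := by
    have : Continuous fun q : (ℝ × ℝ) × ℝ => D (shiftUp q.2 q.1) := by unfold shiftUp; fun_prop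
    exact (this.measurable.pow_const 2).ennreal_ofReal
  have hsq : eLpNorm (fun p => φ (shiftUp ε p) - φ p) 2 volume ^ 2
      ≤ (ENNReal.ofReal ε * eLpNorm D 2 volume) ^ 2 := by
    rw [eLpNorm_two_sq, mul_pow, eLpNorm_two_sq]
    calc _ ≤ ∫⁻ p : ℝ × ℝ, ENNReal.ofReal ε
          * ∫⁻ s in Ioc 0 ε, ENNReal.ofReal (D (shiftUp s p) ^ 2) := lintegral_mono hpt
      _ = ENNReal.ofReal ε * ∫⁻ s in Ioc 0 ε, ∫⁻ p : ℝ × ℝ,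
            ENNReal.ofReal (D (shiftUp s p) ^ 2) := by
          rw [lintegral_const_mul' _ _ ENNReal.ofReal_ne_top, lintegral_lintegral_swap]
          exact hm.aemeasurable
      _ = ENNReal.ofReal ε * ∫⁻ s in Ioc 0 ε, ∫⁻ p : ℝ × ℝ, ENNReal.ofReal (D p ^ 2) := by
          congr 1
          refine lintegral_congr fun s => ?_
          exact (measurePreserving_shiftUp s).lintegral_comp
            (f := fun p => ENNReal.ofReal (D p ^ 2)) (hDc.measurable.pow_const 2).ennreal_ofReal
      _ = _ := by
          rw [setLIntegral_const, Real.volume_Ioc, sub_zero]; ring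
  have h1 := (ENNReal.pow_le_pow_left_iff (by norm_num)).1 hsq
  have h2 := ENNReal.toReal_mono (ENNReal.mul_ne_top ENNReal.ofReal_ne_top hD2.2.ne) h1
  rwa [ENNReal.toReal_mul, ENNReal.toReal_ofReal hε.le] at h2

end Shift

/-! ### Differentiation of boundary data along the graph of the deformation. -/

section Composition

/-- The map `(x, z) ↦ (x, z, v(x))`. -/
def graphMap (v : ℝ → ℝ) (p : ℝ × ℝ) : ℝ × ℝ × ℝ := (p.1, p.2, v p.1)

theorem hasFDerivAt_graphMap {v : ℝ → ℝ} {v' : ℝ} {p : ℝ × ℝ} (hv : HasDerivAt v v' p.1) :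
    HasFDerivAt (graphMap v) ((ContinuousLinearMap.fst ℝ ℝ ℝ).prod
      ((ContinuousLinearMap.snd ℝ ℝ ℝ).prod (v' • ContinuousLinearMap.fst ℝ ℝ ℝ))) p := by
  unfold graphMap
  refine hasFDerivAt_fst.prodMk (hasFDerivAt_snd.prodMk ?_)
  exact hv.comp_hasFDerivAt p hasFDerivAt_fst

/-- Weak derivatives of `(x, z) ↦ F(x, z, v(x))`. -/
theorem hasWeakDeriv_comp_graphMap {F : ℝ × ℝ × ℝ → ℝ} {Q : Set (ℝ × ℝ × ℝ)}
    (hQ : UniqueDiffOn ℝ Q) (hF : ContDiffOn ℝ 2 F Q) {U : Set (ℝ × ℝ)} (hU : IsOpen U)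
    {v v' : ℝ → ℝ} (hv : ∀ p ∈ U, HasDerivAt v (v' p.1) p.1) (hv' : Continuous v')
    (hm : ∀ p ∈ U, graphMap v p ∈ Q) :
    HasWeakDeriv U (1, 0) (fun p => F (graphMap v p))
        (fun p => fderivWithin ℝ F Q (graphMap v p) (1, 0, v' p.1)) ∧
      HasWeakDeriv U (0, 1) (fun p => F (graphMap v p))
        (fun p => fderivWithin ℝ F Q (graphMap v p) (0, 1, 0)) := by
  set f' : ℝ × ℝ → (ℝ × ℝ →L[ℝ] ℝ) := fun p => (fderivWithin ℝ F Q (graphMap v p)).comp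
    ((ContinuousLinearMap.fst ℝ ℝ ℝ).prod
      ((ContinuousLinearMap.snd ℝ ℝ ℝ).prod (v' p.1 • ContinuousLinearMap.fst ℝ ℝ ℝ))) with hf'
  -- The image of the open set U lies in Q, possibly on its boundary, as at points where v = -H. A
  -- derivative within Q is enough because the graph map takes a whole neighbourhood into Q.
  have hder : ∀ p ∈ U, HasFDerivAt (fun p => F (graphMap v p)) (f' p) p := by
    intro p hp
    have h1 := ((hF.differentiableOn (by norm_num)) _ (hm p hp)).hasFDerivWithinAt
    exact h1.comp_hasFDerivAt p (hasFDerivAt_graphMap (hv p hp))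
      (by filter_upwards [hU.mem_nhds hp] with q hq using hm q hq)
  have hgc : ContinuousOn (graphMap v) U := fun p hp =>
    (hasFDerivAt_graphMap (hv p hp)).continuousAt.continuousWithinAt
  have hDc : ContinuousOn (fun p => fderivWithin ℝ F Q (graphMap v p)) U :=
    (hF.continuousOn_fderivWithin hQ (by norm_num)).comp hgc hm
  have k1 := hasWeakDeriv_of_hasFDerivAt hU ((1, 0) : ℝ × ℝ) (f' := f') hder (by
    have : ContinuousOn (fun p => fderivWithin ℝ F Q (graphMap v p) (1, 0, v' p.1)) U :=
      hDc.clm_apply (by fun_prop)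
    simpa [hf'] using this)
  have k2 := hasWeakDeriv_of_hasFDerivAt hU ((0, 1) : ℝ × ℝ) (f' := f') hder (by
    have : ContinuousOn (fun p => fderivWithin ℝ F Q (graphMap v p) (0, 1, 0)) U :=
      hDc.clm_apply continuousOn_const
    simpa [hf'] using this)
  constructor
  · simpa [hf'] using k1
  · simpa [hf'] using k2

/-- A `C²` function has a bounded and Lipschitz continuous derivative on compact convex sets. -/
theorem exists_bound_fderivWithin {E : Type*} [NormedAddCommGroup E] [NormedSpace ℝ E]
    {F : E → ℝ} {Q K : Set E} (hQ : UniqueDiffOn ℝ Q) (hF : ContDiffOn ℝ 2 F Q) (hK : IsCompact K)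
    (hc : Convex ℝ K) (hKQ : K ⊆ Q) :
    ∃ B, 0 ≤ B ∧ (∀ q ∈ K, ‖fderivWithin ℝ F Q q‖ ≤ B) ∧ ∀ q ∈ K, ∀ q' ∈ K,
      ‖fderivWithin ℝ F Q q - fderivWithin ℝ F Q q'‖ ≤ B * ‖q - q'‖ := by
  have h1 : ContDiffOn ℝ 1 (fderivWithin ℝ F Q) Q := hF.fderivWithin hQ (by norm_num)
  obtain ⟨B₁, hB₁⟩ := hK.exists_bound_of_continuousOn (h1.continuousOn.mono hKQ)
  obtain ⟨B₂, hB₂⟩ := hK.exists_bound_of_continuousOn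
    ((h1.continuousOn_fderivWithin hQ le_rfl).mono hKQ)
  refine ⟨max (max B₁ B₂) 0, le_max_right _ _, fun q hq => (hB₁ q hq).trans (by simp),
    fun q hq q' hq' => ?_⟩
  refine hc.norm_image_sub_le_of_norm_hasFDerivWithin_le
    (f' := fun q => fderivWithin ℝ (fderivWithin ℝ F Q) Q q) (fun x hx => ?_) (fun x hx => ?_)
    hq' hq
  · exact (((h1.differentiableOn (by norm_num)) x (hKQ hx)).hasFDerivWithinAt).mono hKQ
  · exact (hB₂ x hx).trans (by simp)

end Composition

/-! ### The translation argument for the energy near the upper boundary. -/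

section Strip

theorem measurableEmbedding_shiftUp (ε : ℝ) : MeasurableEmbedding (shiftUp ε) := by
  have e : shiftUp ε = Homeomorph.addRight ((0 : ℝ), ε) := by ext p <;> simp [shiftUp]
  rw [e]; exact (Homeomorph.addRight _).measurableEmbedding

theorem continuous_shiftUp (ε : ℝ) : Continuous (shiftUp ε) := (contDiff_shiftUp ε).continuous

theorem memLp_comp_shiftUp {f : ℝ × ℝ → ℝ} (hf : MemLp f 2 volume) (ε : ℝ) :
    MemLp (fun p => f (shiftUp ε p)) 2 volume :=
  hf.comp_measurePreserving (measurePreserving_shiftUp ε)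

theorem memLp_bdd_mul {α : Type*} [MeasurableSpace α] {μ : Measure α} {f c : α → ℝ}
    (hf : MemLp f 2 μ) (hc : AEStronglyMeasurable c μ) {R : ℝ} (hR : ∀ x, |c x| ≤ R) :
    MemLp (fun x => c x * f x) 2 μ := by
  refine MemLp.of_le_mul (c := R) hf (hc.mul hf.1) (ae_of_all _ fun x => ?_)
  rw [norm_mul]
  exact mul_le_mul_of_nonneg_right (hR x) (norm_nonneg _)

theorem nrm2_bdd_mul_le {α : Type*} [MeasurableSpace α] {μ : Measure α} {f c : α → ℝ}
    (hf : MemLp f 2 μ) {R : ℝ} (hR0 : 0 ≤ R) (hR : ∀ x, |c x| ≤ R) :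
    nrm2 μ (fun x => c x * f x) ≤ R * nrm2 μ f := by
  have h := eLpNorm_le_mul_eLpNorm_of_ae_le_mul (μ := μ) (f := fun x => c x * f x) (g := f)
    (c := R) (ae_of_all _ fun x => by
      rw [norm_mul]; exact mul_le_mul_of_nonneg_right (hR x) (norm_nonneg _)) 2
  have h2 := ENNReal.toReal_mono (ENNReal.mul_ne_top ENNReal.ofReal_ne_top hf.2.ne) h
  rwa [ENNReal.toReal_mul, ENNReal.toReal_ofReal hR0] at h2

theorem integral_sub_add_sub {α : Type*} [MeasurableSpace α] {μ : Measure α}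
    {f₁ f₂ f₃ f₄ : α → ℝ} (h₁ : Integrable f₁ μ) (h₂ : Integrable f₂ μ) (h₃ : Integrable f₃ μ)
    (h₄ : Integrable f₄ μ) : ∫ x, (f₁ x - f₂ x + (f₃ x - f₄ x)) ∂μ
      = (∫ x, f₁ x ∂μ) - (∫ x, f₂ x ∂μ) + ((∫ x, f₃ x ∂μ) - ∫ x, f₄ x ∂μ) := by
  have h12 : Integrable (fun x => f₁ x - f₂ x) μ := h₁.sub h₂
  have h34 : Integrable (fun x => f₃ x - f₄ x) μ := h₃.sub h₄
  rw [integral_add h12 h34, integral_sub h₁ h₂, integral_sub h₃ h₄]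

/-- Here (a, b) and (a', b') are the gradients of the potential at a point and at its translate, and
k₁, k₂ are the increments of the gradient of the boundary data. The core is a(a' - a) ≤ (a'² -
a²)/2; the increments are absorbed by Young's inequality. -/
theorem strip_pointwise_below {a b a' b' k₁ k₂ B ε η : ℝ} (hε : 0 ≤ ε) (hη0 : 0 ≤ η) (hη1 : η ≤ 1)
    (h₁ : |k₁| ≤ B * ε) (h₂ : |k₂| ≤ B * ε) :
    η * (a * (a' - a - k₁) + b * (b' - b - k₂))
      ≤ 1 / 2 * (η * (a' ^ 2 + b' ^ 2)) - 1 / 2 * (η * (a ^ 2 + b ^ 2))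
        + ε * (B ^ 2 + (a ^ 2 + b ^ 2)) := by
  have q : ∀ x k : ℝ, |k| ≤ B * ε → -(x * k) ≤ ε * (B ^ 2 + x ^ 2) / 2 := by
    intro x k hk
    have h1 : -(x * k) ≤ |x| * (B * ε) := by
      rw [← neg_mul]
      refine (le_abs_self _).trans ?_
      rw [abs_mul, abs_neg]; gcongr
    have h2 : 0 ≤ ε * (|x| - B) ^ 2 := by positivity
    have h3 : ε * (|x| - B) ^ 2 = ε * (x ^ 2 + B ^ 2) - 2 * (|x| * (B * ε)) := by
      rw [sub_sq, sq_abs]; ring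
    linarith
  have q1 := q a k₁ h₁
  have q2 := q b k₂ h₂
  have ineq : a * (a' - a - k₁) + b * (b' - b - k₂)
      ≤ 1 / 2 * (a' ^ 2 + b' ^ 2) - 1 / 2 * (a ^ 2 + b ^ 2) + ε * (B ^ 2 + (a ^ 2 + b ^ 2)) := by
    have := mul_nonneg hε (sq_nonneg a)
    have := mul_nonneg hε (sq_nonneg b)
    linarith [sq_nonneg (a' - a), sq_nonneg (b' - b)]
  have m1 := mul_le_mul_of_nonneg_left ineq hη0
  have m2 : η * (ε * (B ^ 2 + (a ^ 2 + b ^ 2))) ≤ ε * (B ^ 2 + (a ^ 2 + b ^ 2)) :=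
    mul_le_of_le_one_left (by positivity) hη1
  linarith

/-- This is the case of a point whose translate has left the domain, so that zero stands in place of
the translated gradient. Of the coefficient 3/4, one half enters the global difference of energies
and the remaining quarter is the gain. -/
theorem strip_pointwise_in {a b k₁ k₂ B η : ℝ} (hη0 : 0 ≤ η) (hη1 : η ≤ 1)
    (h₁ : |k₁| ≤ B) (h₂ : |k₂| ≤ B) :
    η * (a * (0 - (a - k₁)) + b * (0 - (b - k₂)))
      ≤ -(3 / 4) * (η * (a ^ 2 + b ^ 2)) + 2 * B ^ 2 := by
  have k1 : k₁ ^ 2 ≤ B ^ 2 := by rw [← sq_abs]; exact pow_le_pow_left₀ (abs_nonneg _) h₁ 2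
  have k2 : k₂ ^ 2 ≤ B ^ 2 := by rw [← sq_abs]; exact pow_le_pow_left₀ (abs_nonneg _) h₂ 2
  have ineq : a * (0 - (a - k₁)) + b * (0 - (b - k₂)) ≤ -(3 / 4) * (a ^ 2 + b ^ 2) + 2 * B ^ 2 := by
    linarith [sq_nonneg (a / 2 - k₁), sq_nonneg (b / 2 - k₂)]
  have m1 := mul_le_mul_of_nonneg_left ineq hη0
  have m2 : η * (2 * B ^ 2) ≤ 2 * B ^ 2 := mul_le_of_le_one_left (by positivity) hη1
  linarith

/-- Testing the variational equation with vertical difference quotients. -/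
theorem abs_integral_shiftUp_le {U : Set (ℝ × ℝ)} {a b g₁ g₂ : ℝ × ℝ → ℝ}
    (ha : MemLp a 2 volume) (hb : MemLp b 2 volume) (hg₁ : MemLp g₁ 2 volume)
    (hg₂ : MemLp g₂ 2 volume) {φ : ℕ → ℝ × ℝ → ℝ} (hφ : ∀ n, IsTestFun U (φ n))
    (h₁ : Tendsto (fun n => eLpNorm (fun p => g₁ p - fderiv ℝ (φ n) p (1, 0)) 2 volume) atTop (𝓝 0))
    (h₂ : Tendsto (fun n => eLpNorm (fun p => g₂ p - fderiv ℝ (φ n) p (0, 1)) 2 volume) atTop (𝓝 0))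
    {η : ℝ → ℝ} (hη : ContDiff ℝ ∞ η) (hη1 : ∀ z, |η z| ≤ 1) {R z₀ : ℝ} (hR0 : 0 ≤ R)
    (hR : ∀ z, |deriv η z| ≤ R) (hη0 : ∀ z ≤ z₀, η z = 0) {ε : ℝ} (hε : 0 < ε)
    (hgeo : ∀ p : ℝ × ℝ, z₀ ≤ p.2 → shiftUp ε p ∈ U → p ∈ U)
    (hw : ∀ T, IsTestFun U T → (∀ p : ℝ × ℝ, p.2 ≤ z₀ → T p = 0) →
      ∫ p, (a p * fderiv ℝ T p (1, 0) + b p * fderiv ℝ T p (0, 1)) = 0) :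
    |∫ p, η p.2 * (a p * (g₁ (shiftUp ε p) - g₁ p) + b p * (g₂ (shiftUp ε p) - g₂ p))|
      ≤ ε * (R * nrm2 volume b * nrm2 volume g₂) := by
  set ηa : ℝ × ℝ → ℝ := fun p => η p.2 * a p with hηa
  set ηb : ℝ × ℝ → ℝ := fun p => η p.2 * b p with hηb
  have cη : Continuous fun p : ℝ × ℝ => η p.2 := hη.continuous.comp continuous_snd
  have cη' : Continuous fun p : ℝ × ℝ => deriv η p.2 :=
    (hη.continuous_deriv (by simp)).comp continuous_snd
  have mηa : MemLp ηa 2 volume := memLp_bdd_mul ha cη.aestronglyMeasurable fun p => hη1 p.2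
  have mηb : MemLp ηb 2 volume := memLp_bdd_mul hb cη.aestronglyMeasurable fun p => hη1 p.2
  have mD : ∀ n e, MemLp (fun p => fderiv ℝ (φ n) p e) 2 volume := fun n e =>
    ((hφ n).continuous_fderiv e).memLp_of_hasCompactSupport ((hφ n).hasCompactSupport_fderiv e)
  have mφ : ∀ n, MemLp (φ n) 2 volume := fun n =>
    (hφ n).continuous.memLp_of_hasCompactSupport (hφ n).2.1
  have shiftlim : ∀ {g : ℝ × ℝ → ℝ} {e : ℝ × ℝ}, MemLp g 2 volume →
      Tendsto (fun n => eLpNorm (fun p => g p - fderiv ℝ (φ n) p e) 2 volume) atTop (𝓝 0) →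
      Tendsto (fun n => eLpNorm (fun p => g (shiftUp ε p) - fderiv ℝ (φ n) (shiftUp ε p) e) 2
        volume) atTop (𝓝 0) := by
    intro g e hg h
    refine h.congr fun n => ?_
    exact (eLpNorm_comp_measurePreserving (hg.sub (mD n e)).1 (measurePreserving_shiftUp ε)).symm
  -- The equation tested with T leaves only the term in which the derivative falls on η; it is of
  -- order ε by the bound on difference quotients.
  have main : ∀ n, (∫ p, ηa p * fderiv ℝ (φ n) (shiftUp ε p) (1, 0))
      - (∫ p, ηa p * fderiv ℝ (φ n) p (1, 0))
      + ((∫ p, ηb p * fderiv ℝ (φ n) (shiftUp ε p) (0, 1))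
      - (∫ p, ηb p * fderiv ℝ (φ n) p (0, 1)))
      = -∫ p, (deriv η p.2 * b p) * (φ n (shiftUp ε p) - φ n p) := by
    intro n
    set Φ := φ n
    have hΦ := hφ n
    -- T is supported in U: the cutoff restricts it to heights at least z₀, where a point belongs to
    -- U as soon as its upward translate does.
    set T : ℝ × ℝ → ℝ := fun p => η p.2 * (Φ (shiftUp ε p) - Φ p) with hT
    have sub1 : tsupport (fun p : ℝ × ℝ => η p.2) ⊆ {p | z₀ ≤ p.2} := by
      refine closure_minimal (fun p hp => ?_) (isClosed_le continuous_const continuous_snd)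
      by_contra hcon
      exact hp (hη0 _ (not_le.1 hcon).le)
    have sub2 : tsupport (fun p => Φ (shiftUp ε p)) ⊆ shiftUp ε ⁻¹' tsupport Φ := by
      refine closure_minimal (fun p hp => ?_) ((isClosed_tsupport Φ).preimage (continuous_shiftUp ε))
      exact subset_tsupport _ hp
    have cs2 : HasCompactSupport (fun p => Φ (shiftUp ε p)) := by
      have e : shiftUp ε = Homeomorph.addRight ((0 : ℝ), ε) := by ext p <;> simp [shiftUp]
      rw [e]
      exact hΦ.2.1.comp_homeomorph _
    have hTt : IsTestFun U T := by
      refine ⟨(hη.comp contDiff_snd).mul ((hΦ.1.comp (contDiff_shiftUp ε)).sub hΦ.1),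
        (cs2.sub hΦ.2.1).mul_left, fun p hp => ?_⟩
      have p1 : z₀ ≤ p.2 := sub1 (tsupport_mul_subset_left hp)
      have p2 := tsupport_sub _ _ (tsupport_mul_subset_right hp)
      rcases p2 with p2 | p2
      · exact hgeo p p1 (hΦ.2.2 (sub2 p2))
      · exact hΦ.2.2 p2
    have hD : ∀ p e, fderiv ℝ T p e = η p.2 * (fderiv ℝ Φ (shiftUp ε p) e - fderiv ℝ Φ p e)
        + deriv η p.2 * e.2 * (Φ (shiftUp ε p) - Φ p) := by
      intro p e
      have d1 : HasFDerivAt (fun p : ℝ × ℝ => η p.2)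
          (deriv η p.2 • ContinuousLinearMap.snd ℝ ℝ ℝ) p :=
        ((hη.differentiable (by simp)) p.2).hasDerivAt.comp_hasFDerivAt p hasFDerivAt_snd
      have d2 : HasFDerivAt (fun p => Φ (shiftUp ε p)) _ p :=
        (hΦ.differentiable (shiftUp ε p)).hasFDerivAt.comp p (hasFDerivAt_shiftUp ε p)
      have d3 := d1.mul (d2.sub (hΦ.differentiable p).hasFDerivAt)
      have : fderiv ℝ T p = _ := d3.fderiv
      rw [this]
      simp
      ring
    have h0 := hw T hTt (fun p hp => by simp [hT, hη0 _ hp])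
    have mS : ∀ e, MemLp (fun p => fderiv ℝ Φ (shiftUp ε p) e) 2 volume := fun e =>
      memLp_comp_shiftUp (mD n e) ε
    have mdiff : MemLp (fun p => Φ (shiftUp ε p) - Φ p) 2 volume :=
      (memLp_comp_shiftUp (mφ n) ε).sub (mφ n)
    have mη'b : MemLp (fun p => deriv η p.2 * b p) 2 volume :=
      memLp_bdd_mul hb cη'.aestronglyMeasurable fun p => hR p.2
    have i1 := integrable_mul_of_memLp mηa (mS (1, 0))
    have i2 := integrable_mul_of_memLp mηa (mD n (1, 0))
    have i3 := integrable_mul_of_memLp mηb (mS (0, 1))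
    have i4 := integrable_mul_of_memLp mηb (mD n (0, 1))
    have i14 : Integrable fun p => ηa p * fderiv ℝ Φ (shiftUp ε p) (1, 0)
        - ηa p * fderiv ℝ Φ p (1, 0) + (ηb p * fderiv ℝ Φ (shiftUp ε p) (0, 1)
        - ηb p * fderiv ℝ Φ p (0, 1)) := (i1.sub i2).add (i3.sub i4)
    rw [← integral_sub_add_sub i1 i2 i3 i4, eq_neg_iff_add_eq_zero,
      ← integral_add i14 (integrable_mul_of_memLp mη'b mdiff)]
    refine Eq.trans ?_ h0
    congr 1; ext p
    rw [hD, hD]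
    simp only [hηa, hηb]
    ring
  have lim : Tendsto (fun n => (∫ p, ηa p * fderiv ℝ (φ n) (shiftUp ε p) (1, 0))
      - (∫ p, ηa p * fderiv ℝ (φ n) p (1, 0))
      + ((∫ p, ηb p * fderiv ℝ (φ n) (shiftUp ε p) (0, 1))
      - (∫ p, ηb p * fderiv ℝ (φ n) p (0, 1)))) atTop
      (𝓝 ((∫ p, ηa p * g₁ (shiftUp ε p)) - (∫ p, ηa p * g₁ p)
        + ((∫ p, ηb p * g₂ (shiftUp ε p)) - (∫ p, ηb p * g₂ p)))) := by
    refine Tendsto.add (Tendsto.sub ?_ ?_) (Tendsto.sub ?_ ?_)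
    · exact tendsto_integral_mul_of_eLpNorm mηa (memLp_comp_shiftUp hg₁ ε)
        (fun n => memLp_comp_shiftUp (mD n _) ε) (shiftlim hg₁ h₁)
    · exact tendsto_integral_mul_of_eLpNorm mηa hg₁ (fun n => mD n _) h₁
    · exact tendsto_integral_mul_of_eLpNorm mηb (memLp_comp_shiftUp hg₂ ε)
        (fun n => memLp_comp_shiftUp (mD n _) ε) (shiftlim hg₂ h₂)
    · exact tendsto_integral_mul_of_eLpNorm mηb hg₂ (fun n => mD n _) h₂
  have e0 : ∫ p, η p.2 * (a p * (g₁ (shiftUp ε p) - g₁ p) + b p * (g₂ (shiftUp ε p) - g₂ p))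
      = (∫ p, ηa p * g₁ (shiftUp ε p)) - (∫ p, ηa p * g₁ p)
        + ((∫ p, ηb p * g₂ (shiftUp ε p)) - (∫ p, ηb p * g₂ p)) := by
    have i1 := integrable_mul_of_memLp mηa (memLp_comp_shiftUp hg₁ ε)
    have i2 := integrable_mul_of_memLp mηa hg₁
    have i3 := integrable_mul_of_memLp mηb (memLp_comp_shiftUp hg₂ ε)
    have i4 := integrable_mul_of_memLp mηb hg₂
    rw [← integral_sub_add_sub i1 i2 i3 i4]
    congr 1; ext p
    simp only [hηa, hηb]; ring
  rw [e0]
  have lim2 := (nrm2_le_of_tendsto hg₂ (fun n => mD n (0, 1)) h₂).const_mul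
    (ε * (R * nrm2 volume b))
  rw [← mul_assoc ε (R * nrm2 volume b)]
  refine le_of_tendsto_of_tendsto lim.abs lim2 (Eventually.of_forall fun n => ?_)
  simp only
  rw [main n, abs_neg]
  refine (abs_integral_mul_le (memLp_bdd_mul hb cη'.aestronglyMeasurable fun p => hR p.2)
    ((memLp_comp_shiftUp (mφ n) ε).sub (mφ n))).trans ?_
  calc _ ≤ (R * nrm2 volume b) * (ε * nrm2 volume (fun p => fderiv ℝ (φ n) p (0, 1))) := by
        gcongr
        · exact nrm2_nonneg _ _
        · exact mul_nonneg hR0 (nrm2_nonneg _ _)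
        · exact nrm2_bdd_mul_le hb hR0 fun p => hR p.2
        · exact nrm2_shiftUp_sub_le (hφ n) hε
    _ = _ := by ring

/-- The estimate of the gradient in a strip of width `ε` below the upper boundary of `S`. -/
theorem integral_strip_le {S : Set (ℝ × ℝ)} (hS : MeasurableSet S) (hSv : volume S ≠ ⊤)
    {a b g₁ g₂ K₁ K₂ : ℝ × ℝ → ℝ} (ha : MemLp a 2 volume) (hb : MemLp b 2 volume)
    (hg₁ : MemLp g₁ 2 volume) (hg₂ : MemLp g₂ 2 volume)
    {η : ℝ → ℝ} (hηc : Continuous η) (hηm : Monotone η) (hη0 : ∀ z, 0 ≤ η z) (hη1 : ∀ z, η z ≤ 1)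
    {z₀ B ε A Q : ℝ} (hη : ∀ z ≤ z₀, η z = 0) (hε : 0 < ε)
    (hout : ∀ p : ℝ × ℝ, z₀ < p.2 → p ∉ S → a p = 0 ∧ b p = 0 ∧ g₁ p = 0 ∧ g₂ p = 0)
    (hin : ∀ᵐ p, p ∈ S → a p = g₁ p + K₁ p ∧ b p = g₂ p + K₂ p)
    (hK : ∀ p ∈ S, |K₁ p| ≤ B ∧ |K₂ p| ≤ B)
    (hK' : ∀ p ∈ S, shiftUp ε p ∈ S →
      |K₁ (shiftUp ε p) - K₁ p| ≤ B * ε ∧ |K₂ (shiftUp ε p) - K₂ p| ≤ B * ε)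
    (hvol : volume.real (S \ shiftUp ε ⁻¹' S) ≤ A * ε)
    (hQ : |∫ p, η p.2 * (a p * (g₁ (shiftUp ε p) - g₁ p) + b p * (g₂ (shiftUp ε p) - g₂ p))|
      ≤ ε * Q) :
    ∫ p in S \ shiftUp ε ⁻¹' S, η p.2 * (a p ^ 2 + b p ^ 2)
      ≤ ε * (4 * (Q + 2 * B ^ 2 * A + B ^ 2 * volume.real S
        + (nrm2 volume a ^ 2 + nrm2 volume b ^ 2))) := by
  set s := S \ shiftUp ε ⁻¹' S with hs
  have ms : MeasurableSet s := hS.diff ((continuous_shiftUp ε).measurable hS)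
  set E : ℝ × ℝ → ℝ := fun p => a p ^ 2 + b p ^ 2 with hE
  have iE : Integrable E := ha.integrable_sq.add hb.integrable_sq
  have cη : Continuous fun p : ℝ × ℝ => η p.2 := hηc.comp continuous_snd
  have bη : ∀ᵐ p : ℝ × ℝ, ‖η p.2‖ ≤ 1 := ae_of_all _ fun p => by
    rw [Real.norm_of_nonneg (hη0 _)]; exact hη1 _
  have iηE : Integrable fun p => η p.2 * E p := iE.bdd_mul cη.aestronglyMeasurable bη
  have iEs : Integrable fun p => E (shiftUp ε p) :=
    (measurePreserving_shiftUp ε).integrable_comp_of_integrable iE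
  have iηEs : Integrable fun p => η p.2 * E (shiftUp ε p) :=
    iEs.bdd_mul cη.aestronglyMeasurable bη
  -- A change of variables moves the translation from E to η, and η(z - ε) ≤ η(z).
  have hmono : ∫ p, η p.2 * E (shiftUp ε p) ≤ ∫ p, η p.2 * E p := by
    have e1 : ∫ p, η p.2 * E (shiftUp ε p) = ∫ p : ℝ × ℝ, η (p.2 - ε) * E p := by
      rw [← (measurePreserving_shiftUp ε).integral_comp (measurableEmbedding_shiftUp ε)
        (fun p => η (p.2 - ε) * E p)]
      simp [shiftUp]
    rw [e1]
    refine integral_mono ?_ iηE fun p => ?_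
    · exact iE.bdd_mul (hηc.comp (continuous_snd.sub continuous_const)).aestronglyMeasurable
        (ae_of_all _ fun p => by rw [Real.norm_of_nonneg (hη0 _)]; exact hη1 _)
    · exact mul_le_mul_of_nonneg_right (hηm (by linarith)) (by positivity)
  -- A pointwise majorant of the tested integrand: half the increment of the weighted energy
  -- density, whose integral is nonpositive, the gain -1/4 on s, an error 2B² on s, whose area is at
  -- most Aε, and an error proportional to ε.
  set J : ℝ × ℝ → ℝ := fun p => 1 / 2 * (η p.2 * E (shiftUp ε p)) - 1 / 2 * (η p.2 * E p)
    - 1 / 4 * s.indicator (fun p => η p.2 * E p) p + s.indicator (fun _ => 2 * B ^ 2) p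
    + ε * (S.indicator (fun _ => B ^ 2) p + E p) with hJ
  have hsv : volume s ≠ ⊤ := ne_top_of_le_ne_top hSv (measure_mono sdiff_subset)
  have j1 := iηEs.const_mul (1 / 2)
  have j2 := iηE.const_mul (1 / 2)
  have j3 := (iηE.indicator ms).const_mul (1 / 4)
  have j4 : Integrable (s.indicator fun _ : ℝ × ℝ => 2 * B ^ 2) :=
    (integrable_indicator_iff ms).2 (integrableOn_const hsv)
  have j5 : Integrable (S.indicator fun _ : ℝ × ℝ => B ^ 2) :=
    (integrable_indicator_iff hS).2 (integrableOn_const hSv)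
  have j5' : Integrable (fun p => S.indicator (fun _ => B ^ 2) p + E p) := j5.add iE
  have j6 := j5'.const_mul ε
  have j12 : Integrable fun p => 1 / 2 * (η p.2 * E (shiftUp ε p)) - 1 / 2 * (η p.2 * E p) :=
    j1.sub j2
  have j123 : Integrable fun p => 1 / 2 * (η p.2 * E (shiftUp ε p)) - 1 / 2 * (η p.2 * E p)
      - 1 / 4 * s.indicator (fun p => η p.2 * E p) p := j12.sub j3
  have j1234 : Integrable fun p => 1 / 2 * (η p.2 * E (shiftUp ε p)) - 1 / 2 * (η p.2 * E p)
      - 1 / 4 * s.indicator (fun p => η p.2 * E p) p + s.indicator (fun _ => 2 * B ^ 2) p :=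
    j123.add j4
  have iJ : Integrable J := j1234.add j6
  have IJ : ∫ p, J p = 1 / 2 * (∫ p, η p.2 * E (shiftUp ε p)) - 1 / 2 * (∫ p, η p.2 * E p)
      - 1 / 4 * (∫ p in s, η p.2 * E p) + volume.real s * (2 * B ^ 2)
      + ε * (volume.real S * B ^ 2 + ∫ p, E p) := by
    simp only [hJ]
    rw [integral_add j1234 j6, integral_add j123 j4, integral_sub j12 j3, integral_sub j1 j2,
      integral_const_mul, integral_const_mul, integral_const_mul, integral_const_mul]
    have e5 : ∫ p, (S.indicator (fun _ => B ^ 2) p + E p)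
        = (∫ p, S.indicator (fun _ => B ^ 2) p) + ∫ p, E p := integral_add j5 iE
    rw [e5, integral_indicator ms, integral_indicator ms, integral_indicator hS,
      setIntegral_const, setIntegral_const]
    rfl
  have hB0 : ∀ p ∈ S, 0 ≤ B := fun p hp => (abs_nonneg _).trans (hK p hp).1
  have hle : ∫ p, η p.2 * (a p * (g₁ (shiftUp ε p) - g₁ p) + b p * (g₂ (shiftUp ε p) - g₂ p))
      ≤ ∫ p, J p := by
    refine integral_mono_ae ?_ iJ ?_
    · have i1 := integrable_mul_of_memLp ha ((memLp_comp_shiftUp hg₁ ε).sub hg₁)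
      have i2 := integrable_mul_of_memLp hb ((memLp_comp_shiftUp hg₂ ε).sub hg₂)
      exact (i1.add i2).bdd_mul cη.aestronglyMeasurable bη
    · have hin' := (measurePreserving_shiftUp ε).quasiMeasurePreserving.ae hin
      filter_upwards [hin, hin'] with p hp hp'
      have hEn : ∀ p, 0 ≤ E p := fun p => by positivity
      rcases le_or_gt p.2 z₀ with hz | hz
      · have : η p.2 = 0 := hη _ hz
        simp only [hJ, this, zero_mul, mul_zero, sub_zero]
        have t1 : 0 ≤ s.indicator (fun _ => 2 * B ^ 2) p := indicator_nonneg (fun _ _ => by positivity) _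
        have t2 : 0 ≤ S.indicator (fun _ => B ^ 2) p := indicator_nonneg (fun _ _ => by positivity) _
        have t3 : s.indicator (fun p : ℝ × ℝ => η p.2 * E p) p = 0 := by
          by_cases h : p ∈ s
          · rw [indicator_of_mem h, this, zero_mul]
          · rw [indicator_of_notMem h]
        rw [t3]
        have := hEn p
        have t4 : 0 ≤ ε * (S.indicator (fun _ => B ^ 2) p + E p) := by positivity
        linarith
      · by_cases hpS : p ∈ S
        · obtain ⟨ha', hb'⟩ := hp hpS
          obtain ⟨hk1, hk2⟩ := hK p hpS
          have hBp := hB0 p hpS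
          have e0 := hη0 p.2
          have e1 := hη1 p.2
          have eS : S.indicator (fun _ : ℝ × ℝ => B ^ 2) p = B ^ 2 := indicator_of_mem hpS _
          have hεE : 0 ≤ ε * (B ^ 2 + E p) := by have := hEn p; positivity
          by_cases hps : shiftUp ε p ∈ S
          · have hns : p ∉ s := fun h => h.2 hps
            obtain ⟨ha2, hb2⟩ := hp' hps
            obtain ⟨l1, l2⟩ := hK' p hpS hps
            simp only [hJ]
            rw [indicator_of_notMem hns, indicator_of_notMem hns, eS]
            have r1 : g₁ (shiftUp ε p) - g₁ p
                = a (shiftUp ε p) - a p - (K₁ (shiftUp ε p) - K₁ p) := by rw [ha2, ha']; ring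
            have r2 : g₂ (shiftUp ε p) - g₂ p
                = b (shiftUp ε p) - b p - (K₂ (shiftUp ε p) - K₂ p) := by rw [hb2, hb']; ring
            rw [r1, r2]
            have := strip_pointwise_below (a := a p) (b := b p) (a' := a (shiftUp ε p))
              (b' := b (shiftUp ε p)) hε.le e0 e1 l1 l2
            simp only [hE]
            linarith
          · have hs' : p ∈ s := ⟨hpS, hps⟩
            have hz' : z₀ < (shiftUp ε p).2 := by simp only [shiftUp]; linarith
            obtain ⟨o1, o2, o3, o4⟩ := hout _ hz' hps
            simp only [hJ]
            rw [indicator_of_mem hs', indicator_of_mem hs', eS]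
            have r3 : E (shiftUp ε p) = 0 := by simp [hE, o1, o2]
            rw [o3, o4, r3]
            have r1 : g₁ p = a p - K₁ p := by rw [ha']; ring
            have r2 : g₂ p = b p - K₂ p := by rw [hb']; ring
            rw [r1, r2]
            have := strip_pointwise_in (a := a p) (b := b p) e0 e1 hk1 hk2
            have hEp : E p = a p ^ 2 + b p ^ 2 := rfl
            rw [← hEp] at this
            linarith
        · obtain ⟨o1, o2, o3, o4⟩ := hout p hz hpS
          have hns : p ∉ s := fun h => hpS h.1
          simp only [hJ]
          rw [indicator_of_notMem hns, indicator_of_notMem hns, indicator_of_notMem hpS]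
          have r3 : E p = 0 := by simp [hE, o1, o2]
          rw [o1, o2, r3]
          have := mul_nonneg (hη0 p.2) (hEn (shiftUp ε p))
          simp only [zero_mul, add_zero, mul_zero, sub_zero]
          linarith
  have hlow := (abs_le.1 hQ).1
  have hEint : ∫ p, E p = nrm2 volume a ^ 2 + nrm2 volume b ^ 2 := by
    rw [nrm2_sq ha, nrm2_sq hb, ← integral_add ha.integrable_sq hb.integrable_sq]
  rw [IJ, hEint] at hle
  have hv2 : volume.real s * (2 * B ^ 2) ≤ A * ε * (2 * B ^ 2) := by gcongr
  linarith

end Strip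

/-! ### The domain Ω(v), its two layers and the permittivity. -/

section Geometry

theorem MemH2D.continuousOn {L : ℝ} {v : ℝ → ℝ} (hv : MemH2D L v) : ContinuousOn v (Icc (-L) L) :=
  hv.2.1.continuousOn

theorem MemH2D.abs_apply_le {L : ℝ} (hL : 0 < L) {v : ℝ → ℝ} (hv : MemH2D L v) {ρ : ℝ}
    (hρ : l2 L (dx L (dx L v)) ≤ ρ) {x : ℝ} (hx : x ∈ Icc (-L) L) :
    |v x| ≤ √(2 * L) * ρ * (L - |x|) := by
  obtain ⟨v', -, -, -, -, h⟩ := hv.structure hL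
  refine (h x hx).trans ?_
  have h1 : |x| ≤ L := abs_le.2 hx
  have h2 : (0 : ℝ) ≤ L - |x| := by linarith
  gcongr

namespace Data

variable {P : Data}

theorem isOpen_Omega1 : IsOpen P.Omega1 := isOpen_Ioo.prod isOpen_Ioo

theorem isOpen_Omega2 {v : ℝ → ℝ} (hv : ContinuousOn v (dom P.L)) : IsOpen (P.Omega2 v) := by
  have h1 : ContinuousOn (fun p : ℝ × ℝ => v p.1 - p.2) (dom P.L ×ˢ univ) :=
    (hv.comp continuousOn_fst fun p hp => hp.1).sub continuousOn_snd
  have h2 := h1.isOpen_inter_preimage (isOpen_dom.prod isOpen_univ) (isOpen_Ioi (a := (0 : ℝ)))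
  have h3 : IsOpen {p : ℝ × ℝ | -P.H < p.2} := isOpen_lt continuous_const continuous_snd
  convert h2.inter h3 using 1
  ext p
  simp only [Omega2, mem_inter_iff, mem_prod, mem_univ, and_true, mem_preimage, mem_Ioi, sub_pos]
  simp only [mem_ofPred]
  tauto

theorem volume_interface (v : ℝ → ℝ) : volume (P.interface v) = 0 := by
  refine measure_mono_null (t := univ ×ˢ {-P.H}) (fun p hp => ⟨mem_univ _, hp.2.1⟩) ?_
  rw [Measure.volume_eq_prod, Measure.prod_prod]; simp

theorem measurableSet_Omega {v : ℝ → ℝ} (hv : ContinuousOn v (dom P.L)) :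
    MeasurableSet (P.Omega v) := by
  refine (isOpen_Omega1.measurableSet.union ?_).union (isOpen_Omega2 hv).measurableSet
  have h2 := (hv.isOpen_inter_preimage isOpen_dom (isOpen_Ioi (a := -P.H))).measurableSet
  have : P.interface v = (dom P.L ∩ v ⁻¹' Ioi (-P.H)) ×ˢ {-P.H} := by
    ext p
    simp only [interface, mem_prod, mem_inter_iff, mem_preimage, mem_Ioi, mem_singleton_iff]
    simp only [mem_ofPred]
    tauto
  rw [this]
  exact h2.prod (measurableSet_singleton _)

theorem Omega2_subset (v : ℝ → ℝ) : P.Omega2 v ⊆ P.Omega v := subset_union_right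

theorem Omega1_subset (v : ℝ → ℝ) : P.Omega1 ⊆ P.Omega v := fun _ hp => Or.inl (Or.inl hp)

theorem mem_Omega2_of_mem {v : ℝ → ℝ} {p : ℝ × ℝ} (hp : p ∈ P.Omega v) (h : -P.H < p.2) :
    p ∈ P.Omega2 v := by
  rcases hp with (hp | hp) | hp
  · exact absurd hp.2.2 (not_lt.2 h.le)
  · exact absurd hp.2.1 h.ne'
  · exact hp

/-- The interface is a null set, so the two layers, on each of which the data are smooth, can be
treated separately. -/
theorem ae_Omega_of {v : ℝ → ℝ} {p : ℝ × ℝ → Prop} (h1 : ∀ᵐ q ∂volume.restrict P.Omega1, p q)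
    (h2 : ∀ᵐ q ∂volume.restrict (P.Omega2 v), p q) : ∀ᵐ q ∂volume.restrict (P.Omega v), p q := by
  rw [Omega, ae_restrict_union_iff, ae_restrict_union_iff]
  refine ⟨⟨h1, ?_⟩, h2⟩
  rw [Measure.restrict_eq_zero.2 (volume_interface v)]
  simp

theorem aestronglyMeasurable_sigma (hP : P.Admissible) {v : ℝ → ℝ} (hv : ContinuousOn v (dom P.L)) :
    AEStronglyMeasurable P.sigma (volume.restrict (P.Omega v)) := by
  rw [Omega, aestronglyMeasurable_union_iff, aestronglyMeasurable_union_iff]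
  refine ⟨⟨?_, ?_⟩, ?_⟩
  · have h := (hP.σ₁_smooth.continuousOn.mono (t := P.Omega1)
      (prod_mono Ioo_subset_Icc_self Ioo_subset_Icc_self)).aestronglyMeasurable (μ := volume)
      isOpen_Omega1.measurableSet
    refine h.congr ?_
    filter_upwards [ae_restrict_mem isOpen_Omega1.measurableSet] with p hp
    rw [sigma, if_pos hp.2.2.le]
  · rw [Measure.restrict_eq_zero.2 (volume_interface v)]
    exact aestronglyMeasurable_zero_measure _
  · refine (aestronglyMeasurable_const (b := P.σ₂)).congr ?_
    filter_upwards [ae_restrict_mem (isOpen_Omega2 hv).measurableSet] with p hp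
    rw [sigma, if_neg (not_le.2 hp.2.1)]

theorem exists_sigma_bounds (hP : P.Admissible) : ∃ s S : ℝ, 0 < s ∧ ∀ (v : ℝ → ℝ), ∀ p ∈ P.Omega v,
    p.2 ≠ -P.H → s ≤ P.sigma p ∧ P.sigma p ≤ S := by
  have hne : (Icc (-P.L) P.L ×ˢ Icc (-P.H - P.d) (-P.H)).Nonempty :=
    ⟨(0, -P.H), ⟨by linarith [hP.L_pos], hP.L_pos.le⟩, by linarith [hP.d_pos], le_rfl⟩
  have hK : IsCompact (Icc (-P.L) P.L ×ˢ Icc (-P.H - P.d) (-P.H)) := isCompact_Icc.prod isCompact_Icc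
  obtain ⟨q, hq, hq'⟩ := hK.exists_isMinOn hne hP.σ₁_smooth.continuousOn
  obtain ⟨r, hr, hr'⟩ := hK.exists_isMaxOn hne hP.σ₁_smooth.continuousOn
  refine ⟨min (P.σ₁ q.1 q.2) P.σ₂, max (P.σ₁ r.1 r.2) P.σ₂,
    lt_min (hP.σ₁_pos _ hq.1 _ hq.2) hP.σ₂_pos, fun v p hp hp2 => ?_⟩
  rcases hp with (hp | hp) | hp
  · have hp' : p ∈ Icc (-P.L) P.L ×ˢ Icc (-P.H - P.d) (-P.H) :=
      ⟨Ioo_subset_Icc_self hp.1, Ioo_subset_Icc_self hp.2⟩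
    rw [sigma, if_pos hp.2.2.le]
    exact ⟨(min_le_left _ _).trans (hq' hp'), le_max_of_le_left (hr' hp')⟩
  · exact absurd hp.2.1 hp2
  · rw [sigma, if_neg (not_le.2 hp.2.1)]
    exact ⟨min_le_right _ _, le_max_right _ _⟩

theorem ae_ne_interface (v : ℝ → ℝ) : ∀ᵐ p ∂volume.restrict (P.Omega v), p.2 ≠ -P.H := by
  refine ae_restrict_of_ae ?_
  rw [ae_iff]
  refine measure_mono_null (t := univ ×ˢ {-P.H}) (fun p hp => ⟨mem_univ _, ?_⟩) ?_
  · simpa using hp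
  · rw [Measure.volume_eq_prod, Measure.prod_prod]; simp

end Data

end Geometry

/-! ### The energy bound for the transmission problem. -/

section Energy

/-- The energy estimate for the variational solution to a Dirichlet problem. -/
theorem integral_grad_sq_le {α : Type*} [MeasurableSpace α] {μ : Measure α} [IsFiniteMeasure μ]
    {σ p q p₀ q₀ : α → ℝ} {s S B : ℝ} (hs : 0 < s)
    (hσm : AEStronglyMeasurable σ μ) (hσ : ∀ᵐ x ∂μ, s ≤ σ x ∧ σ x ≤ S)
    (hp : MemLp p 2 μ) (hq : MemLp q 2 μ) (hp₀ : MemLp p₀ 2 μ) (hq₀ : MemLp q₀ 2 μ)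
    {P Q : ℕ → α → ℝ} (hP : ∀ n, MemLp (P n) 2 μ) (hQ : ∀ n, MemLp (Q n) 2 μ)
    (hPt : Tendsto (fun n => eLpNorm (fun x => p₀ x - P n x) 2 μ) atTop (𝓝 0))
    (hQt : Tendsto (fun n => eLpNorm (fun x => q₀ x - Q n x) 2 μ) atTop (𝓝 0))
    (h0 : ∀ n, ∫ x, σ x * (p x * P n x + q x * Q n x) ∂μ = 0)
    (hpb : ∀ᵐ x ∂μ, |p x - p₀ x| ≤ B ∧ |q x - q₀ x| ≤ B) :
    ∫ x, (p x ^ 2 + q x ^ 2) ∂μ ≤ 2 * (S * B ^ 2 * μ.real univ) / s := by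
  have hσp : ∀ {f : α → ℝ}, MemLp f 2 μ → MemLp (fun x => σ x * f x) 2 μ := by
    intro f hf
    refine MemLp.of_le_mul (c := S) hf (hσm.mul hf.1) ?_
    filter_upwards [hσ] with x hx
    rw [norm_mul, Real.norm_of_nonneg (hs.le.trans hx.1)]
    exact mul_le_mul_of_nonneg_right hx.2 (norm_nonneg _)
  have t1 := tendsto_integral_mul_of_eLpNorm (hσp hp) hp₀ hP hPt
  have t2 := tendsto_integral_mul_of_eLpNorm (hσp hq) hq₀ hQ hQt
  have t3 := t1.add t2
  have e : ∀ n, (∫ x, σ x * p x * P n x ∂μ) + ∫ x, σ x * q x * Q n x ∂μ = 0 := by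
    intro n
    rw [← integral_add (integrable_mul_of_memLp (hσp hp) (hP n))
      (integrable_mul_of_memLp (hσp hq) (hQ n)), ← h0 n]
    congr 1; ext x; ring
  simp only [e] at t3
  -- By density, the difference of the solution and the boundary data is itself an admissible test
  -- function.
  have h1 : (∫ x, σ x * p x * p₀ x ∂μ) + ∫ x, σ x * q x * q₀ x ∂μ = 0 :=
    (tendsto_nhds_unique t3 tendsto_const_nhds)
  have i1 := integrable_mul_of_memLp (hσp hp) hp₀
  have i2 := integrable_mul_of_memLp (hσp hq) hq₀
  rw [← integral_add i1 i2] at h1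
  have i3 : Integrable (fun x => σ x * p x * p₀ x + σ x * q x * q₀ x) μ := i1.add i2
  have i4 : Integrable (fun x => p x ^ 2 + q x ^ 2) μ := hp.integrable_sq.add hq.integrable_sq
  have i5 : Integrable (fun x => s / 2 * (p x ^ 2 + q x ^ 2) - S * B ^ 2) μ :=
    (i4.const_mul _).sub (integrable_const _)
  -- Polarisation: 2σ∇ψ·∇(ψ - h) = σ|∇ψ|² + σ|∇(ψ - h)|² - σ|∇h|², where the middle term is dropped
  -- and |∇h|² ≤ 2B².
  have key := integral_mono_ae i5 i3 (by
    filter_upwards [hσ, hpb] with x hx hb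
    have e1 : (p x - p₀ x) ^ 2 ≤ B ^ 2 := by
      rw [← sq_abs]; exact pow_le_pow_left₀ (abs_nonneg _) hb.1 2
    have e2 : (q x - q₀ x) ^ 2 ≤ B ^ 2 := by
      rw [← sq_abs]; exact pow_le_pow_left₀ (abs_nonneg _) hb.2 2
    have hσ0 : 0 < σ x := hs.trans_le hx.1
    have e3 : σ x * B ^ 2 ≤ S * B ^ 2 := mul_le_mul_of_nonneg_right hx.2 (sq_nonneg _)
    have e4 : s * (p x ^ 2 + q x ^ 2) ≤ σ x * (p x ^ 2 + q x ^ 2) :=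
      mul_le_mul_of_nonneg_right hx.1 (by positivity)
    have e5 : σ x * ((p x - p₀ x) ^ 2 + (q x - q₀ x) ^ 2) ≤ σ x * (2 * B ^ 2) :=
      mul_le_mul_of_nonneg_left (by linarith) hσ0.le
    have e6 : 0 ≤ σ x * (p₀ x ^ 2 + q₀ x ^ 2) := by positivity
    have e7 : σ x * ((p x - p₀ x) ^ 2 + (q x - q₀ x) ^ 2)
      = σ x * (p x ^ 2 + q x ^ 2) + σ x * (p₀ x ^ 2 + q₀ x ^ 2)
        - 2 * (σ x * p x * p₀ x + σ x * q x * q₀ x) := by ring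
    show s / 2 * (p x ^ 2 + q x ^ 2) - S * B ^ 2 ≤ σ x * p x * p₀ x + σ x * q x * q₀ x
    linarith)
  rw [h1, integral_sub (i4.const_mul _) (integrable_const _), integral_const_mul,
    integral_const, smul_eq_mul] at key
  rw [le_div_iff₀ hs]
  nlinarith

end Energy

/-! ### Uniform bounds for the boundary data and the cutoff in the gap. -/

namespace Data

variable {P : Data}

theorem norm_graph_vector_le (a b c : ℝ) (ha : |a| ≤ 1) (hb : |b| ≤ 1) {V : ℝ}
    (hc : |c| ≤ V) : ‖((a, b, c) : ℝ × ℝ × ℝ)‖ ≤ 1 + V := by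
  have hV : 0 ≤ V := (abs_nonneg _).trans hc
  rw [Prod.norm_def, Prod.norm_def]
  simp only [Real.norm_eq_abs]
  exact max_le (by linarith) (max_le (by linarith) (by linarith))

/-- The gradients of the boundary data are bounded and Lipschitz continuous in the vertical
direction, locally uniformly with respect to the deformation. -/
theorem exists_boundary_data_bound (hP : P.Admissible) (ρ : ℝ) : ∃ B, 0 ≤ B ∧ ∀ v, P.MemSbar v →
    l2 P.L (dx P.L (dx P.L v)) ≤ ρ → ∀ ψ, P.IsPotential v ψ →
    (∀ᵐ p ∂volume.restrict (P.Omega v),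
      |pdx (P.Omega v) ψ p - pdx (P.Omega v) (ψ - P.hBdry v) p| ≤ B ∧
      |pdz (P.Omega v) ψ p - pdz (P.Omega v) (ψ - P.hBdry v) p| ≤ B) ∧
    ∃ K₁ K₂ : ℝ × ℝ → ℝ,
      (∀ᵐ p ∂volume.restrict (P.Omega2 v),
        pdx (P.Omega v) ψ p = pdx (P.Omega v) (ψ - P.hBdry v) p + K₁ p ∧
        pdz (P.Omega v) ψ p = pdz (P.Omega v) (ψ - P.hBdry v) p + K₂ p) ∧
      (∀ p ∈ P.Omega2 v, |K₁ p| ≤ B ∧ |K₂ p| ≤ B) ∧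
      ∀ ε > 0, ∀ p ∈ P.Omega2 v, shiftUp ε p ∈ P.Omega2 v →
        |K₁ (shiftUp ε p) - K₁ p| ≤ B * ε ∧ |K₂ (shiftUp ε p) - K₂ p| ≤ B * ε := by
  have hL := hP.L_pos
  -- M bounds v from above and V bounds |∂ₓv|, for all deformations under consideration; the compact
  -- sets below therefore do not depend on v.
  set M := √(2 * P.L) * ρ * P.L with hM
  set V := √(2 * P.L) * ρ with hV
  have ud₁ : UniqueDiffOn ℝ (Icc (-P.L) P.L ×ˢ Icc (-P.H - P.d) (-P.H) ×ˢ Ici (-P.H)) :=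
    (uniqueDiffOn_Icc (by linarith)).prod
      ((uniqueDiffOn_Icc (by linarith [hP.d_pos])).prod (uniqueDiffOn_Ici _))
  have ud₂ : UniqueDiffOn ℝ (Icc (-P.L) P.L ×ˢ Ici (-P.H) ×ˢ Ici (-P.H)) :=
    (uniqueDiffOn_Icc (by linarith)).prod ((uniqueDiffOn_Ici _).prod (uniqueDiffOn_Ici _))
  obtain ⟨B₁, hB₁, hb₁, -⟩ := exists_bound_fderivWithin ud₁ hP.h₁_smooth
    (K := Icc (-P.L) P.L ×ˢ Icc (-P.H - P.d) (-P.H) ×ˢ Icc (-P.H) M)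
    (isCompact_Icc.prod (isCompact_Icc.prod isCompact_Icc))
    ((convex_Icc _ _).prod ((convex_Icc _ _).prod (convex_Icc _ _)))
    (Set.prod_mono le_rfl (Set.prod_mono le_rfl Icc_subset_Ici_self))
  obtain ⟨B₂, hB₂, hb₂, hl₂⟩ := exists_bound_fderivWithin ud₂ hP.h₂_smooth
    (K := Icc (-P.L) P.L ×ˢ Icc (-P.H) M ×ˢ Icc (-P.H) M)
    (isCompact_Icc.prod (isCompact_Icc.prod isCompact_Icc))
    ((convex_Icc _ _).prod ((convex_Icc _ _).prod (convex_Icc _ _)))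
    (Set.prod_mono le_rfl (Set.prod_mono Icc_subset_Ici_self Icc_subset_Ici_self))
  refine ⟨max B₁ B₂ * (1 + |V|), by positivity, fun v hv hρ ψ hψ => ?_⟩
  obtain ⟨v', hv'c, hvd, -, hv'b, -⟩ := hv.1.structure hL
  have hvb : ∀ x ∈ dom P.L, v x ∈ Icc (-P.H) M := fun x hx => by
    refine ⟨hv.2 x hx, (le_abs_self _).trans ((hv.1.abs_apply_le hL hρ
      (Ioo_subset_Icc_self hx)).trans ?_)⟩
    have h0 : (0 : ℝ) ≤ ρ := ENNReal.toReal_nonneg.trans hρ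
    rw [hM]
    have := abs_nonneg x
    gcongr; linarith
  have hv'V : ∀ x, |v' x| ≤ |V| := fun x => by
    refine (hv'b x).trans (le_trans ?_ (le_abs_self _))
    rw [hV]; gcongr
  have hvc : ContinuousOn v (dom P.L) := hv.1.continuousOn.mono Ioo_subset_Icc_self
  have m₁ : ∀ p ∈ P.Omega1, graphMap v p ∈
      Icc (-P.L) P.L ×ˢ Icc (-P.H - P.d) (-P.H) ×ˢ Icc (-P.H) M :=
    fun p hp => ⟨Ioo_subset_Icc_self hp.1, Ioo_subset_Icc_self hp.2, hvb _ hp.1⟩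
  have m₂ : ∀ p ∈ P.Omega2 v, graphMap v p ∈ Icc (-P.L) P.L ×ˢ Icc (-P.H) M ×ˢ Icc (-P.H) M :=
    fun p hp => ⟨Ioo_subset_Icc_self hp.1, ⟨hp.2.1.le, hp.2.2.le.trans (hvb _ hp.1).2⟩, hvb _ hp.1⟩
  obtain ⟨w₁, w₁'⟩ := hasWeakDeriv_comp_graphMap ud₁ hP.h₁_smooth isOpen_Omega1
    (v := v) (v' := v') (fun p hp => hvd _ hp.1) hv'c
    (fun p hp => Set.prod_mono le_rfl (Set.prod_mono le_rfl Icc_subset_Ici_self) (m₁ p hp))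
  obtain ⟨w₂, w₂'⟩ := hasWeakDeriv_comp_graphMap ud₂ hP.h₂_smooth (isOpen_Omega2 hvc)
    (v := v) (v' := v') (fun p hp => hvd _ hp.1) hv'c
    (fun p hp => Set.prod_mono le_rfl (Set.prod_mono Icc_subset_Ici_self Icc_subset_Ici_self) (m₂ p hp))
  -- The weak gradient of h_v is the difference of those of ψ and ψ - h_v. On each layer it agrees
  -- with the classical gradient of the smooth formula by uniqueness of weak derivatives.
  have hh : ψ - (ψ - P.hBdry v) = P.hBdry v := by ext p; simp
  have gx := hψ.1.2.1.1.sub hψ.2.1.1.2.1.1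
  have gz := hψ.1.2.2.1.sub hψ.2.1.1.2.2.1
  rw [hh] at gx gz
  have e₁ : P.hBdry v =ᵐ[volume.restrict P.Omega1]
      fun p => (fun q : ℝ × ℝ × ℝ => P.h₁ q.1 q.2.1 q.2.2) (graphMap v p) := by
    filter_upwards [ae_restrict_mem isOpen_Omega1.measurableSet] with p hp
    rw [hBdry, if_pos hp.2.2.le]; rfl
  have e₂ : P.hBdry v =ᵐ[volume.restrict (P.Omega2 v)]
      fun p => (fun q : ℝ × ℝ × ℝ => P.h₂ q.1 q.2.1 q.2.2) (graphMap v p) := by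
    filter_upwards [ae_restrict_mem (isOpen_Omega2 hvc).measurableSet] with p hp
    rw [hBdry, if_neg (not_le.2 hp.2.1)]; rfl
  have x₁ := ((gx.mono (Omega1_subset v)).congr e₁ (EventuallyEq.refl _ _)).unique isOpen_Omega1 w₁
  have z₁ := ((gz.mono (Omega1_subset v)).congr e₁ (EventuallyEq.refl _ _)).unique isOpen_Omega1 w₁'
  have x₂ := ((gx.mono (Omega2_subset v)).congr e₂ (EventuallyEq.refl _ _)).unique
    (isOpen_Omega2 hvc) w₂
  have z₂ := ((gz.mono (Omega2_subset v)).congr e₂ (EventuallyEq.refl _ _)).unique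
    (isOpen_Omega2 hvc) w₂'
  have nx : ∀ x, ‖((1, 0, v' x) : ℝ × ℝ × ℝ)‖ ≤ 1 + |V| := fun x =>
    norm_graph_vector_le _ _ _ (by simp) (by simp) (hv'V x)
  have nz : ‖((0, 1, 0) : ℝ × ℝ × ℝ)‖ ≤ 1 + |V| :=
    norm_graph_vector_le _ _ _ (by simp) (by simp) (by simp)
  have op : ∀ (A : ℝ × ℝ × ℝ →L[ℝ] ℝ) (y : ℝ × ℝ × ℝ) (c : ℝ), ‖A‖ ≤ c → ‖y‖ ≤ 1 + |V| →
      |A y| ≤ c * (1 + |V|) := fun A y c hA hy => by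
    rw [← Real.norm_eq_abs]; exact A.le_of_opNorm_le_of_le hA hy
  have b₁ := fun p (hp : p ∈ P.Omega1) => (hb₁ _ (m₁ p hp)).trans (le_max_left B₁ B₂)
  have b₂ := fun p (hp : p ∈ P.Omega2 v) => (hb₂ _ (m₂ p hp)).trans (le_max_right B₁ B₂)
  refine ⟨ae_Omega_of ?_ ?_, _, _, ?_, fun p hp => ⟨op _ _ _ (b₂ p hp) (nx p.1),
    op _ _ _ (b₂ p hp) nz⟩, fun ε hε p hp hp' => ?_⟩
  · filter_upwards [x₁, z₁, ae_restrict_mem isOpen_Omega1.measurableSet] with p hx hz hp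
    simp only [Pi.sub_apply] at hx hz
    rw [hx, hz]
    exact ⟨op _ _ _ (b₁ p hp) (nx p.1), op _ _ _ (b₁ p hp) nz⟩
  · filter_upwards [x₂, z₂, ae_restrict_mem (isOpen_Omega2 hvc).measurableSet] with p hx hz hp
    simp only [Pi.sub_apply] at hx hz
    rw [hx, hz]
    exact ⟨op _ _ _ (b₂ p hp) (nx p.1), op _ _ _ (b₂ p hp) nz⟩
  · filter_upwards [x₂, z₂] with p hx hz
    simp only [Pi.sub_apply] at hx hz
    rw [← hx, ← hz]
    exact ⟨by ring, by ring⟩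
  -- A vertical translation changes neither v(x) nor the direction (1, 0, v'(x)), so the Lipschitz
  -- continuity of the derivative of h₂ suffices and no modulus of continuity of v' is needed.
  · have hn : ‖graphMap v (shiftUp ε p) - graphMap v p‖ = ε := by
      simp only [graphMap, shiftUp, Prod.mk_sub_mk, sub_self, add_sub_cancel_left, Prod.norm_def,
        norm_zero, Real.norm_of_nonneg hε.le]
      simp [hε.le]
    have h := hl₂ _ (m₂ _ hp') _ (m₂ p hp)
    rw [hn] at h
    have h' := h.trans (mul_le_mul_of_nonneg_right (le_max_right B₁ B₂) hε.le)
    have r : max B₁ B₂ * (1 + |V|) * ε = max B₁ B₂ * ε * (1 + |V|) := by ring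
    rw [r]
    exact ⟨op _ _ _ h' (nx p.1), op _ _ _ h' nz⟩

end Data

/-- The cutoff vanishes near the interface z = -H, so that only the constant permittivity σ₂ is
seen. It equals 1 above -H/4, which contains the strips of width less than H/8 below the points with
v ≥ -H/8. -/
theorem exists_strip_cutoff {H : ℝ} (hH : 0 < H) : ∃ η : ℝ → ℝ, ∃ R : ℝ, 0 ≤ R ∧ ContDiff ℝ ∞ η ∧
    Monotone η ∧ (∀ z, 0 ≤ η z) ∧ (∀ z, η z ≤ 1) ∧ (∀ z, |deriv η z| ≤ R) ∧
    (∀ z ≤ -H / 2, η z = 0) ∧ ∀ z ≥ -H / 4, η z = 1 := by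
  set ℓ : ℝ → ℝ := fun z => (z + H / 2) / (H / 4) with hℓ
  have hℓs : ContDiff ℝ ∞ ℓ := (contDiff_id.add contDiff_const).div_const _
  set η : ℝ → ℝ := fun z => Real.smoothTransition (ℓ z) with hη
  have hs : ContDiff ℝ ∞ η := Real.smoothTransition.contDiff.comp hℓs
  have h0 : ∀ z ≤ -H / 2, η z = 0 := fun z hz =>
    Real.smoothTransition.zero_of_nonpos (div_nonpos_of_nonpos_of_nonneg (by linarith) (by linarith))
  have h1 : ∀ z ≥ -H / 4, η z = 1 := fun z hz =>
    Real.smoothTransition.one_of_one_le ((one_le_div (by linarith)).2 (by linarith))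
  have hd : Continuous (deriv η) := hs.continuous_deriv (by simp)
  obtain ⟨R, hR⟩ := (isCompact_Icc (a := -H / 2) (b := -H / 4)).exists_bound_of_continuousOn
    hd.continuousOn
  refine ⟨η, max R 0, le_max_right _ _, hs, ?_, fun z => Real.smoothTransition.nonneg _,
    fun z => Real.smoothTransition.le_one _, fun z => ?_, h0, h1⟩
  · intro z w hzw
    refine Real.smoothTransition.monotone ?_
    simp only [hℓ]; gcongr
  · rcases lt_or_ge z (-H / 2) with h | h
    · have : η =ᶠ[𝓝 z] fun _ => 0 := by
        filter_upwards [Iio_mem_nhds h] with y hy using h0 y (le_of_lt hy)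
      rw [this.deriv_eq]; simp
    rcases le_or_gt z (-H / 4) with h' | h'
    · exact (hR z ⟨h, h'⟩).trans (le_max_left _ _)
    · have : η =ᶠ[𝓝 z] fun _ => 1 := by
        filter_upwards [Ioi_mem_nhds h'] with y hy using h1 y (le_of_lt hy)
      rw [this.deriv_eq]; simp

theorem nrm2_indicator {α : Type*} [MeasurableSpace α] {μ : Measure α} {s : Set α}
    (hs : MeasurableSet s) (f : α → ℝ) : nrm2 μ (s.indicator f) = nrm2 (μ.restrict s) f := by
  rw [nrm2, nrm2, eLpNorm_indicator_eq_eLpNorm_restrict hs]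

theorem IsTestFun.fderiv_eq_zero_of_notMem {E : Type*} [NormedAddCommGroup E] [NormedSpace ℝ E]
    {U : Set E} {φ : E → ℝ} (hφ : IsTestFun U φ) {p : E} (hp : p ∉ U) : fderiv ℝ φ p = 0 :=
  image_eq_zero_of_notMem_tsupport fun h => hp (hφ.2.2 (tsupport_fderiv_subset ℝ h))

/-! ### The energy of the potential in thin strips below the plate. -/

namespace Data

variable {P : Data}

/-- The set of points of `Ω₂(v)` that leave it under the vertical translation by `ε`, above the
points `x` with `v(x) ≥ -H/8`. -/
def strip (P : Data) (v : ℝ → ℝ) (ε : ℝ) : Set (ℝ × ℝ) :=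
  {p | p.1 ∈ dom P.L ∧ -P.H / 8 ≤ v p.1 ∧ v p.1 - ε ≤ p.2 ∧ p.2 < v p.1}

theorem measurableSet_dom_inter {L : ℝ} {v : ℝ → ℝ} (hv : ContinuousOn v (Icc (-L) L)) (c : ℝ) :
    MeasurableSet (dom L ∩ v ⁻¹' Ici c) := by
  have h := (hv.preimage_isClosed_of_isClosed isClosed_Icc (isClosed_Ici (a := c))).measurableSet
  have e : dom L ∩ v ⁻¹' Ici c = dom L ∩ (Icc (-L) L ∩ v ⁻¹' Ici c) := by
    ext x
    simp only [mem_inter_iff]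
    exact ⟨fun hx => ⟨hx.1, Ioo_subset_Icc_self hx.1, hx.2⟩, fun hx => ⟨hx.1, hx.2.2⟩⟩
  rw [e]
  exact measurableSet_Ioo.inter h

/-- The strip stays above -H/4, hence inside Ω₂(v), and an upward translation can leave Ω₂(v) only
through the plate. -/
theorem strip_eq {v : ℝ → ℝ} {ε : ℝ} (hε0 : 0 < ε) (hε : ε < P.H / 8) (hH : 0 < P.H) :
    P.strip v ε = ((dom P.L ∩ v ⁻¹' Ici (-P.H / 8)) ×ˢ univ) ∩
      (P.Omega2 v \ shiftUp ε ⁻¹' P.Omega2 v) := by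
  ext p
  simp only [strip, Omega2, shiftUp, mem_prod, mem_inter_iff, mem_preimage, mem_univ,
    Set.mem_sdiff, mem_Ici]
  simp only [mem_ofPred]
  constructor
  · rintro ⟨h1, h2, h3, h4⟩
    exact ⟨⟨⟨h1, h2⟩, trivial⟩, ⟨h1, by linarith, h4⟩, fun h => by linarith [h.2.2]⟩
  · rintro ⟨⟨⟨h1, h2⟩, -⟩, ⟨-, h3, h4⟩, h5⟩
    refine ⟨h1, h2, ?_, h4⟩
    by_contra h
    push Not at h
    exact h5 ⟨h1, by linarith, by linarith⟩

theorem measurableSet_strip {v : ℝ → ℝ} (hv : ContinuousOn v (Icc (-P.L) P.L)) {ε : ℝ}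
    (hε0 : 0 < ε) (hε : ε < P.H / 8) (hH : 0 < P.H) : MeasurableSet (P.strip v ε) := by
  rw [strip_eq hε0 hε hH]
  have h2 := (isOpen_Omega2 (P := P) (hv.mono Ioo_subset_Icc_self)).measurableSet
  exact ((measurableSet_dom_inter hv _).prod MeasurableSet.univ).inter
    (h2.diff ((measurableEmbedding_shiftUp ε).measurable h2))

/-- Width 2ε instead of ε leaves room for the strict inequalities of `regionBetween`, since the
lower edge z = v(x) - ε must be included. -/
theorem volume_diff_shiftUp_le (hL : 0 < P.L) {v : ℝ → ℝ} (hv : ContinuousOn v (dom P.L)) {ε : ℝ}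
    (hε : 0 < ε) : volume.real (P.Omega2 v \ shiftUp ε ⁻¹' P.Omega2 v) ≤ 4 * P.L * ε := by
  have hsub : P.Omega2 v \ shiftUp ε ⁻¹' P.Omega2 v
      ⊆ regionBetween (fun x => v x - 2 * ε) v (dom P.L) := by
    rintro p ⟨⟨h1, h2, h3⟩, h4⟩
    refine ⟨h1, ?_, h3⟩
    by_contra h
    push Not at h
    exact h4 ⟨h1, by simp only [shiftUp]; linarith, by simp only [shiftUp]; linarith⟩
  have hm : AEMeasurable v (volume.restrict (dom P.L)) := hv.aemeasurable measurableSet_Ioo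
  have h := measure_mono (μ := volume) hsub
  rw [Measure.volume_eq_prod, volume_regionBetween_eq_lintegral (hm.sub_const _) hm measurableSet_Ioo]
    at h
  simp only [Pi.sub_apply, sub_sub_cancel, lintegral_const, Measure.restrict_apply_univ,
    Real.volume_Ioo] at h
  rw [← ENNReal.ofReal_mul (by linarith)] at h
  refine ENNReal.toReal_le_of_le_ofReal (by positivity) (h.trans (le_of_eq ?_))
  congr 1; ring

/-- The energy of the potential close to the elastic plate. -/
theorem exists_strip_bound (hP : P.Admissible) (ρ : ℝ) : ∃ C, 0 ≤ C ∧ ∀ v, P.MemSbar v →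
    l2 P.L (dx P.L (dx P.L v)) ≤ ρ → ∀ ψ, P.IsPotential v ψ → ∀ ε, 0 < ε → ε < P.H / 8 →
      ∫⁻ p in P.strip v ε, ENNReal.ofReal (pdz (P.Omega v) ψ p ^ 2) ≤ ENNReal.ofReal (C * ε) := by
  have hL := hP.L_pos
  have hH := hP.H_pos
  have hd := hP.d_pos
  obtain ⟨B, hB, hdata⟩ := exists_boundary_data_bound hP ρ
  obtain ⟨s, S, hs, hσ⟩ := exists_sigma_bounds hP
  obtain ⟨η, R, hR0, hηs, hηm, hη0, hη1, hηR, hηz, hηo⟩ := exists_strip_cutoff hH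
  set M := √(2 * P.L) * ρ * P.L with hM
  set box : Set (ℝ × ℝ) := Icc (-P.L) P.L ×ˢ Icc (-P.H - P.d) M with hbox
  have hboxv : volume box ≠ ⊤ := (isCompact_Icc.prod isCompact_Icc).measure_lt_top.ne
  set W := volume.real box with hW
  have hW0 : 0 ≤ W := measureReal_nonneg
  set E := 2 * (|S| * B ^ 2 * W) / s with hE
  have hE0 : 0 ≤ E := by positivity
  -- E bounds the squared norm of the gradient and W the area of Ω(v). As ‖b‖² ≤ E and ‖g₂‖² ≤ 2E +
  -- 2B²W, the first summand dominates the contribution of the derivative of the cutoff; 4L comes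
  -- from the area of the strip.
  refine ⟨4 * (R * (3 * E + 2 * B ^ 2 * W) + 2 * B ^ 2 * (4 * P.L) + B ^ 2 * W + E), by positivity,
    fun v hv hρ ψ hψ ε hε hε' => ?_⟩
  have hρ0 : 0 ≤ ρ := ENNReal.toReal_nonneg.trans hρ
  have hvb : ∀ x ∈ dom P.L, v x ≤ M := fun x hx => by
    refine (le_abs_self _).trans ((hv.1.abs_apply_le hL hρ (Ioo_subset_Icc_self hx)).trans ?_)
    have := abs_nonneg x
    rw [hM]; gcongr; linarith
  have hM0 : 0 ≤ M := by positivity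
  have hvc : ContinuousOn v (dom P.L) := hv.1.continuousOn.mono Ioo_subset_Icc_self
  have hΩm : MeasurableSet (P.Omega v) := measurableSet_Omega hvc
  have hΩbox : P.Omega v ⊆ box := by
    rintro p ((hp | hp) | hp)
    · exact ⟨Ioo_subset_Icc_self hp.1, hp.2.1.le, by linarith [hp.2.2]⟩
    · exact ⟨Ioo_subset_Icc_self hp.1, by linarith [hp.2.1], by linarith [hp.2.1]⟩
    · exact ⟨Ioo_subset_Icc_self hp.1, by linarith [hp.2.1], hp.2.2.le.trans (hvb _ hp.1)⟩
  have hΩv : volume (P.Omega v) ≠ ⊤ := ((measure_mono hΩbox).trans_lt hboxv.lt_top).ne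
  have : IsFiniteMeasure (volume.restrict (P.Omega v)) :=
    ⟨by rw [Measure.restrict_apply_univ]; exact hΩv.lt_top⟩
  obtain ⟨hbd, K₁, K₂, hin, hKb, hKl⟩ := hdata v hv hρ ψ hψ
  obtain ⟨hψ1, ⟨hφ1, Φ, hΦ, -, hΦx, hΦz⟩, hψeq⟩ := hψ
  set Ω := P.Omega v with hΩ
  set p := pdx Ω ψ with hp
  set q := pdz Ω ψ with hq
  set p₀ := pdx Ω (ψ - P.hBdry v) with hp₀
  set q₀ := pdz Ω (ψ - P.hBdry v) with hq₀
  have Lp : MemLp p 2 (volume.restrict Ω) := hψ1.2.1.2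
  have Lq : MemLp q 2 (volume.restrict Ω) := hψ1.2.2.2
  have Lp₀ : MemLp p₀ 2 (volume.restrict Ω) := hφ1.2.1.2
  have Lq₀ : MemLp q₀ 2 (volume.restrict Ω) := hφ1.2.2.2
  have LΦ : ∀ n e, MemLp (fun x => fderiv ℝ (Φ n) x e) 2 volume := fun n e =>
    ((hΦ n).continuous_fderiv e).memLp_of_hasCompactSupport ((hΦ n).hasCompactSupport_fderiv e)
  have hWle : (volume.restrict Ω).real univ ≤ W := by
    rw [measureReal_restrict_apply_univ]; exact measureReal_mono hΩbox hboxv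
  have en : ∫ x in Ω, (p x ^ 2 + q x ^ 2) ≤ E := by
    refine (integral_grad_sq_le hs (aestronglyMeasurable_sigma hP hvc) (S := S) (B := B) ?_ Lp Lq
      Lp₀ Lq₀ (fun n => (LΦ n (1, 0)).restrict _) (fun n => (LΦ n (0, 1)).restrict _) hΦx hΦz
      (fun n => hψeq _ (hΦ n)) hbd).trans ?_
    · filter_upwards [ae_ne_interface v, ae_restrict_mem hΩm] with x hx hxΩ using hσ v x hxΩ hx
    · rw [hE]
      have := le_abs_self S
      gcongr
  set a := Ω.indicator p with ha
  set b := Ω.indicator q with hb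
  set g₁ := Ω.indicator p₀ with hg₁
  set g₂ := Ω.indicator q₀ with hg₂
  have La : MemLp a 2 volume := (memLp_indicator_iff_restrict hΩm).2 Lp
  have Lb : MemLp b 2 volume := (memLp_indicator_iff_restrict hΩm).2 Lq
  have Lg₁ : MemLp g₁ 2 volume := (memLp_indicator_iff_restrict hΩm).2 Lp₀
  have Lg₂ : MemLp g₂ 2 volume := (memLp_indicator_iff_restrict hΩm).2 Lq₀
  have nab : nrm2 volume a ^ 2 + nrm2 volume b ^ 2 ≤ E := by
    rw [nrm2_indicator hΩm, nrm2_indicator hΩm, nrm2_sq Lp, nrm2_sq Lq,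
      ← integral_add Lp.integrable_sq Lq.integrable_sq]
    exact en
  have ng : nrm2 volume g₂ ^ 2 ≤ 2 * E + 2 * B ^ 2 * W := by
    rw [nrm2_indicator hΩm, nrm2_sq Lq₀]
    have i1 : Integrable (fun x => 2 * q x ^ 2 + 2 * B ^ 2) (volume.restrict Ω) :=
      (Lq.integrable_sq.const_mul 2).add (integrable_const _)
    have h1 : ∫ x in Ω, q₀ x ^ 2 ≤ ∫ x in Ω, (2 * q x ^ 2 + 2 * B ^ 2) := by
      refine integral_mono_ae Lq₀.integrable_sq i1 ?_
      filter_upwards [hbd] with x hx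
      have e2 : (q x - q₀ x) ^ 2 ≤ B ^ 2 := by
        rw [← sq_abs]; exact pow_le_pow_left₀ (abs_nonneg _) hx.2 2
      show q₀ x ^ 2 ≤ 2 * q x ^ 2 + 2 * B ^ 2
      nlinarith [sq_nonneg (q₀ x - 2 * q x)]
    rw [integral_add (Lq.integrable_sq.const_mul 2) (integrable_const _), integral_const_mul,
      integral_const, smul_eq_mul] at h1
    have h2 : ∫ x in Ω, q x ^ 2 ≤ E := by
      rw [nrm2_indicator hΩm, nrm2_indicator hΩm, nrm2_sq Lp, nrm2_sq Lq] at nab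
      have : 0 ≤ ∫ x in Ω, p x ^ 2 := integral_nonneg fun x => sq_nonneg _
      linarith
    have h3 : (volume.restrict Ω).real univ * (2 * B ^ 2) ≤ W * (2 * B ^ 2) := by gcongr
    linarith
  have indt : ∀ (g : ℝ × ℝ → ℝ) (n : ℕ) (e : ℝ × ℝ),
      (fun x => Ω.indicator g x - fderiv ℝ (Φ n) x e)
        = Ω.indicator (fun x => g x - fderiv ℝ (Φ n) x e) := by
    intro g n e
    ext x
    by_cases hx : x ∈ Ω
    · simp [hx]
    · simp [hx, (hΦ n).fderiv_eq_zero_of_notMem hx]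
  have hQ := abs_integral_shiftUp_le La Lb Lg₁ Lg₂ hΦ
    (by simp only [hg₁, indt, eLpNorm_indicator_eq_eLpNorm_restrict hΩm]; exact hΦx)
    (by simp only [hg₂, indt, eLpNorm_indicator_eq_eLpNorm_restrict hΩm]; exact hΦz) hηs
    (fun z => abs_le.2 ⟨by linarith [hη0 z], hη1 z⟩) hR0 hηR hηz hε
    (fun x hx hx' => Omega2_subset v (by
      have h2 : shiftUp ε x ∈ P.Omega2 v := mem_Omega2_of_mem hx' (by simp only [shiftUp]; linarith)
      have h3 : x.2 + ε < v x.1 := h2.2.2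
      exact ⟨h2.1, by linarith, by linarith⟩))
    -- T vanishes up to the height -H/2, hence in a neighbourhood of every point at or below the
    -- interface. On the rest σ is the constant σ₂, which can be divided out.
    (fun T hT hT0 => by
      have h := hψeq T hT
      have e : ∀ x, Ω.indicator (fun x => P.sigma x * (p x * fderiv ℝ T x (1, 0)
          + q x * fderiv ℝ T x (0, 1))) x
          = P.σ₂ * (a x * fderiv ℝ T x (1, 0) + b x * fderiv ℝ T x (0, 1)) := by
        intro x
        by_cases hx : x ∈ Ω
        · rw [ha, hb, indicator_of_mem hx, indicator_of_mem hx, indicator_of_mem hx]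
          by_cases hx2 : x.2 ≤ -P.H
          · have hz : T =ᶠ[𝓝 x] fun _ => 0 := by
              have : {y : ℝ × ℝ | y.2 < -P.H / 2} ∈ 𝓝 x :=
                (isOpen_lt continuous_snd continuous_const).mem_nhds (by
                  show x.2 < -P.H / 2; linarith)
              filter_upwards [this] with y hy using hT0 y (le_of_lt hy)
            have hz' : fderiv ℝ T x = 0 := by rw [hz.fderiv_eq]; simp
            simp [hz']
          · rw [sigma, if_neg hx2]
        · rw [ha, hb, indicator_of_notMem hx, indicator_of_notMem hx, indicator_of_notMem hx]; simp
      rw [← integral_indicator hΩm, integral_congr_ae (ae_of_all _ e), integral_const_mul] at h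
      exact (mul_eq_zero.1 h).resolve_left hP.σ₂_pos.ne')
  have hSm : MeasurableSet (P.Omega2 v) := (isOpen_Omega2 hvc).measurableSet
  have hSb : P.Omega2 v ⊆ box := (Omega2_subset v).trans hΩbox
  have hsl := integral_strip_le hSm ((measure_mono hSb).trans_lt hboxv.lt_top).ne La Lb Lg₁ Lg₂
    hηs.continuous hηm hη0 hη1 (z₀ := -P.H / 2) (B := B) (ε := ε) (A := 4 * P.L) (K₁ := K₁)
    (K₂ := K₂) hηz hε
    (fun x hx hxS => by
      have hxΩ : x ∉ Ω := fun h => hxS (mem_Omega2_of_mem h (by linarith))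
      simp [ha, hb, hg₁, hg₂, hxΩ])
    (by
      rw [ae_restrict_iff' hSm] at hin
      filter_upwards [hin] with x hx hxS
      have hxΩ : x ∈ Ω := Omega2_subset v hxS
      simpa [ha, hb, hg₁, hg₂, hxΩ] using hx hxS)
    hKb (fun x hx hx' => hKl ε hε x hx hx') (volume_diff_shiftUp_le hL hvc hε) hQ
  set N := P.Omega2 v \ shiftUp ε ⁻¹' P.Omega2 v with hN
  have hNm : MeasurableSet N := hSm.diff ((measurableEmbedding_shiftUp ε).measurable hSm)
  have hint : Integrable (fun x : ℝ × ℝ => η x.2 * (a x ^ 2 + b x ^ 2)) volume := by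
    refine (La.integrable_sq.add Lb.integrable_sq).bdd_mul (c := 1)
      (hηs.continuous.comp continuous_snd).aestronglyMeasurable (ae_of_all _ fun x => ?_)
    rw [Real.norm_of_nonneg (hη0 _)]; exact hη1 _
  have hstrip := measurableSet_strip (P := P) hv.1.continuousOn hε hε' hH
  calc ∫⁻ x in P.strip v ε, ENNReal.ofReal (q x ^ 2)
      ≤ ∫⁻ x in P.strip v ε, ENNReal.ofReal (η x.2 * (a x ^ 2 + b x ^ 2)) := by
        refine setLIntegral_mono' hstrip fun x hx => ENNReal.ofReal_le_ofReal ?_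
        have hx' : x ∈ N := by rw [strip_eq hε hε' hH] at hx; exact hx.2
        rw [hηo _ (by have := hx.2.1; have := hx.2.2.1; linarith), one_mul, hb,
          indicator_of_mem (Omega2_subset v hx'.1)]
        have := sq_nonneg (a x)
        linarith
    _ ≤ ∫⁻ x in N, ENNReal.ofReal (η x.2 * (a x ^ 2 + b x ^ 2)) :=
        lintegral_mono_set (by rw [strip_eq hε hε' hH]; exact inter_subset_right)
    _ = ENNReal.ofReal (∫ x in N, η x.2 * (a x ^ 2 + b x ^ 2)) := by
        rw [ofReal_integral_eq_lintegral_ofReal hint.restrict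
          (ae_of_all _ fun x => mul_nonneg (hη0 _) (by positivity))]
    _ ≤ _ := by
        refine ENNReal.ofReal_le_ofReal (hsl.trans ?_)
        rw [mul_comm]
        have f1 : R * nrm2 volume b * nrm2 volume g₂ ≤ R * (3 * E + 2 * B ^ 2 * W) := by
          rw [mul_assoc]
          refine mul_le_mul_of_nonneg_left ?_ hR0
          nlinarith [sq_nonneg (nrm2 volume b - nrm2 volume g₂), sq_nonneg (nrm2 volume a),
            sq_nonneg (nrm2 volume b), sq_nonneg (nrm2 volume g₂)]
        have f2 : volume.real (P.Omega2 v) ≤ W := measureReal_mono hSb hboxv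
        have f3 : B ^ 2 * volume.real (P.Omega2 v) ≤ B ^ 2 * W := by gcongr
        refine mul_le_mul_of_nonneg_right ?_ hε.le
        linarith

end Data

/-! ### From strips to traces: the electrostatic force away from contact. -/

theorem ofReal_sq_average_le (f : ℝ → ℝ) {b ε : ℝ} (hε : 0 < ε) :
    ENNReal.ofReal ((ε⁻¹ * ∫ z in (b - ε)..b, f z) ^ 2)
      ≤ ENNReal.ofReal ε⁻¹ * ∫⁻ z in Ico (b - ε) b, ENNReal.ofReal (f z ^ 2) := by
  have h := ofReal_sq_integral_le (volume.restrict (Ioc (b - ε) b)) f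
  rw [intervalIntegral.integral_of_le (by linarith), mul_pow, ENNReal.ofReal_mul (by positivity),
    restrict_Ico_eq_restrict_Ioc]
  refine (mul_le_mul_right h _).trans (le_of_eq ?_)
  rw [← mul_assoc, Measure.restrict_apply_univ, Real.volume_Ioc, sub_sub_cancel,
    ← ENNReal.ofReal_mul (by positivity)]
  congr 2
  field_simp

/-- The trace is controlled by the mean squares over short segments; if the limit that defines
it does not exist, it has a fixed value. -/
theorem exists_ofReal_traceBelow_sq_le : ∃ c : ℝ, ∀ (f : ℝ × ℝ → ℝ) (x b : ℝ) (ε : ℕ → ℝ),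
    (∀ n, 0 < ε n) → Tendsto ε atTop (𝓝 0) →
    ENNReal.ofReal (traceBelow f x b ^ 2) ≤ ENNReal.ofReal (c ^ 2) +
      liminf (fun n => ENNReal.ofReal (ε n)⁻¹ *
        ∫⁻ z in Ico (b - ε n) b, ENNReal.ofReal (f (x, z) ^ 2)) atTop := by
  -- When there is no limit, `limUnder` is the choice from the empty predicate, and this is the same
  -- number for all functions and points.
  refine ⟨Classical.epsilon fun _ : ℝ => False, fun f x b ε hε hε0 => ?_⟩
  set m : ℝ → ℝ := fun ε => ε⁻¹ * ∫ z in (b - ε)..b, f (x, z) with hm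
  by_cases h : ∃ l, Tendsto m (𝓝[>] 0) (𝓝 l)
  · obtain ⟨l, hl⟩ := h
    have e : traceBelow f x b = l := hl.limUnder_eq
    have t1 : Tendsto ε atTop (𝓝[>] 0) :=
      tendsto_nhdsWithin_of_tendsto_nhds_of_eventually_within _ hε0 (Eventually.of_forall hε)
    have t2 : Tendsto (fun n => ENNReal.ofReal (m (ε n) ^ 2)) atTop (𝓝 (ENNReal.ofReal (l ^ 2))) :=
      ENNReal.tendsto_ofReal ((hl.comp t1).pow 2)
    rw [e, ← t2.liminf_eq]
    refine le_add_left (liminf_le_liminf (Eventually.of_forall fun n => ?_))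
    exact ofReal_sq_average_le (fun z => f (x, z)) (hε n)
  · have e : traceBelow f x b = Classical.epsilon fun _ : ℝ => False := by
      show lim (map m (𝓝[>] 0)) = _
      rw [lim]
      congr 1
      ext l
      exact iff_false_intro fun hl => h ⟨l, hl⟩
    rw [e]
    exact le_self_add

namespace Data

variable {P : Data}

/-- Tonelli's theorem assembles the vertical segments of length ε into the strip, whose energy Cε
cancels the factor 1/ε from averaging; Fatou's lemma along ε = H/(16(n+1)) does the rest. The term
with c accounts for points where the averages do not converge. -/
theorem lintegral_traceBelow_le (hL : 0 < P.L) (hH : 0 < P.H) {c : ℝ}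
    (hc : ∀ (f : ℝ × ℝ → ℝ) (x b : ℝ) (ε : ℕ → ℝ), (∀ n, 0 < ε n) → Tendsto ε atTop (𝓝 0) →
      ENNReal.ofReal (traceBelow f x b ^ 2) ≤ ENNReal.ofReal (c ^ 2) +
        liminf (fun n => ENNReal.ofReal (ε n)⁻¹ *
          ∫⁻ z in Ico (b - ε n) b, ENNReal.ofReal (f (x, z) ^ 2)) atTop)
    {v : ℝ → ℝ} (hv : ContinuousOn v (Icc (-P.L) P.L)) {q : ℝ × ℝ → ℝ}
    (hq : AEStronglyMeasurable q (volume.restrict (P.Omega2 v))) {C : ℝ}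
    (hC : ∀ ε, 0 < ε → ε < P.H / 8 →
      ∫⁻ p in P.strip v ε, ENNReal.ofReal (q p ^ 2) ≤ ENNReal.ofReal (C * ε)) :
    ∫⁻ x in dom P.L ∩ v ⁻¹' Ici (-P.H / 8), ENNReal.ofReal (traceBelow q x (v x) ^ 2)
      ≤ ENNReal.ofReal (c ^ 2) * ENNReal.ofReal (2 * P.L) + ENNReal.ofReal C := by
  set A := dom P.L ∩ v ⁻¹' Ici (-P.H / 8) with hA
  have hAm : MeasurableSet A := measurableSet_dom_inter hv _
  set ε : ℕ → ℝ := fun n => (P.H / 16) * (1 / ((n : ℝ) + 1)) with hε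
  have hεp : ∀ n, 0 < ε n := fun n => by positivity
  have hεl : ∀ n, ε n < P.H / 8 := fun n => by
    have : (1 : ℝ) / ((n : ℝ) + 1) ≤ 1 := by
      rw [div_le_one (by positivity)]; linarith [(Nat.cast_nonneg n : (0 : ℝ) ≤ n)]
    simp only [hε]; nlinarith
  have hε0 : Tendsto ε atTop (𝓝 0) := by
    have := (tendsto_one_div_add_atTop_nhds_zero_nat (𝕜 := ℝ)).const_mul (P.H / 16)
    simpa [hε] using this
  set F : ℕ → ℝ × ℝ → ℝ≥0∞ := fun n =>
    (P.strip v (ε n)).indicator fun p => ENNReal.ofReal (q p ^ 2) with hF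
  have hFm : ∀ n, AEMeasurable (F n) (volume.prod volume) := fun n => by
    rw [← Measure.volume_eq_prod, hF,
      aemeasurable_indicator_iff (measurableSet_strip hv (hεp n) (hεl n) hH)]
    have h1 : P.strip v (ε n) ⊆ P.Omega2 v := by
      rw [strip_eq (hεp n) (hεl n) hH]; exact fun p hp => hp.2.1
    exact ((hq.mono_measure (Measure.restrict_mono h1 le_rfl)).aemeasurable.pow_const 2).ennreal_ofReal
  have hFs : ∀ n, ∀ x ∈ A, ∫⁻ z, F n (x, z) = ∫⁻ z in Ico (v x - ε n) (v x),
      ENNReal.ofReal (q (x, z) ^ 2) := fun n x hx => by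
    rw [← lintegral_indicator measurableSet_Ico]
    refine lintegral_congr fun z => ?_
    by_cases hz : z ∈ Ico (v x - ε n) (v x)
    · rw [indicator_of_mem hz]
      exact indicator_of_mem (s := P.strip v (ε n)) (show (x, z) ∈ _ from ⟨hx.1, hx.2, hz⟩) _
    · rw [indicator_of_notMem hz]
      exact indicator_of_notMem (s := P.strip v (ε n))
        (show (x, z) ∉ P.strip v (ε n) from fun h => hz h.2.2) _
  have hFi : ∀ n, ∫⁻ x in A, ∫⁻ z, F n (x, z) ≤ ENNReal.ofReal (C * ε n) := fun n => by
    refine (setLIntegral_le_lintegral _ _).trans ?_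
    rw [← lintegral_prod _ (hFm n), ← Measure.volume_eq_prod,
      lintegral_indicator (measurableSet_strip hv (hεp n) (hεl n) hH)]
    exact hC _ (hεp n) (hεl n)
  calc ∫⁻ x in A, ENNReal.ofReal (traceBelow q x (v x) ^ 2)
      ≤ ∫⁻ x in A, (ENNReal.ofReal (c ^ 2) +
          liminf (fun n => ENNReal.ofReal (ε n)⁻¹ * ∫⁻ z, F n (x, z)) atTop) := by
        refine setLIntegral_mono' hAm fun x hx => (hc q x (v x) ε hεp hε0).trans ?_
        simp only [hFs _ x hx]; exact le_rfl
    _ = (∫⁻ _ in A, ENNReal.ofReal (c ^ 2)) + ∫⁻ x in A,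
          liminf (fun n => ENNReal.ofReal (ε n)⁻¹ * ∫⁻ z, F n (x, z)) atTop :=
        lintegral_add_left measurable_const _
    _ ≤ _ := by
        refine add_le_add ?_ ?_
        · rw [setLIntegral_const]
          refine mul_le_mul_right ((measure_mono inter_subset_left).trans (le_of_eq ?_)) _
          rw [Real.volume_Ioo]; congr 1; ring
        · refine (lintegral_liminf_le' fun n =>
            ((hFm n).lintegral_prod_right'.restrict).const_mul _).trans ?_
          refine liminf_le_of_le (by isBoundedDefault) fun d hd => ?_
          obtain ⟨n, hn⟩ := hd.exists
          refine hn.trans ?_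
          rw [lintegral_const_mul' _ _ ENNReal.ofReal_ne_top]
          refine (mul_le_mul_right (hFi n) _).trans (le_of_eq ?_)
          rw [← ENNReal.ofReal_mul (inv_nonneg.2 (hεp n).le)]
          congr 1
          have := (hεp n).ne'
          field_simp

theorem force_nonneg (hP : P.Admissible) (v : ℝ → ℝ) (x : ℝ) : 0 ≤ P.force v x := by
  have := hP.σ₂_pos
  rw [force]
  split_ifs <;> positivity

/-- Away from the coincidence set, the electrostatic force is bounded in `L₁`. -/
theorem exists_lintegral_force_le (hP : P.Admissible) (ρ : ℝ) : ∃ C, 0 ≤ C ∧ ∀ v, P.MemSbar v →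
    l2 P.L (dx P.L (dx P.L v)) ≤ ρ →
      ∫⁻ x in dom P.L ∩ v ⁻¹' Ici (-P.H / 8), ENNReal.ofReal (P.force v x) ≤ ENNReal.ofReal C := by
  have hL := hP.L_pos
  have hH := hP.H_pos
  have hσ := hP.σ₂_pos
  obtain ⟨C, hC, hs⟩ := exists_strip_bound hP ρ
  obtain ⟨c, hc⟩ := exists_ofReal_traceBelow_sq_le
  set V := √(2 * P.L) * ρ with hV
  refine ⟨P.σ₂ / 2 * (1 + V ^ 2) * (c ^ 2 * (2 * P.L) + C), by positivity, fun v hv hρ => ?_⟩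
  have hvc : ContinuousOn v (dom P.L) := hv.1.continuousOn.mono Ioo_subset_Icc_self
  obtain ⟨v', -, -, hdv, hv'b, -⟩ := hv.1.structure hL
  set q := pdz (P.Omega v) (P.potential v) with hq
  have key : ∫⁻ x in dom P.L ∩ v ⁻¹' Ici (-P.H / 8), ENNReal.ofReal (traceBelow q x (v x) ^ 2)
      ≤ ENNReal.ofReal (c ^ 2) * ENNReal.ofReal (2 * P.L) + ENNReal.ofReal C := by
    by_cases hex : ∃ ψ, P.IsPotential v ψ
    · have hpot : P.IsPotential v (P.potential v) := by
        rw [potential, dif_pos hex]; exact hex.choose_spec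
      refine lintegral_traceBelow_le hL hH hc hv.1.continuousOn ?_ (hs v hv hρ _ hpot)
      exact hpot.1.2.2.2.1.mono_measure (Measure.restrict_mono (Omega2_subset v) le_rfl)
    -- Without a variational solution `potential` is zero by convention. Its selected weak
    -- derivative then vanishes almost everywhere and the strip bound is trivial.
    · have h0 : P.potential v = 0 := by rw [potential, dif_neg hex]
      have w0 : HasWeakDeriv (P.Omega v) ((0, 1) : ℝ × ℝ) (0 : ℝ × ℝ → ℝ) 0 :=
        ⟨locallyIntegrableOn_zero, locallyIntegrableOn_zero, fun φ _ => by simp⟩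
      have hq0 : q =ᵐ[volume.restrict (P.Omega2 v)] 0 := by
        rw [hq, h0]
        exact ((hasWeakDeriv_weakDeriv w0).mono (Omega2_subset v)).unique (isOpen_Omega2 hvc)
          (w0.mono (Omega2_subset v))
      refine lintegral_traceBelow_le hL hH hc hv.1.continuousOn
        (aestronglyMeasurable_zero.congr hq0.symm) fun ε hε hε' => ?_
      have h1 : P.strip v ε ⊆ P.Omega2 v := by
        rw [strip_eq hε hε' hH]; exact fun p hp => hp.2.1
      rw [lintegral_congr_ae (g := fun _ => 0)]
      · simp
      · filter_upwards [ae_restrict_of_ae_restrict_of_subset h1 hq0] with p hp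
        rw [hp]; simp
  calc ∫⁻ x in dom P.L ∩ v ⁻¹' Ici (-P.H / 8), ENNReal.ofReal (P.force v x)
      ≤ ∫⁻ x in dom P.L ∩ v ⁻¹' Ici (-P.H / 8), ENNReal.ofReal (P.σ₂ / 2 * (1 + V ^ 2)) *
          ENNReal.ofReal (traceBelow q x (v x) ^ 2) := by
        refine lintegral_mono_ae ?_
        filter_upwards [ae_restrict_of_ae_restrict_of_subset inter_subset_left hdv,
          ae_restrict_mem (measurableSet_dom_inter hv.1.continuousOn _)] with x hx hxA
        rw [← ENNReal.ofReal_mul (by positivity)]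
        refine ENNReal.ofReal_le_ofReal ?_
        -- These points are not in contact, so the force is given by the trace from below the plate.
        have hne : v x ≠ -P.H := fun h => by
          have : -P.H / 8 ≤ v x := hxA.2
          linarith
        have hd : dx P.L v x ^ 2 ≤ V ^ 2 := by
          rw [hx, ← sq_abs]
          refine pow_le_pow_left₀ (abs_nonneg _) ((hv'b x).trans ?_) 2
          rw [hV]; gcongr
        rw [force, if_neg hne]
        gcongr
    _ ≤ _ := by
        rw [lintegral_const_mul' _ _ ENNReal.ofReal_ne_top]
        refine (mul_le_mul_right key _).trans (le_of_eq ?_)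
        rw [ENNReal.ofReal_mul (p := P.σ₂ / 2 * (1 + V ^ 2)) (by positivity),
          ENNReal.ofReal_add (by positivity) hC,
          ENNReal.ofReal_mul (p := c ^ 2) (by positivity)]

end Data

/-! ### Positive functionals on H²_D(D) and measures. -/

section PositiveFunctionals

variable {L : ℝ}

theorem memH2D_zero (hL : 0 < L) : MemH2D L 0 := by
  have h : IsTestFun (dom L) (0 : ℝ → ℝ) := by
    refine ⟨contDiff_const, HasCompactSupport.zero, ?_⟩
    simp [tsupport]
  exact h.memH2D hL

/-- `H²_D(D)` as a space of functions on the line. -/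
def submoduleH2D (hL : 0 < L) : Submodule ℝ (ℝ → ℝ) where
  carrier := {v | MemH2D L v}
  zero_mem' := memH2D_zero hL
  add_mem' {v w} hv hw := by
    have h := MemH2D.linComb hL hv hw 1 1
    have e : (fun x => 1 * v x + 1 * w x) = v + w := by ext x; simp
    rwa [e] at h
  smul_mem' c v hv := by
    have h := MemH2D.linComb hL hv hv c 0
    have e : (fun x => c * v x + 0 * v x) = c • v := by ext x; simp
    rwa [e] at h

/-- A functional on `H²_D(D)` that is nonnegative on the functions that are nonnegative on `[-r, r]`
is the integration against a finite measure. -/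
theorem exists_finiteMeasure_of_nonneg (hL : 0 < L) {r : ℝ} (hr0 : 0 < r) (hr : r < L)
    {ξ : (ℝ → ℝ) → ℝ} (hlin : ∀ v w a b, MemH2D L v → MemH2D L w →
      ξ (fun x => a * v x + b * w x) = a * ξ v + b * ξ w)
    (hpos : ∀ v, MemH2D L v → (∀ x, |x| ≤ r → 0 ≤ v x) → 0 ≤ ξ v) :
    ∃ μ : FiniteMeasure (dom L), ∀ v, MemH2D L v →
      ξ v = ∫ x : dom L, v x ∂(μ : Measure (dom L)) := by
  set K := Icc (-r) r with hK
  have hKd : K ⊆ dom L := fun x hx => ⟨by linarith [hx.1], by linarith [hx.2]⟩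
  let T : submoduleH2D hL →ₗ[ℝ] C(K, ℝ) :=
    { toFun := fun v => ⟨fun x => v.1 x, continuousOn_iff_continuous_domRestrict.1
        ((MemH2D.continuousOn v.2).mono (hKd.trans Ioo_subset_Icc_self))⟩
      map_add' := fun v w => by ext x; rfl
      map_smul' := fun c v => by ext x; rfl }
  let ξ' : submoduleH2D hL →ₗ[ℝ] ℝ :=
    { toFun := fun v => ξ v.1
      map_add' := fun v w => by
        have h := hlin v.1 w.1 1 1 v.2 w.2
        have e : (fun x => 1 * v.1 x + 1 * w.1 x) = (v + w).1 := by ext x; simp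
        rw [e] at h
        simpa using h
      map_smul' := fun c v => by
        have h := hlin v.1 v.1 c 0 v.2 v.2
        have e : (fun x => c * v.1 x + 0 * v.1 x) = (c • v).1 := by ext x; simp
        rw [e] at h
        simpa using h }
  have hpos' : ∀ v : submoduleH2D hL, 0 ≤ T v → 0 ≤ ξ' v := fun v hv =>
    hpos v.1 v.2 fun x hx => hv ⟨x, abs_le.1 hx⟩
  -- If v vanishes on [-r, r], then both v and -v are admissible in the positivity assumption. Hence
  -- ξ descends to the restrictions to [-r, r].
  have hker : LinearMap.ker T ≤ LinearMap.ker ξ' := fun v hv => by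
    rw [LinearMap.mem_ker] at hv ⊢
    refine le_antisymm ?_ (hpos' v hv.ge)
    have := hpos' (-v) (by rw [map_neg, hv, neg_zero])
    rw [map_neg] at this
    linarith
  let g : LinearMap.range T →ₗ[ℝ] ℝ :=
    ((LinearMap.ker T).liftQ ξ' hker).comp T.quotKerEquivRange.symm.toLinearMap
  have hg : ∀ (v : submoduleH2D hL) (h : T v ∈ LinearMap.range T), g ⟨T v, h⟩ = ξ' v := fun v h => by
    show (LinearMap.ker T).liftQ ξ' hker (T.quotKerEquivRange.symm ⟨T v, h⟩) = _
    rw [LinearMap.quotKerEquivRange_symm_apply_image]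
    rfl
  obtain ⟨χ, hχ, hχ1, hχr⟩ := exists_cutoff hr0 hr
  -- The extension theorem requires every continuous y to become nonnegative after adding some
  -- element of the range; ‖y‖χ serves because χ = 1 on K.
  obtain ⟨G, hG, hG0⟩ := riesz_extension (PointedCone.positive ℝ C(K, ℝ))
    (⟨LinearMap.range T, g⟩ : C(K, ℝ) →ₗ.[ℝ] ℝ)
    (by
      rintro ⟨_, v, rfl⟩ hx
      refine le_of_le_of_eq ?_ (hg v ⟨v, rfl⟩).symm
      exact hpos' v hx)
    (fun y => by
      refine ⟨⟨T (‖y‖ • ⟨χ, hχ.memH2D hL⟩), ⟨_, rfl⟩⟩, ?_⟩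
      show (0 : C(K, ℝ)) ≤ _
      intro x
      have h1 : χ x = 1 := hχr _ (abs_le.2 x.2)
      have h2 := y.norm_coe_le_norm x
      have h3 := neg_abs_le (y x)
      have h4 : 0 ≤ ‖y‖ * χ x + y x := by rw [h1, mul_one]; rw [Real.norm_eq_abs] at h2; linarith
      exact h4)
  obtain ⟨m, hm⟩ : ∃ m : FiniteMeasure K, ∀ f : C(K, ℝ), ∫ x, f x ∂(m : Measure K) = G f := by
    let Λ : CompactlySupportedContinuousMap K ℝ →ₚ[ℝ] ℝ :=
      { toFun := fun f => G f
        map_add' := fun f h => map_add G (f : C(K, ℝ)) (h : C(K, ℝ))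
        map_smul' := fun c f => map_smul G c (f : C(K, ℝ))
        monotone' := fun f h hfh => by
          have h0 := hG0 ((h : C(K, ℝ)) - (f : C(K, ℝ))) (show (0 : C(K, ℝ)) ≤ _ from fun x => by
            have := hfh x
            show 0 ≤ h x - f x
            linarith)
          rw [map_sub] at h0
          linarith }
    refine ⟨⟨RealRMK.rieszMeasure Λ, inferInstance⟩, fun f => ?_⟩
    exact RealRMK.integral_rieszMeasure Λ (CompactlySupportedContinuousMap.continuousMapEquiv f)
  have hi : Measurable (inclusion hKd) := (continuous_inclusion hKd).measurable
  refine ⟨⟨(m : Measure K).map (inclusion hKd), inferInstance⟩, fun v hv => ?_⟩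
  have hvc : Continuous fun x : dom L => v x :=
    continuousOn_iff_continuous_domRestrict.1 (hv.continuousOn.mono Ioo_subset_Icc_self)
  have e1 : ∫ x : dom L, v x ∂((m : Measure K).map (inclusion hKd)) = G (T ⟨v, hv⟩) := by
    rw [integral_map hi.aemeasurable hvc.aestronglyMeasurable, ← hm]
    rfl
  refine Eq.trans ?_ e1.symm
  exact ((hG ⟨T ⟨v, hv⟩, ⟨_, rfl⟩⟩).trans (hg ⟨v, hv⟩ _)).symm

/-- Cutoff functions that exhaust the interval. -/
theorem exists_cutoff_seq (hL : 0 < L) : ∃ χ : ℕ → ℝ → ℝ, (∀ n, IsTestFun (dom L) (χ n)) ∧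
    (∀ n x, 0 ≤ χ n x ∧ χ n x ≤ 1) ∧ ∀ r < L, ∀ᶠ n in atTop, ∀ x, |x| ≤ r → χ n x = 1 := by
  have h : ∀ n : ℕ, ∃ χ : ℝ → ℝ, IsTestFun (dom L) χ ∧ (∀ x, 0 ≤ χ x ∧ χ x ≤ 1) ∧
      ∀ x, |x| ≤ L * (1 - 1 / ((n : ℝ) + 2)) → χ x = 1 := fun n => by
    have h2 : (1 : ℝ) / ((n : ℝ) + 2) < 1 := by
      rw [div_lt_one (by positivity)]; linarith [(Nat.cast_nonneg n : (0 : ℝ) ≤ n)]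
    have h3 : (0 : ℝ) < 1 / ((n : ℝ) + 2) := by positivity
    exact exists_cutoff (mul_pos hL (by linarith)) (by nlinarith)
  choose χ h1 h2 h3 using h
  refine ⟨χ, h1, h2, fun r hr => ?_⟩
  have t : Tendsto (fun n : ℕ => L * (1 - 1 / ((n : ℝ) + 2))) atTop (𝓝 (L * (1 - 0))) := by
    refine ((tendsto_const_nhds).sub ?_).const_mul L
    exact tendsto_const_nhds.div_atTop
      (tendsto_atTop_add_const_right _ _ tendsto_natCast_atTop_atTop)
  rw [sub_zero, mul_one] at t
  filter_upwards [t.eventually_const_lt hr] with n hn x hx using h3 n x (hx.trans hn.le)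

theorem tendsto_integral_of_bdd {X : Type*} [MeasurableSpace X] {μ : Measure X} [IsFiniteMeasure μ]
    {f : ℕ → X → ℝ} {g : X → ℝ} {c : ℝ} (hf : ∀ n, AEStronglyMeasurable (f n) μ)
    (hb : ∀ n x, |f n x| ≤ c) (h : ∀ x, Tendsto (fun n => f n x) atTop (𝓝 (g x))) :
    Tendsto (fun n => ∫ x, f n x ∂μ) atTop (𝓝 (∫ x, g x ∂μ)) :=
  tendsto_integral_of_dominated_convergence (fun _ => c) hf (integrable_const _)
    (fun n => ae_of_all _ (hb n)) (ae_of_all _ h)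

theorem tendsto_integral_cutoff {χ : ℕ → ℝ → ℝ} (hχ : ∀ n, IsTestFun (dom L) (χ n))
    (hb : ∀ n x, 0 ≤ χ n x ∧ χ n x ≤ 1) (h1 : ∀ r < L, ∀ᶠ n in atTop, ∀ x, |x| ≤ r → χ n x = 1)
    (μ : FiniteMeasure (dom L)) :
    Tendsto (fun n => ∫ x : dom L, χ n x ∂(μ : Measure (dom L))) atTop (𝓝 (μ.mass : ℝ)) := by
  have h := tendsto_integral_of_bdd (μ := (μ : Measure (dom L))) (f := fun n (x : dom L) => χ n x)
    (g := fun _ => 1) (c := 1)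
    (fun n => ((hχ n).continuous.comp continuous_subtype_val).aestronglyMeasurable)
    (fun n x => abs_le.2 ⟨by linarith [(hb n x).1], (hb n x).2⟩) (fun x => by
      refine tendsto_const_nhds.congr' ?_
      filter_upwards [h1 |(x : ℝ)| (abs_lt.2 x.2)] with n hn using (hn x le_rfl).symm)
  rw [integral_const, smul_eq_mul, mul_one] at h
  exact h

/-- Two cutoffs equal to 1 on [-r, r] differ by a function that vanishes there, so ξ takes the same
value on both; along exhausting cutoffs these values tend to the mass. As μ is any representing
measure, its support need not be known. -/
theorem mass_eq_of_cutoff (hL : 0 < L) {r : ℝ} (hr : r < L)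
    {ξ : (ℝ → ℝ) → ℝ} (hlin : ∀ v w a b, MemH2D L v → MemH2D L w →
      ξ (fun x => a * v x + b * w x) = a * ξ v + b * ξ w)
    (hpos : ∀ v, MemH2D L v → (∀ x, |x| ≤ r → 0 ≤ v x) → 0 ≤ ξ v)
    {μ : FiniteMeasure (dom L)} (hμ : ∀ v, MemH2D L v →
      ξ v = ∫ x : dom L, v x ∂(μ : Measure (dom L)))
    {χ : ℝ → ℝ} (hχ : IsTestFun (dom L) χ) (hχr : ∀ x, |x| ≤ r → χ x = 1) : (μ.mass : ℝ) = ξ χ := by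
  obtain ⟨χ', h1, h2, h3⟩ := exists_cutoff_seq hL
  refine tendsto_nhds_unique (tendsto_integral_cutoff h1 h2 h3 μ) (tendsto_const_nhds.congr' ?_)
  filter_upwards [h3 r hr] with n hn
  rw [← hμ _ ((h1 n).memH2D hL)]
  have a1 := hpos _ (MemH2D.linComb hL (hχ.memH2D hL) ((h1 n).memH2D hL) 1 (-1)) fun x hx => by
    rw [hχr x hx, hn x hx]; norm_num
  have a2 := hpos _ (MemH2D.linComb hL (hχ.memH2D hL) ((h1 n).memH2D hL) (-1) 1) fun x hx => by
    rw [hχr x hx, hn x hx]; norm_num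
  rw [hlin _ _ _ _ (hχ.memH2D hL) ((h1 n).memH2D hL)] at a1 a2
  linarith

/-- The functions in `C₀(D)` are bounded pointwise limits of test functions. -/
theorem exists_testFun_tendsto (hL : 0 < L) (f : C₀(dom L, ℝ)) : ∃ (φ : ℕ → ℝ → ℝ) (c : ℝ),
    (∀ n, IsTestFun (dom L) (φ n)) ∧ (∀ n (x : dom L), |φ n x| ≤ c) ∧
    ∀ x : dom L, Tendsto (fun n => φ n x) atTop (𝓝 (f x)) := by
  classical
  obtain ⟨χ, h1, h2, h3⟩ := exists_cutoff_seq hL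
  set F : ℝ → ℝ := fun x => if h : x ∈ dom L then f ⟨x, h⟩ else 0 with hF
  have hFf : ∀ x : dom L, F x = f x := fun x => by simp only [hF]; rw [dif_pos x.2]
  have hFc : ContinuousOn F (dom L) := by
    rw [continuousOn_iff_continuous_domRestrict]
    convert f.continuous using 1
    ext x; exact hFf x
  -- Weierstrass approximation is needed only on a compact interval outside which the cutoff
  -- vanishes, since the polynomial is multiplied by it.
  have hp : ∀ n : ℕ, ∃ p : Polynomial ℝ, ∀ x ∈ dom L, χ n x ≠ 0 →
      |p.eval x - F x| < 1 / ((n : ℝ) + 1) := fun n => by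
    obtain ⟨R, -, hR, hR0⟩ := (h1 n).exists_radius hL
    obtain ⟨p, hp⟩ := exists_polynomial_near_of_continuousOn (-R) R F
      (hFc.mono fun x hx => ⟨by linarith [hx.1], by linarith [hx.2]⟩) (1 / ((n : ℝ) + 1))
      (by positivity)
    refine ⟨p, fun x _ hx0 => hp x (abs_le.1 ?_)⟩
    by_contra h
    push Not at h
    exact hx0 (hR0 x h)
  choose p hp using hp
  have hfb : ∀ x : dom L, |f x| ≤ ‖f.toBCF‖ := fun x => f.toBCF.norm_coe_le_norm x
  refine ⟨fun n x => (p n).eval x * χ n x, ‖f.toBCF‖ + 1,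
    fun n => (h1 n).smooth_mul (by
      simpa only [Polynomial.coe_aeval_eq_eval] using (p n).contDiff_aeval (𝕜 := ℝ) ∞), fun n x => ?_, fun x => ?_⟩
  · by_cases h0 : χ n x = 0
    · simp only [h0, mul_zero, abs_zero]; positivity
    · rw [abs_mul, abs_of_nonneg (h2 n x).1]
      have a1 := hp n x x.2 h0
      have a2 : (1 : ℝ) / ((n : ℝ) + 1) ≤ 1 := by
        rw [div_le_one (by positivity)]; linarith [(Nat.cast_nonneg n : (0 : ℝ) ≤ n)]
      have a3 := abs_sub_abs_le_abs_sub ((p n).eval (x : ℝ)) (F x)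
      have a4 := hfb x
      rw [← hFf] at a4
      calc |(p n).eval (x : ℝ)| * χ n x ≤ |(p n).eval (x : ℝ)| * 1 :=
            mul_le_mul_of_nonneg_left (h2 n x).2 (abs_nonneg _)
        _ ≤ _ := by linarith
  · rw [tendsto_iff_norm_sub_tendsto_zero]
    refine squeeze_zero' (Eventually.of_forall fun _ => norm_nonneg _) ?_
      (tendsto_one_div_add_atTop_nhds_zero_nat (𝕜 := ℝ))
    filter_upwards [h3 |(x : ℝ)| (abs_lt.2 x.2)] with n hn
    rw [hn x le_rfl, mul_one, ← hFf, Real.norm_eq_abs]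
    exact (hp n x x.2 (by rw [hn x le_rfl]; exact one_ne_zero)).le

end PositiveFunctionals

/-- The signed density f enters `exists_bv3_of_integral` as the difference of the positive measures
given by its positive and negative parts. -/
theorem integral_withDensity_toNNReal_sub {α : Type*} [MeasurableSpace α] {μ : Measure α}
    {f φ : α → ℝ} (hf : AEMeasurable f μ) (hfφ : Integrable (fun x => f x * φ x) μ) :
    ∫ x, φ x ∂(μ.withDensity fun x => ((f x).toNNReal : ℝ≥0∞))
      - ∫ x, φ x ∂(μ.withDensity fun x => ((-f x).toNNReal : ℝ≥0∞)) = ∫ x, f x * φ x ∂μ := by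
  have e : ∀ y : ℝ, (y.toNNReal : ℝ) - ((-y).toNNReal : ℝ) = y := fun y => by
    rcases le_total 0 y with h | h
    · rw [Real.coe_toNNReal _ h, Real.toNNReal_of_nonpos (by linarith)]; simp
    · rw [Real.coe_toNNReal _ (by linarith : 0 ≤ -y), Real.toNNReal_of_nonpos h]; simp
  have b : ∀ y : ℝ, ‖(y.toNNReal : ℝ)‖ ≤ ‖y‖ := fun y => by
    rw [Real.norm_of_nonneg (NNReal.coe_nonneg _), Real.coe_toNNReal', Real.norm_eq_abs]
    exact max_le (le_abs_self y) (abs_nonneg y)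
  by_cases hφ : AEStronglyMeasurable (fun x => f x * φ x) μ
  swap
  · exact absurd hfφ.1 hφ
  have m : ∀ h : ℝ → ℝ, Measurable h → (∀ y, ‖h y‖ ≤ ‖y‖) → (∀ y, h y = h y / y * y) →
      Integrable (fun x => h (f x) * φ x) μ := fun h hm hb hd => by
    refine hfφ.mono ?_ (ae_of_all _ fun x => ?_)
    · have : (fun x => h (f x) * φ x) = fun x => h (f x) / f x * (f x * φ x) := by
        ext x; rw [← mul_assoc, ← hd]
      rw [this]
      exact (((hm.comp_aemeasurable hf).div hf).aestronglyMeasurable).mul hφ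
    · rw [norm_mul, norm_mul]
      exact mul_le_mul_of_nonneg_right (hb _) (norm_nonneg _)
  have i1 := m (fun y => (y.toNNReal : ℝ)) (by fun_prop) b (fun y => by
    rcases eq_or_ne y 0 with rfl | h
    · simp
    · rw [div_mul_cancel₀ _ h])
  have i2 := m (fun y => ((-y).toNNReal : ℝ)) (by fun_prop)
    (fun y => (b (-y)).trans (norm_neg y).le) (fun y => by
    rcases eq_or_ne y 0 with rfl | h
    · simp
    · rw [div_mul_cancel₀ _ h])
  rw [integral_withDensity_eq_integral_smul₀ hf.real_toNNReal,
    integral_withDensity_eq_integral_smul₀ (f := fun x => (-f x).toNNReal) hf.neg.real_toNNReal]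
  refine (integral_sub i1 i2).symm.trans (integral_congr_ae (ae_of_all _ fun x => ?_))
  show ((f x).toNNReal : ℝ) * φ x - ((-f x).toNNReal : ℝ) * φ x = f x * φ x
  rw [← sub_mul, e]

theorem withDensity_toNNReal_univ_le {α : Type*} [MeasurableSpace α] {μ : Measure α}
    {f : α → ℝ} (hf : Integrable f μ) :
    (μ.withDensity fun x => ((f x).toNNReal : ℝ≥0∞)) univ ≤ ENNReal.ofReal (∫ x, |f x| ∂μ) := by
  rw [withDensity_apply _ MeasurableSet.univ, Measure.restrict_univ,
    ofReal_integral_eq_lintegral_ofReal hf.abs (ae_of_all _ fun x => abs_nonneg _)]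
  exact lintegral_mono fun x => ENNReal.ofReal_le_ofReal (le_abs_self _)

/-! ### The stationary problem at a fixed time. -/

namespace Data

variable {P : Data}

/-- The functional `w + β ∂ₓ⁴v - (τ + a‖∂ₓv‖₂²) ∂ₓ²v + g(v)` on `H²_D(D)`. -/
noncomputable def residual (P : Data) (w v φ : ℝ → ℝ) : ℝ :=
  (∫ x in dom P.L, w x * φ x)
    + P.β * (∫ x in dom P.L, dx P.L (dx P.L v) x * dx P.L (dx P.L φ) x)
    - (P.τ + P.a * P.sqNorm (dx P.L v)) * (∫ x in dom P.L, dx P.L (dx P.L v) x * φ x)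
    + ∫ x in dom P.L, P.force v x * φ x

theorem neg_zeta (u : ℝ → ℝ → ℝ) (t : ℝ) (φ : ℝ → ℝ) :
    -P.zeta u t φ = P.residual (timeDeriv P.L u t) (u t) φ := by
  rw [zeta, residual]; ring

theorem integral_linComb {α : Type*} [MeasurableSpace α] {μ : Measure α} {h f g k : α → ℝ}
    {a b : ℝ} (hk : k =ᵐ[μ] fun x => a * f x + b * g x)
    (hf : Integrable (fun x => h x * f x) μ) (hg : Integrable (fun x => h x * g x) μ) :
    ∫ x, h x * k x ∂μ = a * (∫ x, h x * f x ∂μ) + b * ∫ x, h x * g x ∂μ := by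
  rw [← integral_const_mul, ← integral_const_mul, ← integral_add (hf.const_mul a) (hg.const_mul b)]
  refine integral_congr_ae ?_
  filter_upwards [hk] with x hx
  rw [hx]; ring

theorem residual_linComb (hL : 0 < P.L) {w v : ℝ → ℝ}
    (hw : MemLp w 2 (volume.restrict (dom P.L))) (hv : MemH2D P.L v)
    (hF : ∀ φ, MemH2D P.L φ → IntegrableOn (fun x => P.force v x * φ x) (dom P.L))
    (φ ψ : ℝ → ℝ) (a b : ℝ) (hφ : MemH2D P.L φ) (hψ : MemH2D P.L ψ) :
    P.residual w v (fun x => a * φ x + b * ψ x) = a * P.residual w v φ + b * P.residual w v ψ := by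
  have h2 := (hφ.1.linComb hψ.1 a b).2 2 le_rfl
  have hv2 : MemLp (dx P.L (dx P.L v)) 2 (volume.restrict (dom P.L)) := hv.1.1 2 le_rfl
  have L0 : ∀ {f}, MemH2D P.L f → MemLp f 2 (volume.restrict (dom P.L)) := fun hf =>
    hf.1.1 0 (by norm_num)
  have L2 : ∀ {f}, MemH2D P.L f → MemLp (dx P.L (dx P.L f)) 2 (volume.restrict (dom P.L)) :=
    fun hf => hf.1.1 2 le_rfl
  simp only [residual]
  rw [integral_linComb (h := w) ae_eq_rfl (integrable_mul_of_memLp hw (L0 hφ))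
      (integrable_mul_of_memLp hw (L0 hψ)),
    integral_linComb (h := dx P.L (dx P.L v)) (k := dx P.L (dx P.L fun x => a * φ x + b * ψ x))
      (f := dx P.L (dx P.L φ)) (g := dx P.L (dx P.L ψ)) h2
      (integrable_mul_of_memLp hv2 (L2 hφ)) (integrable_mul_of_memLp hv2 (L2 hψ)),
    integral_linComb (h := dx P.L (dx P.L v)) (f := φ) (g := ψ) ae_eq_rfl
      (integrable_mul_of_memLp hv2 (L0 hφ)) (integrable_mul_of_memLp hv2 (L0 hψ)),
    integral_linComb (h := P.force v) (f := φ) (g := ψ) ae_eq_rfl (hF φ hφ) (hF ψ hψ)]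
  ring

/-- Close to the boundary of `D`, the elastic plate is far from the lower one. -/
theorem exists_radius (hP : P.Admissible) (ρ : ℝ) : ∃ r, 0 < r ∧ r < P.L ∧
    ∀ v, P.MemSbar v → l2 P.L (dx P.L (dx P.L v)) ≤ ρ →
      ∀ x ∈ dom P.L, r < |x| → -P.H / 8 ≤ v x := by
  have hL := hP.L_pos
  have hH := hP.H_pos
  set V := √(2 * P.L) * |ρ| with hV
  have hV0 : 0 ≤ V := by positivity
  have hq : 0 < P.H / (8 * (V + 1)) := by positivity
  -- Since |v(x)| ≤ V(L - |x|), the second entry ensures |v| ≤ H/8 for |x| > r; the first keeps r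
  -- positive.
  refine ⟨max (P.L / 2) (P.L - P.H / (8 * (V + 1))), lt_max_of_lt_left (by linarith),
    max_lt (by linarith) (by linarith), fun v hv hρ x hx hxr => ?_⟩
  have h1 := hv.1.abs_apply_le hL (hρ.trans (le_abs_self ρ)) (Ioo_subset_Icc_self hx)
  have h2 : P.L - |x| ≤ P.H / (8 * (V + 1)) := by
    linarith [le_max_right (P.L / 2) (P.L - P.H / (8 * (V + 1)))]
  have h3 : V * (P.L - |x|) ≤ V * (P.H / (8 * (V + 1))) := mul_le_mul_of_nonneg_left h2 hV0
  have h4 : V * (P.H / (8 * (V + 1))) ≤ P.H / 8 := by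
    rw [mul_div_assoc', div_le_div_iff₀ (by positivity) (by norm_num)]
    nlinarith
  have h5 := neg_abs_le (v x)
  linarith

/-- For small ε > 0 the function v + εφ is an admissible competitor: on [-r, r] it is at least v,
and elsewhere the distance of v from the obstacle absorbs εφ, whatever its sign. -/
theorem residual_nonneg (hP : P.Admissible) {w v : ℝ → ℝ}
    (hw : MemLp w 2 (volume.restrict (dom P.L))) (hv : P.MemSbar v)
    (hF : ∀ φ, MemH2D P.L φ → IntegrableOn (fun x => P.force v x * φ x) (dom P.L))
    (hs : P.MemSubdiff (fun φ => -P.residual w v φ) v) {r : ℝ}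
    (hr : ∀ x ∈ dom P.L, r < |x| → -P.H / 8 ≤ v x) (φ : ℝ → ℝ) (hφ : MemH2D P.L φ)
    (hφ0 : ∀ x, |x| ≤ r → 0 ≤ φ x) : 0 ≤ P.residual w v φ := by
  have hL := hP.L_pos
  have hH := hP.H_pos
  obtain ⟨c, hc⟩ := isCompact_Icc.exists_bound_of_continuousOn hφ.continuousOn
  -- This choice gives ε|φ| ≤ H/2, less than the available distance 7H/8; the summand 1 avoids
  -- division by zero.
  set ε := P.H / (2 * (|c| + 1)) with hε
  have hε0 : 0 < ε := by positivity
  have hεc : ε * |c| ≤ P.H / 2 := by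
    rw [hε, div_mul_eq_mul_div, div_le_div_iff₀ (by positivity) (by norm_num)]
    nlinarith [abs_nonneg c]
  have hmem : P.MemSbar (fun x => 1 * v x + ε * φ x) := by
    refine ⟨hv.1.linComb hL hφ 1 ε, fun x hx => ?_⟩
    show -P.H ≤ 1 * v x + ε * φ x
    rw [one_mul]
    rcases le_or_gt |x| r with h | h
    · have := mul_nonneg hε0.le (hφ0 x h)
      linarith [hv.2 x hx]
    · have h1 := hr x hx h
      have h2 : |φ x| ≤ |c| := (hc x (Ioo_subset_Icc_self hx)).trans (le_abs_self c)
      have h3 : ε * (-|c|) ≤ ε * φ x :=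
        mul_le_mul_of_nonneg_left ((neg_le_neg h2).trans (neg_abs_le _)) hε0.le
      linarith
  have h := hs _ hmem
  have e : (fun x => 1 * v x + ε * φ x) - v = fun x => ε * φ x + 0 * φ x := by
    ext x; simp
  simp only [e] at h
  rw [residual_linComb hL hw hv.1 hF _ _ _ _ hφ hφ, zero_mul, add_zero] at h
  exact nonneg_of_mul_nonneg_right (by linarith : 0 ≤ ε * P.residual w v φ) hε0

/-- The products of the force with exhausting cutoffs are measurable because they are integrable,
and they converge to the force. -/
theorem aestronglyMeasurable_force (hL : 0 < P.L) {v : ℝ → ℝ}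
    (hF : ∀ φ, MemH2D P.L φ → IntegrableOn (fun x => P.force v x * φ x) (dom P.L)) :
    AEStronglyMeasurable (P.force v) (volume.restrict (dom P.L)) := by
  obtain ⟨χ, h1, h2, h3⟩ := exists_cutoff_seq hL
  refine aestronglyMeasurable_of_tendsto_ae atTop (fun n => (hF _ ((h1 n).memH2D hL)).1) ?_
  filter_upwards [ae_restrict_mem measurableSet_Ioo] with x hx
  refine tendsto_const_nhds.congr' ?_
  filter_upwards [h3 |x| (abs_lt.2 hx)] with n hn
  rw [hn x le_rfl, mul_one]

theorem abs_integral_mul_bdd_le {L : ℝ} (hL : 0 < L) {f φ : ℝ → ℝ}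
    (hf : MemLp f 2 (volume.restrict (dom L))) {X : ℝ} (hX : 0 ≤ X)
    (hφ : ∀ᵐ x ∂volume.restrict (dom L), |φ x| ≤ X) :
    |∫ x in dom L, f x * φ x| ≤ X * (√(2 * L) * l2 L f) := by
  have h1 : |∫ x in dom L, f x * φ x| ≤ ∫ x in dom L, X * |f x| := by
    rw [← Real.norm_eq_abs]
    refine norm_integral_le_of_norm_le ((integrableOn_of_memLp hf).abs.const_mul X) ?_
    filter_upwards [hφ] with x hx
    rw [norm_mul, mul_comm]
    exact mul_le_mul_of_nonneg_right hx (norm_nonneg _)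
  rw [integral_const_mul] at h1
  exact h1.trans (mul_le_mul_of_nonneg_left (integral_abs_le_l2 hL hf) hX)

theorem l2_nonneg (L : ℝ) (g : ℝ → ℝ) : 0 ≤ l2 L g := ENNReal.toReal_nonneg

/-- The coefficient of the second derivative is bounded in terms of the `H²`-norm. -/
theorem coeff_bounds (hP : P.Admissible) {v : ℝ → ℝ} (hv : MemH2D P.L v) {ρ : ℝ}
    (hρ : l2 P.L (dx P.L (dx P.L v)) ≤ ρ) :
    |P.τ + P.a * P.sqNorm (dx P.L v)| ≤ P.τ + P.a * (2 * P.L * (√(2 * P.L) * ρ) ^ 2) := by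
  have hL := hP.L_pos
  obtain ⟨v', hv'c, -, hdv, hv'b, -⟩ := hv.structure hL
  have h0 : 0 ≤ P.sqNorm (dx P.L v) := integral_nonneg fun x => sq_nonneg _
  have h1 : P.sqNorm (dx P.L v) ≤ 2 * P.L * (√(2 * P.L) * ρ) ^ 2 := by
    have hb : ∀ᵐ x ∂volume.restrict (dom P.L), ‖dx P.L v x ^ 2‖ ≤ (√(2 * P.L) * ρ) ^ 2 := by
      filter_upwards [hdv] with x hx
      rw [Real.norm_of_nonneg (sq_nonneg _), hx, ← sq_abs]
      refine pow_le_pow_left₀ (abs_nonneg _) ((hv'b x).trans ?_) 2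
      gcongr
    have h2 := norm_setIntegral_le_of_norm_le_const_ae (μ := volume) (s := dom P.L)
      (by simp) hb
    refine (le_abs_self _).trans (h2.trans (le_of_eq ?_))
    rw [Measure.real, Real.volume_Ioo, ENNReal.toReal_ofReal (by linarith)]; ring
  have := hP.τ_nonneg
  have := hP.a_nonneg
  rw [abs_of_nonneg (by positivity)]
  gcongr

/-- The total electrostatic force is finite. -/
theorem exists_integral_force_le (hP : P.Admissible) {ρ r : ℝ} (hρ0 : 0 ≤ ρ)
    (hr : ∀ v, P.MemSbar v → l2 P.L (dx P.L (dx P.L v)) ≤ ρ →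
      ∀ x ∈ dom P.L, r < |x| → -P.H / 8 ≤ v x)
    {χ : ℝ → ℝ} (hχ : IsTestFun (dom P.L) χ) (hχ1 : ∀ x, 0 ≤ χ x ∧ χ x ≤ 1)
    (hχr : ∀ x, |x| ≤ r → χ x = 1) : ∃ C, 0 ≤ C ∧ ∀ v w, P.MemSbar v →
      l2 P.L (dx P.L (dx P.L v)) ≤ ρ → MemLp w 2 (volume.restrict (dom P.L)) →
      (∀ φ, MemH2D P.L φ → IntegrableOn (fun x => P.force v x * φ x) (dom P.L)) →
      IntegrableOn (P.force v) (dom P.L) ∧ ∫ x in dom P.L, P.force v x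
        ≤ C * (1 + l2 P.L w + |P.residual w v χ|) := by
  have hL := hP.L_pos
  obtain ⟨Cf, hCf, hforce⟩ := exists_lintegral_force_le hP ρ
  obtain ⟨X, hX⟩ := hχ.deriv.deriv.continuous.bounded_above_of_compact_support hχ.deriv.deriv.2.1
  have hX0 : 0 ≤ X := (norm_nonneg _).trans (hX 0)
  set cρ := P.τ + P.a * (2 * P.L * (√(2 * P.L) * ρ) ^ 2) with hcρ
  have hτ := hP.τ_nonneg
  have ha := hP.a_nonneg
  have hβ := hP.β_pos
  have hcρ0 : 0 ≤ cρ := by positivity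
  set V := √(2 * P.L) * ρ with hV
  have hV0 : 0 ≤ V := by positivity
  set C := Cf + 1 + √(2 * P.L) + P.β * (X * V) + cρ * V with hC
  refine ⟨C, by positivity, fun v w hv hρ hw hF => ?_⟩
  have hv2 : MemLp (dx P.L (dx P.L v)) 2 (volume.restrict (dom P.L)) := hv.1.1.1 2 le_rfl
  have hχb : ∀ᵐ x ∂volume.restrict (dom P.L), |χ x| ≤ 1 :=
    ae_of_all _ fun x => abs_le.2 ⟨by linarith [(hχ1 x).1], (hχ1 x).2⟩
  have b1 := abs_integral_mul_bdd_le hL hw zero_le_one hχb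
  have b2 := abs_integral_mul_bdd_le hL hv2 zero_le_one hχb
  have b3 := abs_integral_mul_bdd_le hL hv2 (φ := dx P.L (dx P.L χ)) hX0 (by
    filter_upwards [hχ.dx_iterate 2] with x hx
    have hx' : dx P.L (dx P.L χ) x = deriv (deriv χ) x := hx
    rw [hx']; exact hX x)
  have b4 := coeff_bounds hP hv.1 hρ
  have b5 : |(P.τ + P.a * P.sqNorm (dx P.L v)) * ∫ x in dom P.L, dx P.L (dx P.L v) x * χ x|
      ≤ cρ * V := by
    rw [abs_mul]
    refine mul_le_mul b4 (b2.trans ?_) (abs_nonneg _) hcρ0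
    rw [one_mul, hV]; gcongr
  have b6 : |P.β * ∫ x in dom P.L, dx P.L (dx P.L v) x * dx P.L (dx P.L χ) x|
      ≤ P.β * (X * V) := by
    rw [abs_mul, abs_of_pos hβ]
    refine mul_le_mul_of_nonneg_left (b3.trans ?_) hβ.le
    rw [hV]; gcongr
  -- Where contact is possible the trace estimate gives no control, and the force is bounded through
  -- the equation tested with χ.
  have hG : ∫ x in dom P.L, P.force v x * χ x
      ≤ |P.residual w v χ| + √(2 * P.L) * l2 P.L w + P.β * (X * V) + cρ * V := by
    have e : ∫ x in dom P.L, P.force v x * χ x = P.residual w v χ - (∫ x in dom P.L, w x * χ x)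
        - P.β * (∫ x in dom P.L, dx P.L (dx P.L v) x * dx P.L (dx P.L χ) x)
        + (P.τ + P.a * P.sqNorm (dx P.L v)) * ∫ x in dom P.L, dx P.L (dx P.L v) x * χ x := by
      rw [residual]; ring
    rw [e]
    have := le_abs_self (P.residual w v χ)
    have := (abs_le.1 b1).1
    have := (abs_le.1 b6).1
    have := (abs_le.1 b5).2
    linarith
  have hlw : 0 ≤ l2 P.L w := l2_nonneg _ _
  have hlr : 0 ≤ |P.residual w v χ| := abs_nonneg _
  have hl : ∫⁻ x in dom P.L, ENNReal.ofReal (P.force v x)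
      ≤ ENNReal.ofReal (C * (1 + l2 P.L w + |P.residual w v χ|)) := by
    have hAm := measurableSet_dom_inter (L := P.L) hv.1.continuousOn (-P.H / 8)
    -- D is split at v = -H/8. Points with v < -H/8 lie in [-r, r], where χ = 1, and there the force
    -- is at most the nonnegative product of force and cutoff.
    rw [← lintegral_inter_add_sdiff (μ := volume) (fun x => ENNReal.ofReal (P.force v x)) (dom P.L)
      hAm]
    have h1 : ∫⁻ x in dom P.L ∩ (dom P.L ∩ v ⁻¹' Ici (-P.H / 8)), ENNReal.ofReal (P.force v x)
        ≤ ENNReal.ofReal Cf :=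
      (lintegral_mono_set inter_subset_right).trans (hforce v hv hρ)
    have h2 : ∫⁻ x in dom P.L \ (dom P.L ∩ v ⁻¹' Ici (-P.H / 8)), ENNReal.ofReal (P.force v x)
        ≤ ENNReal.ofReal (∫ x in dom P.L, P.force v x * χ x) := by
      rw [ofReal_integral_eq_lintegral_ofReal (hF _ (hχ.memH2D hL))
        (ae_of_all _ fun x => mul_nonneg (force_nonneg hP v x) (hχ1 x).1)]
      refine le_trans ?_ (lintegral_mono_set (sdiff_subset (t := dom P.L ∩ v ⁻¹' Ici (-P.H / 8))))
      refine setLIntegral_mono' (measurableSet_Ioo.diff hAm) fun x hx => ?_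
      have hxr : |x| ≤ r := by
        by_contra h
        push Not at h
        exact hx.2 ⟨hx.1, hr v hv hρ x hx.1 h⟩
      rw [hχr x hxr, mul_one]
    refine (add_le_add h1 h2).trans ?_
    rw [← ENNReal.ofReal_add hCf (integral_nonneg fun x =>
      mul_nonneg (force_nonneg hP v x) (hχ1 x).1)]
    refine ENNReal.ofReal_le_ofReal ((add_le_add_right hG _).trans ?_)
    have k1 : 0 ≤ √(2 * P.L) := Real.sqrt_nonneg _
    have k2 : 0 ≤ P.β * (X * V) := by positivity
    have k3 : 0 ≤ cρ * V := by positivity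
    have k4 : C * (1 + l2 P.L w + |P.residual w v χ|) = C + C * l2 P.L w + C * |P.residual w v χ| := by
      ring
    have k5 : √(2 * P.L) * l2 P.L w ≤ C * l2 P.L w :=
      mul_le_mul_of_nonneg_right (by linarith) hlw
    have k6 : 1 * |P.residual w v χ| ≤ C * |P.residual w v χ| :=
      mul_le_mul_of_nonneg_right (by linarith) hlr
    linarith
  have hm := aestronglyMeasurable_force hL hF
  have hi : IntegrableOn (P.force v) (dom P.L) := by
    refine ⟨hm, (hasFiniteIntegral_iff_ofReal (ae_of_all _ fun x => force_nonneg hP v x)).2 ?_⟩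
    exact hl.trans_lt ENNReal.ofReal_lt_top
  refine ⟨hi, ?_⟩
  rw [← ofReal_integral_eq_lintegral_ofReal hi (ae_of_all _ fun x => force_nonneg hP v x)] at hl
  exact (ENNReal.ofReal_le_ofReal_iff (by positivity)).1 hl

/-- Regularity for the stationary problem with a measure as obstacle reaction. -/
theorem exists_bv3_of_residual (hP : P.Admissible) {ρ r : ℝ} (hρ0 : 0 ≤ ρ)
    (hr : ∀ v, P.MemSbar v → l2 P.L (dx P.L (dx P.L v)) ≤ ρ →
      ∀ x ∈ dom P.L, r < |x| → -P.H / 8 ≤ v x)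
    {χ : ℝ → ℝ} (hχ : IsTestFun (dom P.L) χ) (hχ1 : ∀ x, 0 ≤ χ x ∧ χ x ≤ 1)
    (hχr : ∀ x, |x| ≤ r → χ x = 1) : ∃ C, 0 ≤ C ∧ ∀ v w (μ : FiniteMeasure (dom P.L)), P.MemSbar v →
      l2 P.L (dx P.L (dx P.L v)) ≤ ρ → MemLp w 2 (volume.restrict (dom P.L)) →
      (∀ φ, MemH2D P.L φ → IntegrableOn (fun x => P.force v x * φ x) (dom P.L)) →
      (∀ φ, MemH2D P.L φ → P.residual w v φ = ∫ x : dom P.L, φ x ∂(μ : Measure (dom P.L))) →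
      (μ.mass : ℝ) = P.residual w v χ →
      BV3 P.L (C * (1 + l2 P.L w + |P.residual w v χ|)) v := by
  have hL := hP.L_pos
  obtain ⟨C₁, hC₁, hforce⟩ := exists_integral_force_le hP hρ0 hr hχ hχ1 hχr
  obtain ⟨C₀, hC₀, hbv⟩ := exists_bv3_of_integral hL
  set cρ := P.τ + P.a * (2 * P.L * (√(2 * P.L) * ρ) ^ 2) with hcρ
  have hτ := hP.τ_nonneg
  have ha := hP.a_nonneg
  have hβ := hP.β_pos
  have hcρ0 : 0 ≤ cρ := by positivity
  set V := √(2 * P.L) * ρ with hV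
  have hV0 : 0 ≤ V := by positivity
  set C₂ := P.β⁻¹ * (√(2 * P.L) + cρ * V + C₁ + 1) with hC₂
  refine ⟨C₀ * (ρ + C₂), by positivity, fun v w μ hv hρ hw hF hμ hmass => ?_⟩
  obtain ⟨hgi, hgb⟩ := hforce v w hv hρ hw hF
  set A := 1 + l2 P.L w + |P.residual w v χ| with hA
  have hlw : 0 ≤ l2 P.L w := l2_nonneg _ _
  have hlr : 0 ≤ |P.residual w v χ| := abs_nonneg _
  have hA1 : 1 ≤ A := by linarith
  have hv2 : MemLp (dx P.L (dx P.L v)) 2 (volume.restrict (dom P.L)) := hv.1.1.1 2 le_rfl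
  set c := P.τ + P.a * P.sqNorm (dx P.L v) with hc
  have hcb : |c| ≤ cρ := coeff_bounds hP hv.1 hρ
  have iw := integrableOn_of_memLp hw
  have iv := integrableOn_of_memLp hv2
  -- The equation reads β∂ₓ⁴v = μ + f with f in L₁(D).
  set f : ℝ → ℝ := fun x => c * dx P.L (dx P.L v) x - w x - P.force v x with hf
  have hfi : IntegrableOn f (dom P.L) := ((iv.const_mul c).sub iw).sub hgi
  have hfb : ∫ x in dom P.L, |f x| ≤ (√(2 * P.L) + cρ * V + C₁) * A := by
    have i1 : IntegrableOn (fun x => |c| * |dx P.L (dx P.L v) x| + |w x| + P.force v x) (dom P.L) :=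
      ((iv.abs.const_mul _).add iw.abs).add hgi
    have h1 : ∫ x in dom P.L, |f x|
        ≤ ∫ x in dom P.L, (|c| * |dx P.L (dx P.L v) x| + |w x| + P.force v x) := by
      refine integral_mono hfi.abs i1 fun x => ?_
      show |c * dx P.L (dx P.L v) x - w x - P.force v x| ≤ _
      refine (abs_sub _ _).trans (add_le_add ((abs_sub _ _).trans (add_le_add ?_ le_rfl)) ?_)
      · rw [abs_mul]
      · rw [abs_of_nonneg (force_nonneg hP v x)]
    have i2 : IntegrableOn (fun x => |c| * |dx P.L (dx P.L v) x| + |w x|) (dom P.L) :=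
      (iv.abs.const_mul _).add iw.abs
    rw [integral_add i2 hgi, integral_add (iv.abs.const_mul _) iw.abs, integral_const_mul] at h1
    have h2 := integral_abs_le_l2 hL hv2
    have h3 := integral_abs_le_l2 hL hw
    have h4 : |c| * ∫ x in dom P.L, |dx P.L (dx P.L v) x| ≤ cρ * V :=
      mul_le_mul hcb (h2.trans (by rw [hV]; gcongr)) (integral_nonneg fun _ => abs_nonneg _) hcρ0
    have h5 : cρ * V ≤ cρ * V * A := le_mul_of_one_le_right (by positivity) hA1
    have h6 : √(2 * P.L) * l2 P.L w ≤ √(2 * P.L) * A :=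
      mul_le_mul_of_nonneg_left (by linarith) (Real.sqrt_nonneg _)
    calc _ ≤ _ := h1
      _ ≤ cρ * V * A + √(2 * P.L) * A + C₁ * A :=
        add_le_add (add_le_add (h4.trans h5) (h3.trans h6)) hgb
      _ = _ := by ring
  set D := volume.restrict (dom P.L) with hD
  set ν₁ := D.withDensity fun x => ((f x).toNNReal : ℝ≥0∞) with hν₁
  set ν₂ := D.withDensity fun x => ((-f x).toNNReal : ℝ≥0∞) with hν₂
  have n₁ : ν₁ univ ≤ ENNReal.ofReal ((√(2 * P.L) + cρ * V + C₁) * A) :=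
    (withDensity_toNNReal_univ_le hfi).trans (ENNReal.ofReal_le_ofReal hfb)
  have n₂ : ν₂ univ ≤ ENNReal.ofReal ((√(2 * P.L) + cρ * V + C₁) * A) := by
    refine (withDensity_toNNReal_univ_le (f := fun x => -f x) hfi.neg).trans
      (ENNReal.ofReal_le_ofReal ?_)
    simpa only [abs_neg] using hfb
  have : IsFiniteMeasure ν₁ := ⟨n₁.trans_lt ENNReal.ofReal_lt_top⟩
  have : IsFiniteMeasure ν₂ := ⟨n₂.trans_lt ENNReal.ofReal_lt_top⟩
  set ν₃ := (μ : Measure (dom P.L)).map ((↑) : dom P.L → ℝ) with hν₃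
  have n₃ : ν₃.real univ ≤ A := by
    have e : ν₃.real univ = (μ.mass : ℝ) := by
      rw [Measure.real, hν₃, Measure.map_apply measurable_subtype_coe MeasurableSet.univ]; rfl
    rw [e, hmass]
    linarith [le_abs_self (P.residual w v χ)]
  set b := (P.β⁻¹).toNNReal with hb
  have hbc : (b : ℝ) = P.β⁻¹ := Real.coe_toNNReal _ (by positivity)
  have n₁' : ν₁.real univ ≤ (√(2 * P.L) + cρ * V + C₁) * A :=
    ENNReal.toReal_le_of_le_ofReal (by positivity) n₁
  have n₂' : ν₂.real univ ≤ (√(2 * P.L) + cρ * V + C₁) * A :=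
    ENNReal.toReal_le_of_le_ofReal (by positivity) n₂
  have hsum : C₂ * A = P.β⁻¹ * ((√(2 * P.L) + cρ * V + C₁) * A + A) := by rw [hC₂]; ring
  -- After division by β, the measure μ joins the positive part of f, and the negative part forms
  -- the second measure.
  refine (hbv v (C₂ * A) (b • (ν₁ + ν₃)) (b • ν₂) hv.1 ?_ ?_ fun φ hφ => ?_).mono ?_
  · rw [measureReal_nnreal_smul_apply, measureReal_add_apply, hbc, hsum]
    exact mul_le_mul_of_nonneg_left (add_le_add n₁' n₃) (by positivity)
  · rw [measureReal_nnreal_smul_apply, hbc, hsum]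
    exact mul_le_mul_of_nonneg_left (by linarith) (by positivity)
  · have hφD := hφ.memH2D hL
    have iφ : ∀ κ : Measure ℝ, IsFiniteMeasure κ → Integrable φ κ := fun κ _ =>
      hφ.continuous.integrable_of_hasCompactSupport hφ.2.1
    obtain ⟨B, hB⟩ := hφ.continuous.bounded_above_of_compact_support hφ.2.1
    have im : ∀ {h : ℝ → ℝ}, IntegrableOn h (dom P.L) → Integrable (fun x => h x * φ x) D :=
      fun hh => hh.mul_bdd hφ.continuous.aestronglyMeasurable (ae_of_all _ hB)
    have e3 : ∫ x, φ x ∂ν₃ = ∫ x : dom P.L, φ x ∂(μ : Measure (dom P.L)) :=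
      integral_map measurable_subtype_coe.aemeasurable hφ.continuous.aestronglyMeasurable
    have e4 := integral_withDensity_toNNReal_sub (μ := D) hfi.1.aemeasurable (im hfi)
    have e5 : ∫ x, f x * φ x ∂D = c * (∫ x in dom P.L, dx P.L (dx P.L v) x * φ x)
        - (∫ x in dom P.L, w x * φ x) - ∫ x in dom P.L, P.force v x * φ x := by
      have j1 : Integrable (fun x => c * (dx P.L (dx P.L v) x * φ x)) D := (im iv).const_mul c
      have j2 : Integrable (fun x => c * (dx P.L (dx P.L v) x * φ x) - w x * φ x) D :=
        j1.sub (im iw)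
      rw [← integral_const_mul, ← integral_sub j1 (im iw), ← integral_sub j2 (im hgi)]
      refine integral_congr_ae (ae_of_all _ fun x => ?_)
      simp only [hf]; ring
    have e6 := hμ φ hφD
    rw [residual] at e6
    have e7 : ∫ x in dom P.L, dx P.L (dx P.L v) x * dx P.L (dx P.L φ) x
        = ∫ x in dom P.L, dx P.L (dx P.L v) x * deriv (deriv φ) x := by
      refine integral_congr_ae ?_
      filter_upwards [hφ.dx_iterate 2] with x hx
      have hx' : dx P.L (dx P.L φ) x = deriv (deriv φ) x := hx
      rw [hx']
    rw [e7, ← e3, ← hc] at e6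
    rw [e5] at e4
    rw [integral_smul_nnreal_measure, integral_smul_nnreal_measure,
      integral_add_measure (iφ _ inferInstance) (iφ _ inferInstance), NNReal.smul_def,
      NNReal.smul_def, hbc, smul_eq_mul, smul_eq_mul, ← mul_sub, eq_inv_mul_iff_mul_eq₀ hβ.ne']
    linarith
  · have h1 : C₀ * (l2 P.L (dx P.L (dx P.L v)) + C₂ * A) ≤ C₀ * (ρ * A + C₂ * A) := by
      refine mul_le_mul_of_nonneg_left (add_le_add ?_ le_rfl) hC₀.le
      exact hρ.trans (le_mul_of_one_le_right hρ0 hA1)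
    refine h1.trans (le_of_eq ?_)
    ring

end Data

/-! ### L₂-valued functions of time and the dual norm. -/

theorem memHk_zero_iff {L : ℝ} {v : ℝ → ℝ} :
    MemHk L 0 v ↔ MemLp v 2 (volume.restrict (dom L)) := by
  constructor
  · exact fun h => h.1 0 le_rfl
  · intro h
    refine ⟨fun j hj => ?_, fun j hj => absurd hj (Nat.not_lt_zero j)⟩
    obtain rfl : j = 0 := Nat.le_zero.1 hj
    exact h

theorem normH_zero {L : ℝ} {v : ℝ → ℝ} (hv : MemLp v 2 (volume.restrict (dom L))) :
    normH L 0 v = eLpNorm v 2 (volume.restrict (dom L)) := by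
  have h := normH_sq (L := L) (s := 0) (v := v) (by simpa using memHk_zero_iff.2 hv)
  simp only [Nat.floor_zero, zero_add, Finset.range_one, Finset.sum_singleton,
    Function.iterate_zero, id_eq, Int.fract_zero, gagliardoSq_zero, add_zero] at h
  exact (ENNReal.pow_right_strictMono two_ne_zero).injective h

theorem memLp_of_normH_zero_lt_top {L : ℝ} {v : ℝ → ℝ} (h : normH L 0 v < ⊤) :
    MemLp v 2 (volume.restrict (dom L)) := by
  by_contra hv
  rw [normH, if_neg (by simpa using fun h' => hv (memHk_zero_iff.1 h'))] at h
  exact lt_irrefl _ h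

theorem eLpNorm_le_normH_zero {L : ℝ} (v : ℝ → ℝ) :
    eLpNorm v 2 (volume.restrict (dom L)) ≤ normH L 0 v := by
  by_cases hv : MemLp v 2 (volume.restrict (dom L))
  · exact (normH_zero hv).ge
  · rw [normH, if_neg (by simpa using fun h' => hv (memHk_zero_iff.1 h'))]
    exact le_top

/-- Strongly measurable functions with values in `L₂(D)` have measurable norms. -/
theorem StronglyMeas.aemeasurable_l2 {L : ℝ} {w : ℝ → ℝ → ℝ} (hw : StronglyMeas (normH L 0) w) :
    (∀ᵐ t ∂volume.restrict (Ioi (0 : ℝ)), MemLp (w t) 2 (volume.restrict (dom L))) ∧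
    AEMeasurable (fun t => l2 L (w t)) (volume.restrict (Ioi 0)) := by
  obtain ⟨W, hW, hlim⟩ := hw
  have hWm : ∀ n t, MemLp (W n t) 2 (volume.restrict (dom L)) :=
    fun n t => memLp_of_normH_zero_lt_top (hW n t)
  have hmem : ∀ᵐ t ∂volume.restrict (Ioi (0 : ℝ)), MemLp (w t) 2 (volume.restrict (dom L)) := by
    filter_upwards [hlim] with t ht
    obtain ⟨n, hn⟩ := (ht.eventually_lt_const ENNReal.zero_lt_top).exists
    have h := (hWm n t).sub (memLp_of_normH_zero_lt_top hn)
    rwa [sub_sub_cancel] at h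
  refine ⟨hmem, aemeasurable_of_tendsto_metrizable_ae atTop
    (f := fun n t => l2 L (W n t)) (fun n => ((W n).map (l2 L)).measurable.aemeasurable) ?_⟩
  filter_upwards [hlim, hmem] with t ht hm
  refine nrm2_le_of_tendsto hm (fun n => hWm n t) ?_
  refine ht.congr fun n => ?_
  rw [normH_zero ((hWm n t).sub hm), ← eLpNorm_neg]
  congr 1
  ext x; simp

/-- The dual norm is a supremum over the unit ball, so χ is normalised first. Linearity on H²_D(D)
is an assumption because ξ is merely a map on functions; the summand 1 in c keeps it positive even
if χ = 0. -/
theorem exists_le_normHneg2 {L : ℝ} (hL : 0 < L) {χ : ℝ → ℝ} (hχ : MemH2D L χ) :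
    ∃ c : ℝ, 0 < c ∧ ∀ ξ : (ℝ → ℝ) → ℝ, (∀ v w a b, MemH2D L v → MemH2D L w →
      ξ (fun x => a * v x + b * w x) = a * ξ v + b * ξ w) →
      ENNReal.ofReal |ξ χ| ≤ ENNReal.ofReal c * normHneg2 L ξ := by
  set S := ∑ j ∈ Finset.range 3, eLpNorm ((dx L)^[j] χ) 2 (volume.restrict (dom L)) with hS
  have hSt : S ≠ ⊤ := by
    rw [hS, ← lt_top_iff_ne_top, ENNReal.sum_lt_top]
    intro j hj
    rw [Finset.mem_range] at hj
    exact (hχ.1.1 j (by omega)).2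
  set c := S.toReal + 1 with hc
  have hc0 : 0 < c := by have : 0 ≤ S.toReal := ENNReal.toReal_nonneg; linarith
  have hm := hχ.linComb hL hχ c⁻¹ 0
  have hn : normH L 2 (fun x => c⁻¹ * χ x + 0 * χ x) ≤ 1 := by
    refine (normH_two_le_sum hm.1).trans ?_
    have e : ∀ j ∈ Finset.range 3,
        eLpNorm ((dx L)^[j] (fun x => c⁻¹ * χ x + 0 * χ x)) 2 (volume.restrict (dom L))
          ≤ ENNReal.ofReal c⁻¹ * eLpNorm ((dx L)^[j] χ) 2 (volume.restrict (dom L)) := by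
      intro j hj
      rw [Finset.mem_range] at hj
      rw [eLpNorm_congr_ae ((hχ.1.linComb hχ.1 c⁻¹ 0).2 j (by omega))]
      refine eLpNorm_le_mul_eLpNorm_of_ae_le_mul (ae_of_all _ fun x => ?_) 2
      rw [zero_mul, add_zero, norm_mul, Real.norm_of_nonneg (by positivity)]
    refine (Finset.sum_le_sum e).trans ?_
    rw [← Finset.mul_sum, ← hS, ← ENNReal.ofReal_toReal hSt, ← ENNReal.ofReal_mul (by positivity)]
    refine ENNReal.ofReal_le_one.2 ?_
    rw [inv_mul_le_iff₀ hc0]; linarith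
  refine ⟨c, hc0, fun ξ hξ => ?_⟩
  have h1 : ENNReal.ofReal |ξ (fun x => c⁻¹ * χ x + 0 * χ x)| ≤ normHneg2 L ξ :=
    le_iSup₂_of_le (f := fun v (_ : MemH2D L v ∧ normH L 2 v ≤ 1) => ENNReal.ofReal |ξ v|)
      _ ⟨hm, hn⟩ le_rfl
  rw [hξ _ _ _ _ hχ hχ, zero_mul, add_zero, abs_mul, abs_of_pos (inv_pos.2 hc0),
    ENNReal.ofReal_mul (by positivity)] at h1
  calc ENNReal.ofReal |ξ χ| = ENNReal.ofReal c * (ENNReal.ofReal c⁻¹ * ENNReal.ofReal |ξ χ|) := by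
        rw [← mul_assoc, ← ENNReal.ofReal_mul hc0.le, mul_inv_cancel₀ hc0.ne', ENNReal.ofReal_one,
          one_mul]
    _ ≤ _ := by gcongr

/-! ### Weak solutions: integration of the stationary estimates in time. -/

namespace Data

variable {P : Data} {u₀ : ℝ → ℝ} {u : ℝ → ℝ → ℝ}

theorem IsWeakSolution.isTimeDeriv (hu : P.IsWeakSolution u₀ u) :
    IsTimeDeriv P.L u (timeDeriv P.L u) := by
  have h := hu.time.2
  rw [timeDeriv, dif_pos h]
  exact h.choose_spec

/-- The representation of the multiplier and the regularity of the solution, locally uniformly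
in time. -/
theorem IsWeakSolution.exists_local_bounds (hP : P.Admissible) (hu : P.IsWeakSolution u₀ u)
    {T : ℝ} (hT : 0 < T) : ∃ (C ρ c : ℝ) (χ : ℝ → ℝ), 0 ≤ C ∧ IsTestFun (dom P.L) χ ∧
      ∀ᵐ t ∂volume.restrict (Ioo (0 : ℝ) T), normH P.L 2 (u t) ≤ ENNReal.ofReal ρ ∧
        BV3 P.L (C * (1 + l2 P.L (timeDeriv P.L u t) + |P.zeta u t χ|)) (u t) ∧
        ENNReal.ofReal |P.zeta u t χ| ≤ ENNReal.ofReal c * normHneg2 P.L (P.zeta u t) ∧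
        (∃ μ : FiniteMeasure (dom P.L), ∀ v, MemH2D P.L v →
          -P.zeta u t v = ∫ x : dom P.L, v x ∂(μ : Measure (dom P.L))) ∧
        ∀ μ : FiniteMeasure (dom P.L), (∀ v, MemH2D P.L v →
          -P.zeta u t v = ∫ x : dom P.L, v x ∂(μ : Measure (dom P.L))) →
          (μ.mass : ℝ) = -P.zeta u t χ := by
  have hL := hP.L_pos
  -- One bound ρ in H² on (0, T) fixes r, χ and all constants, so that the estimates depend on t
  -- only through ∂ₜu and ζ.
  set S := essSup (fun t => normH2D P.L (u t)) (volume.restrict (Ioo (0 : ℝ) T)) with hS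
  have hSt : S < ⊤ := hu.bdd.2 T hT
  set ρ := S.toReal with hρ
  have hρ0 : 0 ≤ ρ := ENNReal.toReal_nonneg
  obtain ⟨r, hr0, hrL, hr⟩ := exists_radius hP ρ
  obtain ⟨χ, hχ, hχ1, hχr⟩ := exists_cutoff hr0 hrL
  obtain ⟨C, hC, hbv⟩ := exists_bv3_of_residual hP hρ0 hr hχ hχ1 hχr
  obtain ⟨c, -, hc⟩ := exists_le_normHneg2 hL (hχ.memH2D hL)
  refine ⟨C, ρ, c, χ, hC, hχ, ?_⟩
  have hsub : Ioo (0 : ℝ) T ⊆ Ioi 0 := Ioo_subset_Ioi_self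
  filter_upwards [ENNReal.ae_le_essSup (μ := volume.restrict (Ioo (0 : ℝ) T))
      (fun t => normH2D P.L (u t)),
    ae_restrict_of_ae_restrict_of_subset hsub hu.pairing,
    ae_restrict_of_ae_restrict_of_subset hsub hu.subdiff,
    ae_restrict_of_ae_restrict_of_subset hsub hu.isTimeDeriv.1.1.aemeasurable_l2.1,
    ae_restrict_mem measurableSet_Ioo] with t ht hF hs hw htT
  have hv : P.MemSbar (u t) := hu.constraint t htT.1.le
  have hn : normH P.L 2 (u t) ≤ ENNReal.ofReal ρ := by
    rw [hρ, ENNReal.ofReal_toReal hSt.ne]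
    exact (normH_two_le_normH2D _).trans ht
  have hl : l2 P.L (dx P.L (dx P.L (u t))) ≤ ρ :=
    ENNReal.toReal_le_of_le_ofReal hρ0 ((eLpNorm_le_normH_two hv.1.1 (j := 2) le_rfl).trans hn)
  have hz : ∀ φ, -P.zeta u t φ = P.residual (timeDeriv P.L u t) (u t) φ := neg_zeta u t
  have hz' : P.zeta u t = fun φ => -P.residual (timeDeriv P.L u t) (u t) φ := by
    ext φ; rw [← hz, neg_neg]
  have hlin := residual_linComb hL hw hv.1 hF
  have hpos := residual_nonneg hP hw hv hF (by rw [← hz']; exact hs) (hr _ hv hl)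
  have hmass : ∀ μ : FiniteMeasure (dom P.L), (∀ v, MemH2D P.L v →
      P.residual (timeDeriv P.L u t) (u t) v = ∫ x : dom P.L, v x ∂(μ : Measure (dom P.L))) →
      (μ.mass : ℝ) = P.residual (timeDeriv P.L u t) (u t) χ :=
    fun μ hμ => mass_eq_of_cutoff hL hrL hlin hpos hμ hχ hχr
  obtain ⟨μ, hμ⟩ := exists_finiteMeasure_of_nonneg hL hr0 hrL hlin hpos
  refine ⟨hn, ?_, hc _ fun v w a b hv hw => ?_, ⟨μ, fun v hv => by rw [hz]; exact hμ v hv⟩,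
    fun μ' hμ' => ?_⟩
  · have := hbv (u t) (timeDeriv P.L u t) μ hv hl hw hF hμ (hmass μ hμ)
    rwa [← hz, abs_neg] at this
  · rw [hz']
    simp only [hlin _ _ _ _ hv hw]
    ring
  · rw [hz]
    exact hmass μ' fun v hv => by rw [← hz]; exact hμ' v hv

theorem IsWeakSolution.aemeasurable_zeta (hP : P.Admissible) (hu : P.IsWeakSolution u₀ u)
    {φ : ℝ → ℝ} (hφ : IsTestFun (dom P.L) φ) :
    AEMeasurable (fun t => P.zeta u t φ) (volume.restrict (Ioi 0)) :=
  hu.zeta_mem.1 φ (hφ.memH2D hP.L_pos)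

theorem ae_Ioi_of_Ioo {p : ℝ → Prop}
    (h : ∀ k : ℕ, ∀ᵐ t ∂volume.restrict (Ioo (0 : ℝ) ((k : ℝ) + 1)), p t) :
    ∀ᵐ t ∂volume.restrict (Ioi (0 : ℝ)), p t := by
  have e : (Ioi (0 : ℝ)) = ⋃ k : ℕ, Ioo (0 : ℝ) ((k : ℝ) + 1) := by
    ext t
    simp only [mem_Ioi, mem_iUnion, mem_Ioo]
    constructor
    · intro ht
      obtain ⟨k, hk⟩ := exists_nat_gt t
      exact ⟨k, ht, by linarith⟩
    · rintro ⟨k, hk, -⟩; exact hk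
  rw [e, ae_restrict_iUnion_iff]
  exact h

/-- The multiplier is a nonpositive measure. -/
theorem IsWeakSolution.memL2LocMeasPos (hP : P.Admissible) (hu : P.IsWeakSolution u₀ u) :
    MemL2LocMeasPos P.L (fun t v => -P.zeta u t v) := by
  classical
  have hL := hP.L_pos
  have hex : ∀ᵐ t ∂volume.restrict (Ioi (0 : ℝ)), ∃ μ : FiniteMeasure (dom P.L), ∀ v, MemH2D P.L v →
      -P.zeta u t v = ∫ x : dom P.L, v x ∂(μ : Measure (dom P.L)) := by
    refine ae_Ioi_of_Ioo fun k => ?_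
    obtain ⟨C, ρ, c, χ, -, -, h⟩ := hu.exists_local_bounds hP (T := (k : ℝ) + 1) (by positivity)
    filter_upwards [h] with t ht using ht.2.2.2.1
  -- No measurable selection is needed: integrals of test functions against μ(t) equal -ζ(t) for
  -- a.e. t, however the measure is chosen, and they determine the other integrals by limits.
  set μ : ℝ → FiniteMeasure (dom P.L) := fun t =>
    if h : ∃ μ : FiniteMeasure (dom P.L), ∀ v, MemH2D P.L v →
      -P.zeta u t v = ∫ x : dom P.L, v x ∂(μ : Measure (dom P.L)) then h.choose else 0 with hμ
  have hrep : ∀ᵐ t ∂volume.restrict (Ioi (0 : ℝ)), ∀ v, MemH2D P.L v →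
      -P.zeta u t v = ∫ x : dom P.L, v x ∂(μ t : Measure (dom P.L)) := by
    filter_upwards [hex] with t ht
    simp only [hμ]
    rw [dif_pos ht]
    exact ht.choose_spec
  have htest : ∀ φ, IsTestFun (dom P.L) φ →
      AEMeasurable (fun t => ∫ x : dom P.L, φ x ∂(μ t : Measure (dom P.L)))
        (volume.restrict (Ioi 0)) := fun φ hφ => by
    refine (hu.aemeasurable_zeta hP hφ).neg.congr ?_
    filter_upwards [hrep] with t ht using ht φ (hφ.memH2D hL)
  -- The constant 1 is not in C₀(D), so the mass is reached as the limit of integrals of exhausting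
  -- cutoffs.
  have hmass : AEMeasurable (fun t => ((μ t).mass : ℝ)) (volume.restrict (Ioi 0)) := by
    obtain ⟨χ, h1, h2, h3⟩ := exists_cutoff_seq hL
    exact aemeasurable_of_tendsto_metrizable_ae atTop (fun n => htest _ (h1 n))
      (ae_of_all _ fun t => tendsto_integral_cutoff h1 h2 h3 (μ t))
  refine ⟨μ, hrep, fun f => ?_, ?_, fun T hT => ?_⟩
  · obtain ⟨φ, c, h1, h2, h3⟩ := exists_testFun_tendsto hL f
    refine aemeasurable_of_tendsto_metrizable_ae atTop (fun n => htest _ (h1 n))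
      (ae_of_all _ fun t => ?_)
    exact tendsto_integral_of_bdd (f := fun n (x : dom P.L) => φ n x)
      (fun n => ((h1 n).continuous.comp continuous_subtype_val).aestronglyMeasurable) h2 h3
  · simpa only [Real.toNNReal_coe] using hmass.real_toNNReal
  · obtain ⟨C, ρ, c, χ, -, -, h⟩ := hu.exists_local_bounds hP hT
    have hb : ∀ᵐ t ∂volume.restrict (Ioo (0 : ℝ) T), ((μ t).mass : ℝ≥0∞) ^ 2
        ≤ ENNReal.ofReal c ^ 2 * normHneg2 P.L (P.zeta u t) ^ 2 := by
      filter_upwards [h, ae_restrict_of_ae_restrict_of_subset Ioo_subset_Ioi_self hrep] with t ht hr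
      rw [← mul_pow]
      refine pow_le_pow_left' (le_trans ?_ ht.2.2.1) 2
      rw [← ENNReal.ofReal_coe_nnreal, ht.2.2.2.2 (μ t) hr]
      exact ENNReal.ofReal_le_ofReal (neg_le_abs _)
    refine (lintegral_mono_ae hb).trans_lt ?_
    rw [lintegral_const_mul' _ _ (by finiteness)]
    exact ENNReal.mul_lt_top (by finiteness) (hu.zeta_mem.2 T hT)

/-- The bounds are obtained on each interval (0, k+1) with their own constants and cutoff. Taking k
= ⌊t⌋ makes one measurable bound on (0, ∞), as `stronglyMeas_normH` requires. -/
theorem aemeasurable_glue {ν : Measure ℝ} {f : ℕ → ℝ → ℝ} (hf : ∀ k, AEMeasurable (f k) ν)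
    {κ : ℝ → ℕ} (hκ : Measurable κ) : AEMeasurable (fun t => f (κ t) t) ν := by
  refine ⟨fun t => (hf (κ t)).mk _ t, ?_, ?_⟩
  · have h : Measurable fun p : ℕ × ℝ => (hf p.1).mk _ p.2 :=
      measurable_from_prod_countable_right fun k => (hf k).measurable_mk
    exact h.comp (hκ.prodMk measurable_id)
  · have h : ∀ᵐ t ∂ν, ∀ k, f k t = (hf k).mk _ t := ae_all_iff.2 fun k => (hf k).ae_eq_mk
    filter_upwards [h] with t ht using ht _

/-- The spatial regularity of weak solutions. -/
theorem IsWeakSolution.memL2Loc (hP : P.Admissible) (hu : P.IsWeakSolution u₀ u) {s : ℝ}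
    (h1 : 2 < s) (h2 : s < 7 / 2) : MemL2Loc (normH P.L s) u := by
  have hL := hP.L_pos
  have hlw := hu.isTimeDeriv.1.1.aemeasurable_l2.2
  constructor
  · choose C ρ c χ hC hχ h using fun k : ℕ =>
      hu.exists_local_bounds hP (T := (k : ℝ) + 1) (by positivity)
    have hm : ∀ k, AEMeasurable
        (fun t => C k * (1 + l2 P.L (timeDeriv P.L u t) + |P.zeta u t (χ k)|))
        (volume.restrict (Ioi 0)) := fun k =>
      ((hlw.const_add 1).add (hu.aemeasurable_zeta hP (hχ k)).abs).const_mul _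
    refine stronglyMeas_normH hL h1 h2 hu.bdd.1 (aemeasurable_glue hm Nat.measurable_floor)
      (?_ : ∀ᵐ t ∂volume.restrict (Ioi (0 : ℝ)), _)
    have hall : ∀ᵐ t ∂(volume : Measure ℝ), ∀ k : ℕ, t ∈ Ioo (0 : ℝ) ((k : ℝ) + 1) →
        BV3 P.L (C k * (1 + l2 P.L (timeDeriv P.L u t) + |P.zeta u t (χ k)|)) (u t) :=
      ae_all_iff.2 fun k => by
        have := (ae_restrict_iff' measurableSet_Ioo).1 (h k)
        filter_upwards [this] with t ht htk using (ht htk).2.1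
    rw [ae_restrict_iff' measurableSet_Ioi]
    filter_upwards [hall] with t ht ht0
    exact ht ⌊t⌋₊ ⟨ht0, Nat.lt_floor_add_one t⟩
  · intro T hT
    obtain ⟨C, ρ, c, χ, hC, hχ, h⟩ := hu.exists_local_bounds hP hT
    obtain ⟨K, hK, hKb⟩ := exists_normH_sq_le hL h1 h2
    have hsub : Ioo (0 : ℝ) T ⊆ Ioi 0 := Ioo_subset_Ioi_self
    have hlw' : AEMeasurable (fun t => ENNReal.ofReal (l2 P.L (timeDeriv P.L u t) ^ 2))
        (volume.restrict (Ioo (0 : ℝ) T)) :=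
      ((hlw.mono_measure (Measure.restrict_mono hsub le_rfl)).pow_const 2).ennreal_ofReal
    -- The factor 3 comes from (1 + x + y)² ≤ 3(1 + x² + y²), with x the norm of ∂ₜu and y = |⟨ζ,
    -- χ⟩|. The latter is replaced by the dual norm, whose square is integrable on (0, T).
    have hb : ∀ᵐ t ∂volume.restrict (Ioo (0 : ℝ) T), normH P.L s (u t) ^ 2
        ≤ K * (ENNReal.ofReal ρ ^ 2 + ENNReal.ofReal (3 * C ^ 2) *
          (1 + (ENNReal.ofReal (l2 P.L (timeDeriv P.L u t) ^ 2)
            + ENNReal.ofReal c ^ 2 * normHneg2 P.L (P.zeta u t) ^ 2))) := by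
      filter_upwards [h] with t ht
      refine (hKb _ _ ht.2.1).trans ?_
      refine mul_le_mul_right (add_le_add (pow_le_pow_left' ht.1 2) ?_) _
      rw [← mul_pow]
      have e1 := pow_le_pow_left' ht.2.2.1 2
      rw [← ENNReal.ofReal_pow (abs_nonneg _)] at e1
      refine le_trans ?_ (mul_le_mul_right (add_le_add_right (add_le_add_right e1 _) _) _)
      rw [← ENNReal.ofReal_add (by positivity) (by positivity), ← ENNReal.ofReal_one,
        ← ENNReal.ofReal_add (by positivity) (by positivity), ← ENNReal.ofReal_mul (by positivity)]
      refine ENNReal.ofReal_le_ofReal ?_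
      rw [mul_pow, mul_comm (3 : ℝ), mul_assoc]
      refine mul_le_mul_of_nonneg_left ?_ (sq_nonneg C)
      set x := l2 P.L (timeDeriv P.L u t)
      set y := |P.zeta u t χ|
      nlinarith [sq_nonneg (x - y), sq_nonneg (x - 1), sq_nonneg (y - 1)]
    refine (lintegral_mono_ae hb).trans_lt ?_
    rw [lintegral_const_mul' _ _ hK, lintegral_add_left measurable_const,
      lintegral_const_mul' _ _ ENNReal.ofReal_ne_top, lintegral_add_left measurable_const,
      lintegral_add_left' hlw', lintegral_const_mul' _ _ (by finiteness)]
    have f1 : ∫⁻ t in Ioo (0 : ℝ) T, ENNReal.ofReal (l2 P.L (timeDeriv P.L u t) ^ 2) < ⊤ := by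
      refine lt_of_le_of_lt (lintegral_mono fun t => ?_) (hu.isTimeDeriv.1.2 T hT)
      rw [ENNReal.ofReal_pow (l2_nonneg _ _)]
      exact pow_le_pow_left' (ENNReal.ofReal_toReal_le.trans (eLpNorm_le_normH_zero _)) 2
    have f2 := hu.zeta_mem.2 T hT
    have f3 : ∀ a : ℝ≥0∞, a < ⊤ → ∫⁻ _ in Ioo (0 : ℝ) T, a < ⊤ := fun a ha => by
      rw [setLIntegral_const, Real.volume_Ioo]
      exact ENNReal.mul_lt_top ha ENNReal.ofReal_lt_top
    have f4 := f3 (ENNReal.ofReal ρ ^ 2) (by finiteness)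
    have f5 := f3 1 ENNReal.one_lt_top
    finiteness

end Data

end MEMS

theorem corollary2 (P : MEMS.Data) (hP : P.Admissible) (u₀ : ℝ → ℝ) (hu₀ : P.MemSbar u₀)
    (u : ℝ → ℝ → ℝ) (hu : P.IsWeakSolution u₀ u) :
    (∀ s : ℝ, 2 < s → s < 7 / 2 → MEMS.MemL2Loc (MEMS.normH P.L s) u) ∧
      MEMS.MemL2LocMeasPos P.L (fun t v => - P.zeta u t v) :=
  ⟨fun _ h1 h2 => hu.memL2Loc hP h1 h2, hu.memL2LocMeasPos hP⟩
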